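/- Let $G$ be a connected, simply connected Lie group whose Lie algebra $\mathfrak g$ is completely solvable (solvable, with every $\mathrm{ad}\,Z$ having only real eigenvalues), and suppose $G=P\rtimes M$ where $P=\exp\mathfrak p$ (normal) and $M=\exp\mathfrak m$ are closed subgroups and $\mathfrak g=\mathfrak p\oplus\mathfrak m$ with $\mathfrak p$ an ideal and $\mathfrak m$ a subalgebra. Fix a left Haar measure $\mu_M$ on $M$. Let $\lambda\in\mathfrak p^*$ be such that $\chi_\lambda(\exp X)=e^{2\pi i\lambda(X)}$ is a continuous unitary character of $P$ and the induced representation $\pi_\lambda=\mathrm{ind}_P^G\chi_\lambda$, realized in $L^2(M,\mu_M)$ by $$[\pi_\lambda(pn)\mathbf f](m)=\chi_\lambda(m^{-1}pm)\,\mathbf f(n^{-1}m)\qquad(p\in P,\ n,m\in M),$$ is irreducible. Let $(X_1,\dots,X_{n_1})$ and $(A_1,\dots,A_{n_2})$ be strong Malcev bases of $\mathfrak p$ and $\mathfrak m$ (all initial spans are ideals of $\mathfrak p$, resp. $\mathfrak m$). For $a\in\mathbb R^{n_2}$ put $\mathbf e(a)=\exp(a_1A_1)\cdots\exp(a_{n_2}A_{n_2})$,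 $\mathbf C(a)=e^{-\mathrm{ad}(a_{n_2}A_{n_2})}\cdots e^{-\mathrm{ad}(a_1A_1)}|_{\mathfrak p}$ and $\theta_\lambda(a)=\mathbf C(a)^*\lambda\in\mathfrak p^*$. Let $J=(j_1<\dots<j_{n_2})$ be such that the rows $j_1,\dots,j_{n_2}$ of the Jacobian matrix of $\theta_\lambda$ at $0$ (in the bases $(A_k)$, $(X_j^*)$) form an invertible matrix, and let $\beta_J(a)=\sum_{j\in J}\theta_\lambda(a)(X_j)\,X_j^*\in V_J^*:=\sum_{j\in J}\mathbb RX_j^*$. Let $\mathcal O\subset\mathbb R^{n_2}$ be an open neighbourhood of $0$ on which $\beta_J$ is a diffeomorphism onto an open set, let $\epsilon>0$ with $[-\frac\epsilon2,\frac\epsilon2]^{n_2}\subset\mathcal O$, and put $\mathcal O_\epsilon=(-\frac\epsilon2,\frac\epsilon2)^{n_2}$, $\Omega_\epsilon^\circ=\mathbf e(\mathcal O_\epsilon)\subset M$. Define $\Phi:\Omega_\epsilon^\circ\to\beta_J(\mathcal O_\epsilon)$ by $\Phi(\mathbf e(a))=\beta_J(a)$, and let $\Psi$ be the continuous positive function on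 $\beta_J(\mathcal O_\epsilon)$ with $\Psi(\xi)\,d\xi=d\mu_M(\Phi^{-1}(\xi))$, where $d\xi$ is Lebesgue measure in the coordinates given by $(X_j^*)_{j\in J}$. Let $\mathbf s\in C_c^\infty(M)$ be supported in a compact subset of $\Omega_\epsilon^\circ$. Let $\mathcal L$ be an invertible linear operator of $\sum_{j\in J}\mathbb RX_j$, with inverse transpose $\mathcal L^\top$, such that $\Phi(\mathrm{supp}\,\mathbf s)$ is contained in a fundamental domain of the lattice $\Lambda^\star=\sum_{j\in J}\mathbb Z\,\mathcal L^\top X_j^*$ of $V_J^*$, and put $\Gamma_P=\exp\big(\sum_{j\in J}\mathbb Z\,\mathcal LX_j\big)\subset P$. Let $$\Upsilon(m)=\sqrt{\Psi(\Phi(m))\,|\det\mathcal L^\top|}\;\mathbf s(m)\quad(m\in\Omega_\epsilon^\circ),\qquad \Upsilon=0\text{ elsewhere on }M,$$ and let $\Gamma_M\subset M$ be a discrete set with $$A:=\inf_{m\in M}\sum_{\gamma\in\Gamma_M}|\Upsilon(\gamma m)|^2>0,\qquad B:=\sup_{m\in M}\sum_{\gamma\in\Gamma_M}|\Upsilon(\gamma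 m)|^2<\infty.$$ Then, with $\Gamma=\Gamma_M^{-1}\Gamma_P$, the family $(\pi_\lambda(\kappa)\mathbf s)_{\kappa\in\Gamma}$ is a frame for $L^2(M,\mu_M)$, that is, there are constants $0<a\le b$ with $$a\|\mathbf h\|^2\le\sum_{\kappa\in\Gamma}|\langle\mathbf h,\pi_\lambda(\kappa)\mathbf s\rangle|^2\le b\|\mathbf h\|^2\qquad\text{for all }\mathbf h\in L^2(M,\mu_M);$$ moreover the largest possible lower bound $a$ is $A$ and the smallest possible upper bound $b$ is $B$. -/

import Mathlib

open MeasureTheory Set Filter Topology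
open scoped Manifold ContDiff Matrix Pointwise ENNReal InnerProductSpace

noncomputable section

namespace SolvFrame

/-! ### Lie groups, exponential map, completely solvable Lie algebras -/

/-- The regularity that Mathlib asks for in order to form the Lie algebra of a Lie group holds for
every smooth real Lie group. -/
instance instLieGroupMin {d : ℕ} {G : Type*} [TopologicalSpace G]
    [ChartedSpace (EuclideanSpace ℝ (Fin d)) G] [Group G] [LieGroup (𝓡 d) ∞ G] :
    LieGroup (𝓡 d) (minSmoothness ℝ 3) G :=
  LieGroup.of_le (n := ∞) (by
    rw [minSmoothness_of_isRCLikeNormedField]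
    exact ENat.LEInfty.out)

instance instFiniteLieAlgebra {d : ℕ} {G : Type*} [TopologicalSpace G]
    [ChartedSpace (EuclideanSpace ℝ (Fin d)) G] [Group G] :
    Module.Finite ℝ (GroupLieAlgebra (𝓡 d) G) :=
  inferInstanceAs (Module.Finite ℝ (EuclideanSpace ℝ (Fin d)))

section LieGroup

variable {d : ℕ} {G : Type*} [TopologicalSpace G] [ChartedSpace (EuclideanSpace ℝ (Fin d)) G]
  [Group G]

/-- The exponential map of the Lie group `G`: `exp X` is the value at time `1` of the global
integral curve, starting at `1`, of the left-invariant vector field defined by `X`. -/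
def lieExp (X : GroupLieAlgebra (𝓡 d) G) : G :=
  Classical.epsilon (fun γ : ℝ → G =>
    γ 0 = 1 ∧ IsMIntegralCurve (I := 𝓡 d) γ (mulInvariantVectorField X)) 1

end LieGroup

/-- A finite-dimensional real Lie algebra is completely solvable if it is solvable and every
`ad Z` has only real (complex) eigenvalues. -/
def IsCompletelySolvable (L : Type*) [LieRing L] [LieAlgebra ℝ L] [Module.Finite ℝ L] : Prop :=
  LieAlgebra.IsSolvable L ∧
    ∀ (Z : L) (z : ℂ), Polynomial.aeval z (LieAlgebra.ad ℝ L Z).charpoly = 0 → z.im = 0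

/-- An ordered basis `b` of a Lie algebra is a strong Malcev basis if all the initial spans
`ℝ b₁ + ⋯ + ℝ bᵢ` are ideals. -/
def IsStrongMalcev {L : Type*} [LieRing L] [LieAlgebra ℝ L] {n : ℕ}
    (b : Module.Basis (Fin n) ℝ L) : Prop :=
  ∀ i : Fin n, ∀ x : L, ∀ y ∈ Submodule.span ℝ (b '' Set.Iic i),
    ⁅x, y⁆ ∈ Submodule.span ℝ (b '' Set.Iic i)

/-! ### The orbit maps -/

section Orbit

variable {d : ℕ} {G : Type*} [TopologicalSpace G] [ChartedSpace (EuclideanSpace ℝ (Fin d)) G]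
  [Group G] [LieGroup (𝓡 d) ∞ G]
  {𝔪 : LieSubalgebra ℝ (GroupLieAlgebra (𝓡 d) G)} {𝔭 : LieIdeal ℝ (GroupLieAlgebra (𝓡 d) G)}
  {n₁ n₂ : ℕ}

/-- Canonical coordinates of the second kind, `e(a) = exp (a₁ A₁) ⋯ exp (aₙ Aₙ)`. -/
def secondKind (A : Module.Basis (Fin n₂) ℝ 𝔪) (a : Fin n₂ → ℝ) : G :=
  (List.ofFn fun k => lieExp (a k • (A k : GroupLieAlgebra (𝓡 d) G))).prod

/-- The linear operator `C(a) = e^{-ad (aₙ Aₙ)} ⋯ e^{-ad (a₁ A₁)}` of the ideal `𝔭`; the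
exponentials are computed on matrices with respect to the basis `X` of `𝔭`. -/
def opC (A : Module.Basis (Fin n₂) ℝ 𝔪) (X : Module.Basis (Fin n₁) ℝ 𝔭) (a : Fin n₂ → ℝ) :
    𝔭 →ₗ[ℝ] 𝔭 :=
  Matrix.toLin X X
    (List.ofFn fun k => NormedSpace.exp
      (-(LinearMap.toMatrix X X
        (LieModule.toEnd ℝ (GroupLieAlgebra (𝓡 d) G) 𝔭
          (a k • (A k : GroupLieAlgebra (𝓡 d) G)))))).reverse.prod

/-- The map `θ_λ(a) = C(a)^* λ`, with values in `𝔭^*`. -/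
def theta (A : Module.Basis (Fin n₂) ℝ 𝔪) (X : Module.Basis (Fin n₁) ℝ 𝔭) (lam : Module.Dual ℝ 𝔭)
    (a : Fin n₂ → ℝ) : Module.Dual ℝ 𝔭 :=
  lam ∘ₗ opC A X a

/-- The Jacobian matrix at `0` of `θ_λ` with respect to the bases `A` and `X^*`. -/
def jacZero (A : Module.Basis (Fin n₂) ℝ 𝔪) (X : Module.Basis (Fin n₁) ℝ 𝔭)
    (lam : Module.Dual ℝ 𝔭) : Matrix (Fin n₁) (Fin n₂) ℝ :=
  Matrix.of fun j k => fderiv ℝ (fun a => theta A X lam a (X j)) 0 (Pi.single k 1)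

/-- The map `β_J(a) = P_J^* C(a)^* λ`, an element of `∑_{j ∈ J} ℝ X_j^*`, given by its coordinates
in the basis `(X_j^*)_{j ∈ J}`. -/
def beta (A : Module.Basis (Fin n₂) ℝ 𝔪) (X : Module.Basis (Fin n₁) ℝ 𝔭) (lam : Module.Dual ℝ 𝔭)
    (J : Fin n₂ ↪o Fin n₁) (a : Fin n₂ → ℝ) : Fin n₂ → ℝ :=
  fun i => theta A X lam a (X (J i))

end Orbit

/-- The restriction of `f` to the open set `U` is a (smooth) diffeomorphism onto an open set. -/
def IsDiffeoOn {n : ℕ} (f : (Fin n → ℝ) → (Fin n → ℝ)) (U : Set (Fin n → ℝ)) : Prop :=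
  IsOpen U ∧ IsOpen (f '' U) ∧ ContDiffOn ℝ ∞ f U ∧
    ∃ g : (Fin n → ℝ) → (Fin n → ℝ), ContDiffOn ℝ ∞ g (f '' U) ∧ LeftInvOn g f U

/-- The open cube `(-ε/2, ε/2)ⁿ`. -/
def openCube (n : ℕ) (ε : ℝ) : Set (Fin n → ℝ) := Set.univ.pi fun _ => Set.Ioo (-(ε / 2)) (ε / 2)

/-- The closed cube `[-ε/2, ε/2]ⁿ`. -/
def closedCube (n : ℕ) (ε : ℝ) : Set (Fin n → ℝ) := Set.univ.pi fun _ => Set.Icc (-(ε / 2)) (ε / 2)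

section Smooth

variable {d : ℕ} {G : Type*} [TopologicalSpace G] [ChartedSpace (EuclideanSpace ℝ (Fin d)) G]
  [Group G]

/-- Smooth complex functions on a closed subgroup (an embedded submanifold) of `G`: those that are
locally restrictions of smooth functions on `G`. -/
def IsSmoothFun (d : ℕ) {G : Type*} [TopologicalSpace G]
    [ChartedSpace (EuclideanSpace ℝ (Fin d)) G] [Group G] {M : Subgroup G} (s : M → ℂ) : Prop :=
  ∀ m : M, ∃ F : G → ℂ, ContMDiff (𝓡 d) 𝓘(ℝ, ℂ) ∞ F ∧ ∀ᶠ x : M in 𝓝 m, s x = F x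

theorem IsSmoothFun.continuous {M : Subgroup G} {s : M → ℂ} (hs : IsSmoothFun d s) :
    Continuous s := by
  refine continuous_iff_continuousAt.2 fun m => ?_
  obtain ⟨F, hF, h⟩ := hs m
  exact ((hF.continuous.comp continuous_subtype_val).continuousAt).congr (h.mono fun x hx => hx.symm)

end Smooth

/-! ### The representation induced by a unitary character -/

theorem norm_coeHom (z : Circle) : ‖Circle.coeHom z‖ = 1 := Circle.norm_coe z

theorem continuous_coeHom : Continuous fun z : Circle => Circle.coeHom z :=
  continuous_subtype_val

theorem memLp_mulCircle {Y : Type*} [TopologicalSpace Y] [MeasurableSpace Y] [BorelSpace Y]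
    (μ : Measure Y) (u : C(Y, Circle)) (f : Lp ℂ 2 μ) :
    MemLp (fun y => Circle.coeHom (u y) * f y) 2 μ :=
  (Lp.memLp f).of_le
    ((continuous_coeHom.comp u.continuous).aestronglyMeasurable.mul (Lp.aestronglyMeasurable f))
    (Eventually.of_forall fun y => by rw [norm_mul, norm_coeHom, one_mul])

/-- Multiplication by a continuous function of modulus one, as an isometry of `L²`. -/
def mulCircle {Y : Type*} [TopologicalSpace Y] [MeasurableSpace Y] [BorelSpace Y] (μ : Measure Y)
    (u : C(Y, Circle)) : Lp ℂ 2 μ →ₗᵢ[ℂ] Lp ℂ 2 μ where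
  toFun f := (memLp_mulCircle μ u f).toLp fun y => Circle.coeHom (u y) * f y
  map_add' f g := by
    refine Lp.ext ?_
    filter_upwards [(memLp_mulCircle μ u (f + g)).coeFn_toLp, (memLp_mulCircle μ u f).coeFn_toLp,
      (memLp_mulCircle μ u g).coeFn_toLp, Lp.coeFn_add f g,
      Lp.coeFn_add ((memLp_mulCircle μ u f).toLp _) ((memLp_mulCircle μ u g).toLp _)]
      with y h₁ h₂ h₃ h₄ h₅
    rw [h₁, h₅, Pi.add_apply, h₂, h₃, h₄, Pi.add_apply, mul_add]
  map_smul' c f := by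
    refine Lp.ext ?_
    filter_upwards [(memLp_mulCircle μ u (c • f)).coeFn_toLp, (memLp_mulCircle μ u f).coeFn_toLp,
      Lp.coeFn_smul c f, Lp.coeFn_smul c ((memLp_mulCircle μ u f).toLp _)] with y h₁ h₂ h₃ h₄
    rw [h₁, RingHom.id_apply, h₄, Pi.smul_apply, h₂, h₃, Pi.smul_apply, smul_eq_mul, smul_eq_mul]
    ring
  norm_map' f := by
    refine (Lp.norm_toLp _ (memLp_mulCircle μ u f)).trans ?_
    rw [Lp.norm_def]
    congr 1
    exact eLpNorm_congr_norm_ae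
      (Eventually.of_forall fun y => by rw [norm_mul, norm_coeHom, one_mul])

section Rep

variable {G : Type*} [TopologicalSpace G] [Group G] [IsTopologicalGroup G] {P M : Subgroup G}

/-- Conjugation `m ↦ m⁻¹ p m`, with values in the normal subgroup `P`. -/
def conjP [hP : P.Normal] (p : P) (m : M) : P :=
  ⟨(m : G)⁻¹ * p * m, by simpa using hP.conj_mem p p.2 (m : G)⁻¹⟩

theorem continuous_conjP [P.Normal] (p : P) : Continuous (conjP p : M → P) :=
  Continuous.subtype_mk (by fun_prop) _

variable [MeasurableSpace G] [BorelSpace G]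

/-- The representation `π = ind_P^G χ` of `G = P ⋊ M` realized in `L²(M, μ)`: if `g = p n` with
`p ∈ P` and `n ∈ M`, then `(π(g) f)(m) = χ(m⁻¹ p m) f(n⁻¹ m)`. -/
def indRep [P.Normal] (hPM : P.IsComplement' M) (χ : P →ₜ* Circle) (μ : Measure M)
    [μ.IsMulLeftInvariant] (g : G) : Lp ℂ 2 μ →ₗᵢ[ℂ] Lp ℂ 2 μ :=
  (mulCircle μ ⟨fun m => χ (conjP (hPM.equiv g).1 m),
      χ.continuous_toFun.comp (continuous_conjP (P := P) (hPM.equiv g).1)⟩).comp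
    (Lp.compMeasurePreservingₗᵢ ℂ (fun m : M => ((hPM.equiv g).2 : M)⁻¹ * m)
      (measurePreserving_mul_left μ ((hPM.equiv g).2 : M)⁻¹))

theorem indRep_ae [P.Normal] (hPM : P.IsComplement' M) (χ : P →ₜ* Circle) (μ : Measure M)
    [μ.IsMulLeftInvariant] (p : P) (n : M) (f : Lp ℂ 2 μ) :
    indRep hPM χ μ ((p : G) * n) f =ᵐ[μ] fun m => Circle.coeHom (χ (conjP p m)) * f (n⁻¹ * m) := by
  have h : hPM.equiv ((p : G) * n) = (p, n) := (Equiv.eq_symm_apply hPM.equiv).1 rfl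
  have h₁ : (hPM.equiv ((p : G) * n)).1 = p := by rw [h]
  have h₂ : (hPM.equiv ((p : G) * n)).2 = n := by rw [h]
  refine (MemLp.coeFn_toLp (memLp_mulCircle μ _ _)).trans ?_
  filter_upwards [Lp.coeFn_compMeasurePreserving f
    (measurePreserving_mul_left μ ((hPM.equiv ((p : G) * n)).2 : M)⁻¹)] with m hm
  refine (congrArg _ hm).trans ?_
  simp only [ContinuousMap.coe_mk, h₁, h₂, Function.comp]

/-- Irreducibility: the only closed invariant subspaces are `0` and the whole space. -/
def IsIrreducibleRep {H : Type*} [NormedAddCommGroup H] [InnerProductSpace ℂ H]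
    (π : G → H →ₗᵢ[ℂ] H) : Prop :=
  Nontrivial H ∧ ∀ W : Submodule ℂ H, IsClosed (W : Set H) → (∀ g, ∀ f ∈ W, π g f ∈ W) →
    W = ⊥ ∨ W = ⊤

end Rep

/-! ### Frames -/

section Frame

variable {H : Type*} [NormedAddCommGroup H] [InnerProductSpace ℂ H] {ι : Type*}

/-- `a` is a lower frame bound: `a > 0` and `a ‖h‖² ≤ ∑ |⟨h, vᵢ⟩|²` for all `h`. -/
def IsLowerFrameBound (v : ι → H) (a : ℝ) : Prop :=
  0 < a ∧ ∀ h : H, ENNReal.ofReal (a * ‖h‖ ^ 2) ≤ ∑' i, ‖⟪h, v i⟫_ℂ‖ₑ ^ 2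

/-- `b` is an upper frame bound: `b > 0` and `∑ |⟨h, vᵢ⟩|² ≤ b ‖h‖²` for all `h`. -/
def IsUpperFrameBound (v : ι → H) (b : ℝ) : Prop :=
  0 < b ∧ ∀ h : H, ∑' i, ‖⟪h, v i⟫_ℂ‖ₑ ^ 2 ≤ ENNReal.ofReal (b * ‖h‖ ^ 2)

/-- The family `v` is a frame of `H`. -/
def IsFrame (v : ι → H) : Prop :=
  ∃ a b : ℝ, a ≤ b ∧ IsLowerFrameBound v a ∧ IsUpperFrameBound v b

end Frame

/-! ### The data of the construction -/

section Construction

variable {d : ℕ} {G : Type*} [TopologicalSpace G] [ChartedSpace (EuclideanSpace ℝ (Fin d)) G]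
  [Group G] [LieGroup (𝓡 d) ∞ G] {M : Subgroup G}
  {𝔪 : LieSubalgebra ℝ (GroupLieAlgebra (𝓡 d) G)} {𝔭 : LieIdeal ℝ (GroupLieAlgebra (𝓡 d) G)}
  {n₁ n₂ : ℕ}

/-- The set `Ω_ε° = exp ((-ε/2, ε/2) A₁) ⋯ exp ((-ε/2, ε/2) Aₙ)`, as a subset of `M`. -/
def omegaOpen (M : Subgroup G) (A : Module.Basis (Fin n₂) ℝ 𝔪) (ε : ℝ) : Set M :=
  {m | (m : G) ∈ secondKind A '' openCube n₂ ε}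

/-- The map `Φ` with `Φ(e(a)) = β_J(a)` for `a` in the open cube; only its values on `Ω_ε°`
are meaningful. -/
def phi (A : Module.Basis (Fin n₂) ℝ 𝔪) (X : Module.Basis (Fin n₁) ℝ 𝔭) (lam : Module.Dual ℝ 𝔭)
    (J : Fin n₂ ↪o Fin n₁) (ε : ℝ) (m : M) : Fin n₂ → ℝ :=
  beta A X lam J (Function.invFunOn (secondKind A) (openCube n₂ ε) (m : G))

/-- `Ψ` is a continuous version, on `β_J(O_ε)`, of the Radon–Nikodym derivative with respect to
Lebesgue measure of the image under `Φ` of the Haar measure of `Ω_ε°`, that is,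
`Ψ(ξ) dξ = dμ_M(Φ⁻¹(ξ))`. It is unique on the open set `β_J(O_ε)`. -/
def IsHaarDensity [MeasurableSpace G] (A : Module.Basis (Fin n₂) ℝ 𝔪)
    (X : Module.Basis (Fin n₁) ℝ 𝔭) (lam : Module.Dual ℝ 𝔭) (J : Fin n₂ ↪o Fin n₁) (ε : ℝ)
    (μ : Measure M) (Ψ : (Fin n₂ → ℝ) → ℝ) : Prop :=
  ContinuousOn Ψ (beta A X lam J '' openCube n₂ ε) ∧
  (∀ ξ ∈ beta A X lam J '' openCube n₂ ε, 0 < Ψ ξ) ∧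
  (μ.restrict (omegaOpen M A ε)).map (phi A X lam J ε) =
    (volume.restrict (beta A X lam J '' openCube n₂ ε)).withDensity
      (fun ξ => ENNReal.ofReal (Ψ ξ))

/-- The density `Ψ`. -/
def psi [MeasurableSpace G] (A : Module.Basis (Fin n₂) ℝ 𝔪) (X : Module.Basis (Fin n₁) ℝ 𝔭)
    (lam : Module.Dual ℝ 𝔭) (J : Fin n₂ ↪o Fin n₁) (ε : ℝ) (μ : Measure M) :
    (Fin n₂ → ℝ) → ℝ :=
  Classical.epsilon (IsHaarDensity A X lam J ε μ)

/-- The function `Υ(m) = √(Ψ(Φ(m)) |det L^{-T}|) s(m)`. The operator `L` of `∑_{j ∈ J} ℝ X_j` is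
given by its matrix in the basis `(X_j)_{j ∈ J}`. -/
def upsilon [MeasurableSpace G] (A : Module.Basis (Fin n₂) ℝ 𝔪) (X : Module.Basis (Fin n₁) ℝ 𝔭)
    (lam : Module.Dual ℝ 𝔭) (J : Fin n₂ ↪o Fin n₁) (ε : ℝ) (μ : Measure M)
    (L : GL (Fin n₂) ℝ) (s : M → ℂ) (m : M) : ℂ :=
  (Real.sqrt (psi A X lam J ε μ (phi A X lam J ε m) *
    |((↑L⁻¹ : Matrix (Fin n₂) (Fin n₂) ℝ)ᵀ).det|) : ℂ) * s m

/-- The sum `∑_{γ ∈ Γ_M} |Υ(γ m)|²`, with values in `[0, ∞]`. -/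
def upsilonSum [MeasurableSpace G] (A : Module.Basis (Fin n₂) ℝ 𝔪)
    (X : Module.Basis (Fin n₁) ℝ 𝔭)
    (lam : Module.Dual ℝ 𝔭) (J : Fin n₂ ↪o Fin n₁) (ε : ℝ) (μ : Measure M)
    (L : GL (Fin n₂) ℝ) (s : M → ℂ) (ΓM : Set M) (m : M) : ℝ≥0∞ :=
  ∑' γ : ΓM, ‖upsilon A X lam J ε μ L s ((γ : M) * m)‖ₑ ^ 2

/-- The lattice `Λ = ∑_{j ∈ J} ℤ L X_j` of `∑_{j ∈ J} ℝ X_j ⊆ 𝔭`. -/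
def latticeP (X : Module.Basis (Fin n₁) ℝ 𝔭) (J : Fin n₂ ↪o Fin n₁) (L : GL (Fin n₂) ℝ) :
    Submodule ℤ 𝔭 :=
  Submodule.span ℤ (Set.range fun k : Fin n₂ =>
    ∑ i, (L : Matrix (Fin n₂) (Fin n₂) ℝ) i k • X (J i))

/-- The lattice `Λ^⋆ = ∑_{j ∈ J} ℤ L^{-T} X_j^*`, in the coordinates of `(X_j^*)_{j ∈ J}`. -/
def dualLattice (L : GL (Fin n₂) ℝ) : Submodule ℤ (Fin n₂ → ℝ) :=
  Submodule.span ℤ (Set.range fun k : Fin n₂ =>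
    ((↑L⁻¹ : Matrix (Fin n₂) (Fin n₂) ℝ)ᵀ).col k)

/-- The discrete set `Γ_P = exp Λ`. -/
def gammaP (X : Module.Basis (Fin n₁) ℝ 𝔭) (J : Fin n₂ ↪o Fin n₁) (L : GL (Fin n₂) ℝ) : Set G :=
  (fun Y : 𝔭 => lieExp (Y : GroupLieAlgebra (𝓡 d) G)) '' (latticeP X J L : Set 𝔭)

/-- The set `Γ = Γ_M⁻¹ Γ_P`. -/
def gammaSet (X : Module.Basis (Fin n₁) ℝ 𝔭) (J : Fin n₂ ↪o Fin n₁) (L : GL (Fin n₂) ℝ)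
    (ΓM : Set M) : Set G :=
  ((fun γ : M => (γ : G)) '' ΓM)⁻¹ * gammaP X J L

end Construction

end SolvFrame

end

/-
The matrix coefficients `⟨h, π_λ(γ⁻¹ exp Y) s⟩` with `Y` in the lattice `Λ` are integrals over
`Ω_ε°` of `s(m) conj(h(γ⁻¹ m))` against the character `e^{2πi ⟨Φ(m), Y⟩}`. In the coordinates `Φ`
they are the Fourier coefficients of a function which lives on a fundamental domain of `Λ^⋆`, so
Parseval gives `∑_κ |⟨h, π_λ(κ) s⟩|² = ∫ |h(m)|² ∑_γ |Υ(γ m)|² dμ(m)`. The frame operator is thus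
the multiplication by a continuous function, and the optimal frame bounds are its infimum and
supremum.

The density `Ψ` is explicit: `θ_λ` intertwines the left translations of `M` with the coadjoint
action, so weighting Lebesgue measure in the coordinates `Φ` by the inverse Jacobian of the orbit
map `𝔪 → V_J^*` gives a measure which is left invariant wherever this makes sense, and Haar measure
is determined locally.
-/

namespace SolvFrame

noncomputable section

section IntegralCurve

variable {E E' : Type*} [NormedAddCommGroup E] [NormedSpace ℝ E] [NormedAddCommGroup E']
  [NormedSpace ℝ E'] {H H' : Type*} [TopologicalSpace H] [TopologicalSpace H']
  {I : ModelWithCorners ℝ E H} {I' : ModelWithCorners ℝ E' H'}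
  {X Y : Type*} [TopologicalSpace X] [ChartedSpace H X] [TopologicalSpace Y] [ChartedSpace H' Y]
  {V : (x : X) → TangentSpace I x} {W : (y : Y) → TangentSpace I' y} {f : X → Y} {γ : ℝ → X}

theorem isMIntegralCurveOn_comp_of_related {s : Set ℝ} (hγ : IsMIntegralCurveOn γ V s)
    (hf : MDifferentiable I I' f) (hVW : ∀ x, mfderiv I I' f x (V x) = W (f x)) :
    IsMIntegralCurveOn (f ∘ γ) W s := fun t ht => by
  refine ((hf (γ t)).hasMFDerivAt.comp_hasMFDerivWithinAt t (hγ t ht)).congr_mfderiv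
    (ContinuousLinearMap.ext fun r => ?_)
  exact ((mfderiv I I' f (γ t)).map_smul (show ℝ from r) _).trans
    (congrArg ((show ℝ from r) • ·) (hVW (γ t)))

theorem isMIntegralCurve_comp_of_related (hγ : IsMIntegralCurve γ V)
    (hf : MDifferentiable I I' f) (hVW : ∀ x, mfderiv I I' f x (V x) = W (f x)) :
    IsMIntegralCurve (f ∘ γ) W :=
  isMIntegralCurve_iff_isMIntegralCurveOn.2
    (isMIntegralCurveOn_comp_of_related (hγ.isMIntegralCurveOn univ) hf hVW)

end IntegralCurve

/-! ### One-parameter subgroups and the adjoint representation -/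

section Exp

variable {d : ℕ} {G : Type*} [TopologicalSpace G] [ChartedSpace (EuclideanSpace ℝ (Fin d)) G]
  [Group G]

theorem mulInvariantVectorField_one (v : GroupLieAlgebra (𝓡 d) G) :
    mulInvariantVectorField v (1 : G) = v := by
  have hid : (fun x : G => 1 * x) = id := funext one_mul
  unfold mulInvariantVectorField
  rw [hid, mfderiv_id]
  rfl

/-- The adjoint action `Ad g` of `g` on the Lie algebra, the derivative at `1` of
`x ↦ g x g⁻¹`. -/
def lieAd (g : G) : GroupLieAlgebra (𝓡 d) G →L[ℝ] GroupLieAlgebra (𝓡 d) G :=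
  (mfderiv (𝓡 d) (𝓡 d) (fun x : G => g * x * g⁻¹) 1 :
    EuclideanSpace ℝ (Fin d) →L[ℝ] EuclideanSpace ℝ (Fin d))

@[simp]
theorem lieAd_one (v : GroupLieAlgebra (𝓡 d) G) : lieAd (1 : G) v = v := by
  have hid : (fun x : G => 1 * x * (1 : G)⁻¹) = id := by
    ext x
    simp
  unfold lieAd
  rw [hid, mfderiv_id]
  rfl

variable [LieGroup (𝓡 d) ∞ G]

theorem mdifferentiable_conj (g : G) :
    MDifferentiable (𝓡 d) (𝓡 d) fun y : G => g * y * g⁻¹ :=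
  mdifferentiable_mul_right.comp mdifferentiable_mul_left

theorem mfderiv_mul_left_mulInvariantVectorField (g h : G) (v : GroupLieAlgebra (𝓡 d) G) :
    mfderiv (𝓡 d) (𝓡 d) (fun y : G => g * y) h (mulInvariantVectorField v h) =
      mulInvariantVectorField v (g * h) := by
  have hcomp : (fun x : G => g * h * x) = (fun y : G => g * y) ∘ (fun x : G => h * x) :=
    funext (mul_assoc g h)
  unfold mulInvariantVectorField
  rw [hcomp, mfderiv_comp (I' := 𝓡 d) _ (mdifferentiable_mul_left _)
    (mdifferentiable_mul_left _), mul_one]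
  rfl

theorem mfderiv_conj_mulInvariantVectorField (g h : G) (v : GroupLieAlgebra (𝓡 d) G) :
    mfderiv (𝓡 d) (𝓡 d) (fun y : G => g * y * g⁻¹) h (mulInvariantVectorField v h) =
      mulInvariantVectorField (lieAd g v) (g * h * g⁻¹) := by
  have hcomm : (fun y : G => g * y * g⁻¹) ∘ (fun x : G => h * x) =
      (fun x : G => g * h * g⁻¹ * x) ∘ (fun y : G => g * y * g⁻¹) := by
    ext x
    simp [mul_assoc]
  have hleft := mfderiv_comp (I := 𝓡 d) (I' := 𝓡 d) (I'' := 𝓡 d) (1 : G)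
    (mdifferentiable_conj (d := d) g (h * 1)) (mdifferentiable_mul_left (a := h) 1)
  have hright := mfderiv_comp (I := 𝓡 d) (I' := 𝓡 d) (I'' := 𝓡 d) (1 : G)
    (mdifferentiable_mul_left (a := g * h * g⁻¹) (g * 1 * g⁻¹)) (mdifferentiable_conj g 1)
  rw [hcomm, hright, mul_one h, mul_inv_eq_one.2 (mul_one g)] at hleft
  exact (DFunLike.congr_fun hleft v).symm

theorem lieAd_mul (g h : G) (v : GroupLieAlgebra (𝓡 d) G) :
    lieAd (g * h) v = lieAd g (lieAd h v) := by
  have hcomp : (fun x : G => g * h * x * (g * h)⁻¹) =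
      (fun y : G => g * y * g⁻¹) ∘ (fun x : G => h * x * h⁻¹) := by
    ext x
    simp [mul_assoc]
  have hderiv := mfderiv_comp (I := 𝓡 d) (I' := 𝓡 d) (I'' := 𝓡 d) (1 : G)
    (mdifferentiable_conj (d := d) g (h * 1 * h⁻¹)) (mdifferentiable_conj h 1)
  rw [← hcomp, mul_inv_eq_one.2 (mul_one h)] at hderiv
  exact DFunLike.congr_fun hderiv v

theorem contMDiff_one_mulInvariantVectorField (v : GroupLieAlgebra (𝓡 d) G) :
    ContMDiff (𝓡 d) (𝓡 d).tangent 1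
      (fun g : G => (⟨g, mulInvariantVectorField v g⟩ : TangentBundle (𝓡 d) G)) :=
  (contMDiff_mulInvariantVectorField v).of_le (by
    rw [minSmoothness_of_isRCLikeNormedField]
    norm_num)

variable [T2Space G]

theorem exists_isMIntegralCurve_mulInvariantVectorField (v : GroupLieAlgebra (𝓡 d) G) :
    ∃ γ : ℝ → G, γ 0 = 1 ∧ IsMIntegralCurve (I := 𝓡 d) γ (mulInvariantVectorField v) := by
  obtain ⟨γ, h0, hγ⟩ := exists_isMIntegralCurveAt_of_contMDiffAt_boundaryless (I := 𝓡 d) 0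
    ((contMDiff_one_mulInvariantVectorField v).contMDiffAt (x := (1 : G)))
  obtain ⟨ε, hε, h⟩ := isMIntegralCurveAt_iff'.1 hγ
  rw [Real.ball_eq_Ioo, zero_sub, zero_add] at h
  -- Left translation moves the local solution at `1` everywhere, with a uniform existence time.
  exact exists_isMIntegralCurve_of_isMIntegralCurveOn (contMDiff_one_mulInvariantVectorField v) hε
    (fun g => ⟨fun t => g * γ t, by simp [h0], isMIntegralCurveOn_comp_of_related h
      mdifferentiable_mul_left fun h => mfderiv_mul_left_mulInvariantVectorField g h v⟩) 1

theorem eq_of_isMIntegralCurve_mulInvariantVectorField {v : GroupLieAlgebra (𝓡 d) G}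
    {γ γ' : ℝ → G} (h : IsMIntegralCurve (I := 𝓡 d) γ (mulInvariantVectorField v))
    (h' : IsMIntegralCurve (I := 𝓡 d) γ' (mulInvariantVectorField v)) (h0 : γ 0 = γ' 0) :
    γ = γ' :=
  isMIntegralCurve_Ioo_eq_of_contMDiff_boundaryless (t₀ := 0)
    (contMDiff_one_mulInvariantVectorField v) h h' h0

theorem lieExp_eq_of_isMIntegralCurve {v : GroupLieAlgebra (𝓡 d) G} {γ : ℝ → G} (h0 : γ 0 = 1)
    (h : IsMIntegralCurve (I := 𝓡 d) γ (mulInvariantVectorField v)) : lieExp v = γ 1 := by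
  have hs := Classical.epsilon_spec (exists_isMIntegralCurve_mulInvariantVectorField v)
  exact congrFun (eq_of_isMIntegralCurve_mulInvariantVectorField hs.2 h (hs.1.trans h0.symm)) 1

theorem lieExp_smul_eq_of_isMIntegralCurve {v : GroupLieAlgebra (𝓡 d) G} {γ : ℝ → G}
    (h0 : γ 0 = 1) (h : IsMIntegralCurve (I := 𝓡 d) γ (mulInvariantVectorField v)) (t : ℝ) :
    lieExp (t • v) = γ t := by
  have ht := h.comp_mul t
  rw [← mulInvariantVectorField_smul] at ht
  simpa using lieExp_eq_of_isMIntegralCurve (by simp [h0]) ht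

theorem isMIntegralCurve_lieExp_smul (v : GroupLieAlgebra (𝓡 d) G) :
    IsMIntegralCurve (I := 𝓡 d) (fun t : ℝ => lieExp (t • v)) (mulInvariantVectorField v) := by
  obtain ⟨γ, h0, h⟩ := exists_isMIntegralCurve_mulInvariantVectorField v
  rwa [funext (lieExp_smul_eq_of_isMIntegralCurve h0 h)]

theorem continuous_lieExp_smul (v : GroupLieAlgebra (𝓡 d) G) :
    Continuous fun t : ℝ => (lieExp (t • v) : G) :=
  (isMIntegralCurve_lieExp_smul v).continuous

@[simp]
theorem lieExp_zero : lieExp (0 : GroupLieAlgebra (𝓡 d) G) = (1 : G) := by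
  obtain ⟨γ, h0, h⟩ := exists_isMIntegralCurve_mulInvariantVectorField (0 : GroupLieAlgebra (𝓡 d) G)
  simpa [h0] using lieExp_smul_eq_of_isMIntegralCurve h0 h 0

theorem lieExp_add_smul (v : GroupLieAlgebra (𝓡 d) G) (s t : ℝ) :
    (lieExp ((s + t) • v) : G) = lieExp (s • v) * lieExp (t • v) := by
  have hcurve := isMIntegralCurve_lieExp_smul (G := G) v
  have hmul : IsMIntegralCurve (I := 𝓡 d) (fun t : ℝ => lieExp (s • v) * lieExp (t • v))
      (mulInvariantVectorField v) :=
    isMIntegralCurve_comp_of_related hcurve mdifferentiable_mul_left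
      fun h => mfderiv_mul_left_mulInvariantVectorField _ h v
  have hadd : IsMIntegralCurve (I := 𝓡 d) (fun t : ℝ => (lieExp ((t + s) • v) : G))
      (mulInvariantVectorField v) := hcurve.comp_add s
  simpa [add_comm] using
    congrFun (eq_of_isMIntegralCurve_mulInvariantVectorField hadd hmul (by simp)) t

theorem lieExp_neg (v : GroupLieAlgebra (𝓡 d) G) : (lieExp (-v) : G) = (lieExp v)⁻¹ := by
  have h := lieExp_add_smul (G := G) v (-1) 1
  simp only [neg_add_cancel, zero_smul, lieExp_zero, neg_smul, one_smul] at h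
  exact eq_inv_of_mul_eq_one_left h.symm

theorem conj_lieExp (g : G) (v : GroupLieAlgebra (𝓡 d) G) :
    g * lieExp v * g⁻¹ = lieExp (lieAd g v) := by
  have h : IsMIntegralCurve (I := 𝓡 d) (fun t : ℝ => g * lieExp (t • v) * g⁻¹)
      (mulInvariantVectorField (lieAd g v)) :=
    isMIntegralCurve_comp_of_related (isMIntegralCurve_lieExp_smul v) (mdifferentiable_conj g)
      fun h => mfderiv_conj_mulInvariantVectorField g h v
  simpa using (lieExp_eq_of_isMIntegralCurve (by simp) h).symm

end Exp

/-! ### Multiplication in the chart at the identity -/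

section Chart

variable {d : ℕ} (G : Type*) [TopologicalSpace G] [ChartedSpace (EuclideanSpace ℝ (Fin d)) G]
  [Group G]

local notation "𝔼" => EuclideanSpace ℝ (Fin d)

local notation "φ₁" => extChartAt (𝓡 d) (1 : G)

/-- The multiplication of `G`, read in the chart at `1`. -/
def chartMul (p : 𝔼 × 𝔼) : 𝔼 := φ₁ ((φ₁).symm p.1 * (φ₁).symm p.2)

/-- The coordinates of `1` in the chart at `1`. -/
def chartOne : 𝔼 := φ₁ 1

variable {G}

theorem chartMul_apply {g h : G} (hg : g ∈ (φ₁).source) (hh : h ∈ (φ₁).source) :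
    chartMul G (φ₁ g, φ₁ h) = φ₁ (g * h) := by
  simp only [chartMul, (φ₁).left_inv hg, (φ₁).left_inv hh]

theorem chartMul_chartOne_right {x : 𝔼} (hx : x ∈ (φ₁).target) :
    chartMul G (x, chartOne G) = x := by
  simp only [chartMul, chartOne, (φ₁).left_inv (mem_extChartAt_source (I := 𝓡 d) (1 : G)),
    mul_one, (φ₁).right_inv hx]

theorem chartMul_chartOne_left {x : 𝔼} (hx : x ∈ (φ₁).target) :
    chartMul G (chartOne G, x) = x := by
  simp only [chartMul, chartOne, (φ₁).left_inv (mem_extChartAt_source (I := 𝓡 d) (1 : G)),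
    one_mul, (φ₁).right_inv hx]

theorem target_mem_nhds_chartOne : (φ₁).target ∈ 𝓝 (chartOne G) :=
  extChartAt_target_mem_nhds (I := 𝓡 d) (1 : G)

variable [LieGroup (𝓡 d) ∞ G]

theorem contDiffAt_chartMul : ContDiffAt ℝ ∞ (chartMul (d := d) G) (chartOne G, chartOne G) := by
  rw [← contMDiffAt_iff_contDiffAt]
  have hsymm : ContMDiffAt 𝓘(ℝ, 𝔼) (𝓡 d) ∞ (φ₁).symm (chartOne G) :=
    (contMDiffOn_extChartAt_symm (I := 𝓡 d) (n := ∞) (1 : G)).contMDiffAt target_mem_nhds_chartOne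
  have hsymm_one : (φ₁).symm (chartOne G) = 1 :=
    (φ₁).left_inv (mem_extChartAt_source (I := 𝓡 d) (1 : G))
  have hfst : ContMDiffAt 𝓘(ℝ, 𝔼 × 𝔼) (𝓡 d) ∞ (fun p : 𝔼 × 𝔼 => (φ₁).symm p.1)
      (chartOne G, chartOne G) := ContMDiffAt.comp _ hsymm contDiff_fst.contMDiff.contMDiffAt
  have hsnd : ContMDiffAt 𝓘(ℝ, 𝔼 × 𝔼) (𝓡 d) ∞ (fun p : 𝔼 × 𝔼 => (φ₁).symm p.2)
      (chartOne G, chartOne G) := ContMDiffAt.comp _ hsymm contDiff_snd.contMDiff.contMDiffAt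
  refine ContMDiffAt.comp _ (contMDiffAt_extChartAt' ?_) (hfst.mul hsnd)
  simp only [hsymm_one, mul_one]
  exact mem_chart_source _ _

theorem eventually_differentiableAt_chartMul :
    ∀ᶠ p in 𝓝 ((chartOne G, chartOne G) : 𝔼 × 𝔼), DifferentiableAt ℝ (chartMul G) p :=
  ((contDiffAt_chartMul.of_le (m := 1) (mod_cast le_top)).eventually (by simp)).mono
    fun _ h => h.differentiableAt (by simp)

theorem hasStrictFDerivAt_chartMul :
    HasStrictFDerivAt (chartMul G)
      (ContinuousLinearMap.fst ℝ 𝔼 𝔼 + ContinuousLinearMap.snd ℝ 𝔼 𝔼)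
      (chartOne G, chartOne G) := by
  have hstrict := (contDiffAt_chartMul (d := d) (G := G)).hasStrictFDerivAt (by simp)
  have hfst : HasFDerivAt (fun x : 𝔼 => chartMul G (x, chartOne G)) (.id ℝ 𝔼) (chartOne G) :=
    (hasFDerivAt_id _).congr_of_eventuallyEq
      (mem_of_superset target_mem_nhds_chartOne fun _ => chartMul_chartOne_right)
  have hsnd : HasFDerivAt (fun x : 𝔼 => chartMul G (chartOne G, x)) (.id ℝ 𝔼) (chartOne G) :=
    (hasFDerivAt_id _).congr_of_eventuallyEq
      (mem_of_superset target_mem_nhds_chartOne fun _ => chartMul_chartOne_left)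
  have hinl := (HasFDerivAt.comp (f := fun x => (x, chartOne G)) (chartOne G)
    hstrict.hasFDerivAt (hasFDerivAt_prodMk_left _ _)).unique hfst
  have hinr := (HasFDerivAt.comp (f := fun x => (chartOne G, x)) (chartOne G)
    hstrict.hasFDerivAt (hasFDerivAt_prodMk_right _ _)).unique hsnd
  convert! hstrict using 1
  ext1
  · rw [hinl]
    ext
    simp
  · rw [hinr]
    ext
    simp

theorem fderiv_chartMul_chartOne (p : 𝔼 × 𝔼) :
    fderiv ℝ (chartMul G) (chartOne G, chartOne G) p = p.1 + p.2 := by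
  rw [hasStrictFDerivAt_chartMul.hasFDerivAt.fderiv]
  rfl

theorem hasFDerivAt_fderiv_chartMul :
    HasFDerivAt (fderiv ℝ (chartMul (d := d) G))
      (fderiv ℝ (fderiv ℝ (chartMul (d := d) G)) (chartOne G, chartOne G))
      (chartOne G, chartOne G) :=
  ((contDiffAt_chartMul.fderiv_right (m := 1) (by norm_cast)).differentiableAt
    (by simp)).hasFDerivAt

theorem mfderiv_extChartAt_mulInvariantVectorField {g : G} (hg : g ∈ (φ₁).source)
    (hdiff : DifferentiableAt ℝ (chartMul G) (φ₁ g, chartOne G)) (v : GroupLieAlgebra (𝓡 d) G) :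
    mfderiv (𝓡 d) 𝓘(ℝ, 𝔼) φ₁ g (mulInvariantVectorField v g) =
      fderiv ℝ (chartMul G) (φ₁ g, chartOne G) (0, v) := by
  have hchart : HasMFDerivAt (𝓡 d) 𝓘(ℝ, 𝔼) φ₁ (1 : G) (ContinuousLinearMap.id ℝ 𝔼) := by
    have h := (mdifferentiableAt_extChartAt (I := 𝓡 d) (mem_chart_source 𝔼 (1 : G))).hasMFDerivAt
    rwa [mfderiv_extChartAt_self] at h
  have hright : HasMFDerivAt (𝓡 d) 𝓘(ℝ, 𝔼) (fun h : G => chartMul G (φ₁ g, φ₁ h)) 1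
      ((fderiv ℝ (chartMul G) (φ₁ g, chartOne G)).comp (.inr ℝ 𝔼 𝔼)) :=
    (HasFDerivAt.comp (f := fun x => (φ₁ g, x)) (chartOne G) hdiff.hasFDerivAt
      (hasFDerivAt_prodMk_right _ _)).hasMFDerivAt.comp (1 : G) hchart
  have hleft := mfderiv_comp_apply_of_eq (I := 𝓡 d) (I' := 𝓡 d) (I'' := 𝓘(ℝ, 𝔼)) (1 : G)
    (mdifferentiableAt_extChartAt (I := 𝓡 d) ((extChartAt_source (𝓡 d) (1 : G)) ▸ hg))
    (mdifferentiable_mul_left (a := g) 1) (mul_one g) v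
  have heq : (φ₁ ∘ fun h : G => g * h) =ᶠ[𝓝 1] fun h => chartMul G (φ₁ g, φ₁ h) :=
    mem_of_superset (extChartAt_source_mem_nhds (I := 𝓡 d) (1 : G)) fun h hh =>
      (chartMul_apply hg hh).symm
  rw [heq.mfderiv_eq, hright.mfderiv] at hleft
  exact hleft.symm

/-- The one-parameter group generated by `v`, read in the chart at `1`. -/
def chartExp (v : GroupLieAlgebra (𝓡 d) G) (t : ℝ) : 𝔼 := φ₁ (lieExp (t • v))

variable [T2Space G]

@[simp]
theorem chartExp_zero (v : GroupLieAlgebra (𝓡 d) G) : chartExp v 0 = chartOne G := by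
  simp [chartExp, chartOne]

theorem eventually_lieExp_mem_source (v : GroupLieAlgebra (𝓡 d) G) :
    ∀ᶠ t : ℝ in 𝓝 0, (lieExp (t • v) : G) ∈ (φ₁).source := by
  refine (continuous_lieExp_smul v).continuousAt.eventually_mem ?_
  rw [zero_smul, lieExp_zero]
  exact extChartAt_source_mem_nhds (I := 𝓡 d) (1 : G)

theorem hasDerivAt_chartExp_zero (v : GroupLieAlgebra (𝓡 d) G) :
    HasDerivAt (chartExp v) v 0 := by
  have hfield : ∀ g : G, g = 1 → (mulInvariantVectorField v g : 𝔼) = v := by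
    rintro g rfl
    exact mulInvariantVectorField_one v
  have hcurve := (isMIntegralCurve_lieExp_smul v 0).2
  simp only [writtenInExtChartAt, zero_smul, lieExp_zero, extChartAt_model_space_eq_id,
    modelWithCornersSelf_coe, range_id] at hcurve
  have hfderiv : HasFDerivAt (chartExp v) ((1 : ℝ →L[ℝ] ℝ).smulRight
      (mulInvariantVectorField v (lieExp ((0 : ℝ) • v) : G) : 𝔼)) 0 :=
    hasFDerivWithinAt_univ.1 hcurve
  refine hfderiv.hasDerivAt.congr_deriv ?_
  exact (one_smul ℝ (_ : 𝔼)).trans (hfield _ (by simp))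

theorem tendsto_chartExp_chartOne (v : GroupLieAlgebra (𝓡 d) G) :
    Tendsto (fun t => (chartExp v t, chartOne (d := d) G)) (𝓝 0)
      (𝓝 (chartOne G, chartOne G)) := by
  have h := (hasDerivAt_chartExp_zero v).continuousAt.prodMk
    (continuousAt_const (y := chartOne (d := d) G))
  rwa [ContinuousAt, chartExp_zero] at h

theorem hasDerivAt_chartMul_chartExp_right {x : 𝔼}
    (hx : DifferentiableAt ℝ (chartMul G) (x, chartOne G)) (v : GroupLieAlgebra (𝓡 d) G) :
    HasDerivAt (fun t => chartMul G (x, chartExp v t))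
      (fderiv ℝ (chartMul G) (x, chartOne G) (0, v)) 0 :=
  hx.hasFDerivAt.comp_hasDerivAt_of_eq 0
    ((hasDerivAt_const _ _).prodMk (hasDerivAt_chartExp_zero v)) (by rw [chartExp_zero])

theorem hasDerivAt_chartMul_chartExp_left {x : 𝔼}
    (hx : DifferentiableAt ℝ (chartMul G) (chartOne G, x)) (v : GroupLieAlgebra (𝓡 d) G) :
    HasDerivAt (fun t => chartMul G (chartExp v t, x))
      (fderiv ℝ (chartMul G) (chartOne G, x) (v, 0)) 0 :=
  hx.hasFDerivAt.comp_hasDerivAt_of_eq 0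
    ((hasDerivAt_chartExp_zero v).prodMk (hasDerivAt_const _ _)) (by rw [chartExp_zero])

theorem hasDerivAt_chartExp (v : GroupLieAlgebra (𝓡 d) G) :
    ∀ᶠ t : ℝ in 𝓝 0, HasDerivAt (chartExp v)
      (fderiv ℝ (chartMul G) (chartExp v t, chartOne G) (0, v)) t := by
  filter_upwards [(tendsto_chartExp_chartOne v).eventually eventually_differentiableAt_chartMul,
    eventually_lieExp_mem_source v] with t hdiff ht
  have hderiv := hasDerivAt_chartMul_chartExp_right hdiff v
  rw [← sub_self t] at hderiv
  refine (hderiv.comp_sub_const t t).congr_of_eventuallyEq ?_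
  have hsub : Tendsto (fun r : ℝ => r - t) (𝓝 t) (𝓝 0) := by
    simpa using (continuous_sub_right t).tendsto t
  filter_upwards [hsub.eventually (eventually_lieExp_mem_source v)] with r hr
  rw [chartExp, chartExp, chartExp, chartMul_apply ht hr, ← lieExp_add_smul, add_sub_cancel]

theorem hasStrictDerivAt_chartExp (v : GroupLieAlgebra (𝓡 d) G) :
    HasStrictDerivAt (chartExp v) v 0 := by
  have hcont : ContinuousAt (fun t => fderiv ℝ (chartMul G) (chartExp v t, chartOne G)) 0 := by
    refine ContinuousAt.comp (f := fun t => (chartExp v t, chartOne G)) ?_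
      ((hasDerivAt_chartExp_zero v).continuousAt.prodMk continuousAt_const)
    rw [chartExp_zero]
    exact contDiffAt_chartMul.continuousAt_fderiv (by simp)
  refine (hasStrictDerivAt_of_hasDerivAt_of_continuousAt (hasDerivAt_chartExp v)
    (hcont.clm_apply continuousAt_const)).congr_deriv ?_
  rw [chartExp_zero, fderiv_chartMul_chartOne]
  exact zero_add (v : 𝔼)

-- The chart version of `dL_g v = dR_g (Ad g v)`.
theorem fderiv_chartMul_lieAd {g : G} (hg : g ∈ (φ₁).source)
    (hright : DifferentiableAt ℝ (chartMul G) (φ₁ g, chartOne G))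
    (hleft : DifferentiableAt ℝ (chartMul G) (chartOne G, φ₁ g)) (v : GroupLieAlgebra (𝓡 d) G) :
    fderiv ℝ (chartMul G) (φ₁ g, chartOne G) (0, v) =
      fderiv ℝ (chartMul G) (chartOne G, φ₁ g) (lieAd g v, 0) := by
  refine (hasDerivAt_chartMul_chartExp_right hright v).unique
    ((hasDerivAt_chartMul_chartExp_left hleft (lieAd g v)).congr_of_eventuallyEq ?_)
  filter_upwards [eventually_lieExp_mem_source v, eventually_lieExp_mem_source (lieAd g v)]
    with s hs hs'
  rw [chartExp, chartExp, chartMul_apply hg hs, chartMul_apply hs' hg, ← map_smul, ← conj_lieExp,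
    inv_mul_cancel_right]

end Chart

/-! ### The derivative of the adjoint representation -/

section Calculus

variable {E : Type*} [NormedAddCommGroup E] [NormedSpace ℝ E]

theorem lieBracket_fderiv_snd {f : E × E → E} {x : E} {D : E × E →L[ℝ] E × E →L[ℝ] E}
    (hD : HasFDerivAt (fderiv ℝ f) D (x, x)) (hx : ∀ v, fderiv ℝ f (x, x) (0, v) = v) (v w : E) :
    VectorField.lieBracket ℝ (fun y => fderiv ℝ f (y, x) (0, v))
      (fun y => fderiv ℝ f (y, x) (0, w)) x = D (v, 0) (0, w) - D (w, 0) (0, v) := by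
  have hfield : ∀ v : E, HasFDerivAt (fun y : E => fderiv ℝ f (y, x) (0, v))
      ((D.comp (.inl ℝ E E)).flip (0, v)) x := fun v => by
    have hpartial : HasFDerivAt (fun y : E => fderiv ℝ f (y, x)) (D.comp (.inl ℝ E E)) x :=
      HasFDerivAt.comp (f := fun y => (y, x)) x hD (hasFDerivAt_prodMk_left _ _)
    simpa using hpartial.clm_apply (hasFDerivAt_const ((0, v) : E × E) x)
  rw [VectorField.lieBracket_eq]
  simp [(hfield _).fderiv, hx]

theorem hasDerivAt_of_clm_apply_eq [CompleteSpace E] {B : ℝ → E →L[ℝ] E} {B' : E →L[ℝ] E}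
    {r c : ℝ → E} {r' : E} {t : ℝ} (hB : HasDerivAt B B' t) (hBt : B t = 1)
    (hr : HasDerivAt r r' t) (h : ∀ᶠ s in 𝓝 t, B s (c s) = r s) :
    HasDerivAt c (r' - B' (r t)) t := by
  have hinv : HasDerivAt (fun s => Ring.inverse (B s)) (-B') t := by
    refine ((hasFDerivAt_ringInverse (𝕜 := ℝ) 1).comp_hasDerivAt_of_eq t hB
      (by rw [hBt, Units.val_one])).congr_deriv ?_
    simp
  have hunit : ∀ᶠ s in 𝓝 t, IsUnit (B s) :=
    hB.continuousAt.eventually (Units.isOpen.mem_nhds (by rw [hBt]; exact isUnit_one))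
  have hc : c =ᶠ[𝓝 t] fun s => Ring.inverse (B s) (r s) := by
    filter_upwards [h, hunit] with s hs hs'
    rw [← hs, ← mul_apply_eq_comp, Ring.inverse_mul_cancel _ hs']
    rfl
  refine ((hinv.clm_apply hr).congr_of_eventuallyEq hc).congr_deriv ?_
  rw [hBt, Ring.inverse_one]
  simp [sub_eq_neg_add]

theorem hasDerivAt_of_fderiv_apply_inl_eq [CompleteSpace E] {f : E × E → E}
    {D : E × E →L[ℝ] E × E →L[ℝ] E} {η a : ℝ → E} {v w : E} {t : ℝ}
    (hD : HasFDerivAt (fderiv ℝ f) D (η t, η t))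
    (hf : ∀ p, fderiv ℝ f (η t, η t) p = p.1 + p.2) (hη : HasDerivAt η v t)
    (ha : ∀ᶠ s in 𝓝 t, fderiv ℝ f (η t, η s) (a s, 0) = fderiv ℝ f (η s, η t) (0, w)) :
    HasDerivAt a (D (v, 0) (0, w) - D (0, v) (w, 0)) t := by
  have hright : HasDerivAt (fun s => fderiv ℝ f (η s, η t) (0, w)) (D (v, 0) (0, w)) t := by
    simpa using (HasFDerivAt.comp_hasDerivAt (f := fun s => (η s, η t)) t hD
      (hη.prodMk (hasDerivAt_const t _))).clm_apply (hasDerivAt_const t ((0, w) : E × E))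
  have hleft : HasDerivAt (fun s => (fderiv ℝ f (η t, η s)).comp (.inl ℝ E E))
      ((D (0, v)).comp (.inl ℝ E E)) t := by
    simpa using (HasFDerivAt.comp_hasDerivAt (f := fun s => (η t, η s)) t hD
      ((hasDerivAt_const t _).prodMk hη)).clm_comp
        (hasDerivAt_const t (ContinuousLinearMap.inl ℝ E E))
  refine (hasDerivAt_of_clm_apply_eq hleft ?_ hright ha).congr_deriv ?_
  · ext
    simp [hf]
  · simp [hf]

theorem hasDerivAt_exp_smul_mulVec {ι : Type*} [Fintype ι] [DecidableEq ι] (N : Matrix ι ι ℝ)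
    (y : ι → ℝ) (t : ℝ) : HasDerivAt (fun t : ℝ => NormedSpace.exp (t • N) *ᵥ y)
      (N *ᵥ NormedSpace.exp (t • N) *ᵥ y) t := by
  let _ : NormedRing (Matrix ι ι ℝ) := Matrix.linftyOpNormedRing
  let _ : NormedAlgebra ℝ (Matrix ι ι ℝ) := Matrix.linftyOpNormedAlgebra
  refine ((LinearMap.toContinuousLinearMap
    ((Matrix.mulVecBilin ℝ ℝ).flip y)).hasFDerivAt.comp_hasDerivAt t
    (hasDerivAt_exp_smul_const' (𝕂 := ℝ) N t)).congr_deriv ?_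
  exact (Matrix.mulVec_mulVec _ _ _).symm

theorem sum_exp_smul_neg_mulVec_smul_eq {ι : Type*} [Fintype ι] [DecidableEq ι]
    {N : Matrix ι ι ℝ} {w : ι → ℝ → E} (hw : ∀ j t, HasDerivAt (w j) (∑ i, N i j • w i t) t)
    (y : ι → ℝ) (t : ℝ) :
    ∑ j, (NormedSpace.exp (t • -N) *ᵥ y) j • w j t = ∑ j, y j • w j 0 := by
  have hderiv : ∀ t, HasDerivAt
      (fun t => ∑ j, (NormedSpace.exp (t • -N) *ᵥ y) j • w j t) 0 t := fun t => by
    refine (HasDerivAt.fun_sum fun j _ => (hasDerivAt_pi.1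
      (hasDerivAt_exp_smul_mulVec (-N) y t) j).smul (hw j t)).congr_deriv ?_
    simp only [Finset.sum_add_distrib, Matrix.neg_mulVec, Pi.neg_apply, neg_smul,
      Finset.sum_neg_distrib, Finset.smul_sum, smul_smul]
    rw [Finset.sum_comm, add_neg_eq_zero]
    simp only [Matrix.mulVec, dotProduct, Finset.sum_smul, mul_comm]
  have hconst := is_const_of_deriv_eq_zero (fun t => (hderiv t).differentiableAt)
    (fun t => (hderiv t).deriv) t 0
  simpa using hconst

end Calculus

theorem coe_eq_sum_repr {R V ι : Type*} [Semiring R] [AddCommMonoid V] [Module R V]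
    [Fintype ι] {W : Submodule R V} (b : Module.Basis ι R W) (x : W) :
    (x : V) = ∑ j, b.repr x j • (b j : V) := by
  conv_lhs => rw [← b.sum_repr x]
  simp only [Submodule.coe_sum, Submodule.coe_smul]

section Bracket

variable {d : ℕ} {G : Type*} [TopologicalSpace G] [ChartedSpace (EuclideanSpace ℝ (Fin d)) G]
  [Group G] [LieGroup (𝓡 d) ∞ G]

local notation "𝔼" => EuclideanSpace ℝ (Fin d)

local notation "φ₁" => extChartAt (𝓡 d) (1 : G)

theorem mpullbackWithin_mulInvariantVectorField (v : GroupLieAlgebra (𝓡 d) G) :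
    (VectorField.mpullbackWithin 𝓘(ℝ, 𝔼) (𝓡 d) (φ₁).symm (mulInvariantVectorField v)
      (range (𝓡 d))) =ᶠ[𝓝 (chartOne G)]
    fun x : 𝔼 => fderiv ℝ (chartMul G) (x, chartOne G) (0, v) := by
  have hcont : ContinuousAt (fun x : 𝔼 => (x, chartOne (d := d) G)) (chartOne G) := by fun_prop
  filter_upwards [target_mem_nhds_chartOne (G := G),
    hcont.eventually eventually_differentiableAt_chartMul] with x hx hdiff
  have hsymm := (φ₁).right_inv hx
  have hfield := mfderiv_extChartAt_mulInvariantVectorField ((φ₁).map_target hx)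
    (by rwa [hsymm]) v
  rw [hsymm] at hfield
  rw [← hfield, VectorField.mpullbackWithin_apply, ContinuousLinearMap.inverse_eq
    (mfderivWithin_extChartAt_symm_comp_mfderiv_extChartAt (I := 𝓡 d) hx)
    (mfderiv_extChartAt_comp_mfderivWithin_extChartAt_symm (I := 𝓡 d) hx)]

theorem bracket_eq_chartMul (v w : GroupLieAlgebra (𝓡 d) G) :
    ⁅v, w⁆ = fderiv ℝ (fderiv ℝ (chartMul (d := d) G)) (chartOne G, chartOne G) (v, 0) (0, w) -
      fderiv ℝ (fderiv ℝ (chartMul (d := d) G)) (chartOne G, chartOne G) (w, 0) (0, v) := by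
  let T : 𝔼 →L[ℝ] 𝔼 := mfderiv (𝓡 d) 𝓘(ℝ, 𝔼) φ₁ 1
  let chartField (v : GroupLieAlgebra (𝓡 d) G) : 𝔼 → 𝔼 :=
    VectorField.mpullbackWithin 𝓘(ℝ, 𝔼) (𝓡 d) (φ₁).symm (mulInvariantVectorField v) (range (𝓡 d))
  have hT : T = .id ℝ 𝔼 := mfderiv_extChartAt_self
  have hset : (φ₁).symm ⁻¹' univ ∩ range (𝓡 d) = univ := by simp
  have hdef : ⁅v, w⁆ = T.inverse (VectorField.lieBracketWithin ℝ (chartField v) (chartField w)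
    ((φ₁).symm ⁻¹' univ ∩ range (𝓡 d)) (chartOne G)) := rfl
  have hbracket : VectorField.lieBracket ℝ (chartField v) (chartField w) (chartOne G) = _ :=
    (Filter.EventuallyEq.lieBracket_vectorField_eq (mpullbackWithin_mulInvariantVectorField v)
      (mpullbackWithin_mulInvariantVectorField w)).trans
    (lieBracket_fderiv_snd (E := 𝔼) hasFDerivAt_fderiv_chartMul
      (fun v => by rw [fderiv_chartMul_chartOne, zero_add]) v w)
  rw [hset, VectorField.lieBracketWithin_univ, hT, ContinuousLinearMap.inverse_id, hbracket] at hdef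
  exact hdef

variable [T2Space G]

/-- Mathlib only puts a topology on tangent spaces; calculus in the Lie algebra uses the norm of
the model space. -/
local instance instNormedAddCommGroupLieAlgebra : NormedAddCommGroup (GroupLieAlgebra (𝓡 d) G) :=
  inferInstanceAs (NormedAddCommGroup 𝔼)

/-- The norm of the model space is homogeneous. -/
local instance instNormedSpaceLieAlgebra : NormedSpace ℝ (GroupLieAlgebra (𝓡 d) G) :=
  inferInstanceAs (NormedSpace ℝ 𝔼)

theorem hasDerivAt_lieAd_lieExp_zero (v w : GroupLieAlgebra (𝓡 d) G) :
    HasDerivAt (fun t : ℝ => lieAd (lieExp (t • v) : G) w) ⁅v, w⁆ 0 := by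
  have hchart := (tendsto_chartExp_chartOne v).eventually eventually_differentiableAt_chartMul
  have hchart' := (continuous_swap.tendsto _).comp (tendsto_chartExp_chartOne v) |>.eventually
    eventually_differentiableAt_chartMul
  refine (hasDerivAt_of_fderiv_apply_inl_eq (f := chartMul G) (η := chartExp v)
    (D := fderiv ℝ (fderiv ℝ (chartMul (d := d) G)) (chartOne G, chartOne G))
    (by rw [chartExp_zero]; exact hasFDerivAt_fderiv_chartMul)
    (by rw [chartExp_zero]; exact fderiv_chartMul_chartOne)
    (hasDerivAt_chartExp_zero v) (w := w) ?_).congr_deriv ?_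
  · rw [chartExp_zero]
    filter_upwards [eventually_lieExp_mem_source v, hchart, hchart'] with t ht hright hleft
    exact (fderiv_chartMul_lieAd ht hright hleft w).symm
  · have hsymm := (contDiffAt_chartMul (d := d) (G := G)).isSymmSndFDerivAt
      (by rw [minSmoothness_of_isRCLikeNormedField]; norm_cast) (w, 0) (0, v)
    rw [bracket_eq_chartMul, hsymm]

theorem hasDerivAt_lieAd_lieExp (v w : GroupLieAlgebra (𝓡 d) G) (t : ℝ) :
    HasDerivAt (fun t : ℝ => lieAd (lieExp (t • v) : G) w) (lieAd (lieExp (t • v) : G) ⁅v, w⁆)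
      t := by
  have hzero := hasDerivAt_lieAd_lieExp_zero v w
  rw [← sub_self t] at hzero
  refine ((lieAd (lieExp (t • v) : G)).hasFDerivAt.comp_hasDerivAt t
    (hzero.comp_sub_const t t)).congr_of_eventuallyEq (Eventually.of_forall fun s => ?_)
  have hmul : (lieExp (s • v) : G) = lieExp (t • v) * lieExp ((s - t) • v) := by
    rw [← lieExp_add_smul, add_sub_cancel]
  simp only [hmul]
  exact lieAd_mul _ _ _

-- Both sides solve the same linear differential equation along `t ↦ exp (t v)`.
theorem lieAd_lieExp_neg_coe {𝔭 : LieIdeal ℝ (GroupLieAlgebra (𝓡 d) G)} {n : ℕ}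
    (X : Module.Basis (Fin n) ℝ 𝔭) (v : GroupLieAlgebra (𝓡 d) G) (Y : 𝔭) :
    lieAd (lieExp (-v) : G) (Y : GroupLieAlgebra (𝓡 d) G) =
      (Matrix.toLin X X (NormedSpace.exp (-(LinearMap.toMatrix X X
        (LieModule.toEnd ℝ (GroupLieAlgebra (𝓡 d) G) 𝔭 v)))) Y : 𝔭) := by
  set N := LinearMap.toMatrix X X (LieModule.toEnd ℝ (GroupLieAlgebra (𝓡 d) G) 𝔭 v) with hN
  have hbracket : ∀ j, ⁅v, (X j : GroupLieAlgebra (𝓡 d) G)⁆ =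
      ∑ i, N i j • (X i : GroupLieAlgebra (𝓡 d) G) := fun j => by
    have h := coe_eq_sum_repr (W := 𝔭.toSubmodule) X
      (LieModule.toEnd ℝ (GroupLieAlgebra (𝓡 d) G) 𝔭 v (X j))
    simpa only [hN, LinearMap.toMatrix_apply, LieModule.toEnd_apply_apply, LieSubmodule.coe_bracket]
      using h
  have hode := sum_exp_smul_neg_mulVec_smul_eq (N := N)
    (w := fun j t => lieAd (lieExp (t • v) : G) (X j : GroupLieAlgebra (𝓡 d) G)) (fun j t => by
      have h := hasDerivAt_lieAd_lieExp v (X j) t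
      simpa only [hbracket, map_sum, map_smul] using h) (X.repr Y) 1
  simp only [one_smul, zero_smul, lieExp_zero, lieAd_one] at hode
  have hexp : lieAd (lieExp v : G) ((Matrix.toLin X X (NormedSpace.exp (-N)) Y : 𝔭) :
      GroupLieAlgebra (𝓡 d) G) = (Y : GroupLieAlgebra (𝓡 d) G) := by
    rw [coe_eq_sum_repr (W := 𝔭.toSubmodule) X Y, ← hode,
      coe_eq_sum_repr (W := 𝔭.toSubmodule) X, map_sum]
    simp only [map_smul, Matrix.repr_toLin]
  rw [← hexp, ← lieAd_mul, lieExp_neg, inv_mul_cancel, lieAd_one]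

end Bracket

section SecondKind

variable {d : ℕ} {G : Type*} [TopologicalSpace G] [ChartedSpace (EuclideanSpace ℝ (Fin d)) G]
  [Group G]

local notation "𝔼" => EuclideanSpace ℝ (Fin d)

local notation "φ₁" => extChartAt (𝓡 d) (1 : G)

/-- The ordered product `exp (a₁ v₁) ⋯ exp (aₙ vₙ)`. For a basis `v` of a subalgebra these are
coordinates of the second kind; here `v` is an arbitrary finite family, so that one can induct on
its length. -/
def expProd {n : ℕ} (v : Fin n → GroupLieAlgebra (𝓡 d) G) (a : Fin n → ℝ) : G :=
  (List.ofFn fun k => lieExp (a k • v k)).prod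

theorem expProd_fin_zero (v : Fin 0 → GroupLieAlgebra (𝓡 d) G) (a : Fin 0 → ℝ) :
    (expProd v a : G) = 1 := by
  simp [expProd]

theorem expProd_succ {n : ℕ} (v : Fin (n + 1) → GroupLieAlgebra (𝓡 d) G) (a : Fin (n + 1) → ℝ) :
    (expProd v a : G) = lieExp (a 0 • v 0) * expProd (fun k => v k.succ) (fun k => a k.succ) := by
  simp [expProd, List.ofFn_succ]

theorem expProd_mem {n : ℕ} {v : Fin n → GroupLieAlgebra (𝓡 d) G} {H : Subgroup G}
    (h : ∀ k (t : ℝ), (lieExp (t • v k) : G) ∈ H) (a : Fin n → ℝ) : expProd v a ∈ H := by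
  refine list_prod_mem fun x hx => ?_
  obtain ⟨k, rfl⟩ := (List.mem_ofFn' _ _).1 hx
  exact h k _

-- A surjective strict derivative makes `f` open at `x`.
theorem map_nhds_eq_nhds_one_of_range_eq_top {E : Type*} [NormedAddCommGroup E] [NormedSpace ℝ E]
    [CompleteSpace E] {f : E → G} {f' : E →L[ℝ] 𝔼} {x : E} (hf : ContinuousAt f x) (hfx : f x = 1)
    (hf' : HasStrictFDerivAt (fun y => φ₁ (f y)) f' x) (hsurj : f'.range = ⊤) :
    map f (𝓝 x) = 𝓝 1 := by
  have hsymm : map (φ₁).symm (𝓝 (φ₁ 1)) = 𝓝 1 := by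
    simpa using map_extChartAt_symm_nhdsWithin_range (I := 𝓡 d) (1 : G)
  have hmap := hf'.map_nhds_eq_of_surj hsurj
  rw [hfx] at hmap
  rw [← hmap, map_map] at hsymm
  refine (map_congr ?_).trans hsymm
  filter_upwards [hf.eventually_mem (by rw [hfx]; exact extChartAt_source_mem_nhds (I := 𝓡 d) 1)]
    with y hy
  exact ((φ₁).left_inv hy).symm

variable [LieGroup (𝓡 d) ∞ G]

theorem hasStrictFDerivAt_extChartAt_mul {E : Type*} [NormedAddCommGroup E] [NormedSpace ℝ E]
    {f g : E → G} {f' g' : E →L[ℝ] 𝔼} {x : E} (hf : ContinuousAt f x) (hg : ContinuousAt g x)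
    (hfx : f x = 1) (hgx : g x = 1) (hf' : HasStrictFDerivAt (fun y => φ₁ (f y)) f' x)
    (hg' : HasStrictFDerivAt (fun y => φ₁ (g y)) g' x) :
    HasStrictFDerivAt (fun y => φ₁ (f y * g y)) (f' + g') x := by
  have hmul : HasStrictFDerivAt (chartMul G)
      (ContinuousLinearMap.fst ℝ 𝔼 𝔼 + ContinuousLinearMap.snd ℝ 𝔼 𝔼) (φ₁ (f x), φ₁ (g x)) := by
    rw [hfx, hgx]
    exact hasStrictFDerivAt_chartMul
  have hsource {h : E → G} (hh : ContinuousAt h x) (hhx : h x = 1) :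
      ∀ᶠ y in 𝓝 x, h y ∈ (φ₁).source :=
    hh.eventually_mem (by rw [hhx]; exact extChartAt_source_mem_nhds (I := 𝓡 d) 1)
  refine ((hmul.comp x (hf'.prodMk hg')).congr_of_eventuallyEq ?_).congr_fderiv ?_
  · filter_upwards [hsource hf hfx, hsource hg hgx] with y hfy hgy
    exact chartMul_apply hfy hgy
  · ext y : 1
    simp

variable [T2Space G]

theorem expProd_zero {n : ℕ} (v : Fin n → GroupLieAlgebra (𝓡 d) G) : (expProd v 0 : G) = 1 := by
  simp [expProd]

theorem lieAd_list_prod_inv_coe {𝔭 : LieIdeal ℝ (GroupLieAlgebra (𝓡 d) G)} {n : ℕ}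
    (X : Module.Basis (Fin n) ℝ 𝔭) (l : List (GroupLieAlgebra (𝓡 d) G)) (Y : 𝔭) :
    lieAd ((l.map lieExp).prod : G)⁻¹ (Y : GroupLieAlgebra (𝓡 d) G) =
      (Matrix.toLin X X ((l.map fun v => NormedSpace.exp (-(LinearMap.toMatrix X X
        (LieModule.toEnd ℝ (GroupLieAlgebra (𝓡 d) G) 𝔭 v)))).reverse.prod) Y : 𝔭) := by
  induction l generalizing Y with
  | nil => simp
  | cons v l ih =>
    rw [List.map_cons, List.prod_cons, mul_inv_rev, ← lieExp_neg, List.map_cons,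
      List.reverse_cons, List.prod_append, List.prod_singleton, Matrix.toLin_mul X X X]
    exact (lieAd_mul _ _ _).trans
      ((congrArg (lieAd ((l.map lieExp).prod : G)⁻¹) (lieAd_lieExp_neg_coe X v Y)).trans (ih _))

theorem lieAd_secondKind_inv {𝔭 : LieIdeal ℝ (GroupLieAlgebra (𝓡 d) G)}
    {𝔪 : LieSubalgebra ℝ (GroupLieAlgebra (𝓡 d) G)} {n₁ n₂ : ℕ}
    (X : Module.Basis (Fin n₁) ℝ 𝔭) (A : Module.Basis (Fin n₂) ℝ 𝔪) (a : Fin n₂ → ℝ) (Y : 𝔭) :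
    lieAd (secondKind A a : G)⁻¹ (Y : GroupLieAlgebra (𝓡 d) G) = (opC A X a Y : 𝔭) := by
  have h := lieAd_list_prod_inv_coe (G := G) X
    (List.ofFn fun k => a k • (A k : GroupLieAlgebra (𝓡 d) G)) Y
  rwa [List.map_ofFn, List.map_ofFn] at h

variable [IsTopologicalGroup G]

theorem continuous_expProd {n : ℕ} (v : Fin n → GroupLieAlgebra (𝓡 d) G) :
    Continuous (expProd v : (Fin n → ℝ) → G) := by
  induction n with
  | zero => exact continuous_of_const fun a b => by rw [expProd_fin_zero, expProd_fin_zero]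
  | succ n ih =>
    rw [funext (expProd_succ v)]
    exact ((continuous_lieExp_smul (v 0)).comp (continuous_apply 0)).mul
      ((ih fun k => v k.succ).comp (by fun_prop))

theorem hasStrictFDerivAt_expProd {n : ℕ} (v : Fin n → GroupLieAlgebra (𝓡 d) G) :
    HasStrictFDerivAt (fun a : Fin n → ℝ => φ₁ (expProd v a))
      (∑ k, (ContinuousLinearMap.proj (R := ℝ) (φ := fun _ : Fin n => ℝ) k).smulRight
        (v k : 𝔼)) 0 := by
  induction n with
  | zero =>
    simp only [expProd_fin_zero, Finset.univ_eq_empty, Finset.sum_empty]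
    exact hasStrictFDerivAt_const _ _
  | succ n ih =>
    let head : (Fin (n + 1) → ℝ) →L[ℝ] ℝ := ContinuousLinearMap.proj 0
    let tail : (Fin (n + 1) → ℝ) →L[ℝ] (Fin n → ℝ) :=
      ContinuousLinearMap.pi fun k => ContinuousLinearMap.proj k.succ
    have hhead : HasStrictFDerivAt (fun a => φ₁ (lieExp (head a • v 0) : G)) _ 0 :=
      HasStrictFDerivAt.comp (g := chartExp (v 0)) (0 : Fin (n + 1) → ℝ)
        (hasStrictDerivAt_chartExp (v 0)).hasStrictFDerivAt head.hasStrictFDerivAt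
    have htail : HasStrictFDerivAt (fun a => φ₁ (expProd (fun k => v k.succ) (tail a))) _ 0 :=
      HasStrictFDerivAt.comp (f := tail) (0 : Fin (n + 1) → ℝ)
        (by rw [map_zero]; exact ih fun k => v k.succ) tail.hasStrictFDerivAt
    have hmul := hasStrictFDerivAt_extChartAt_mul
      ((continuous_lieExp_smul (v 0)).comp head.continuous).continuousAt
      ((continuous_expProd fun k => v k.succ).comp tail.continuous).continuousAt
      (by simp only [Function.comp_apply, map_zero, zero_smul, lieExp_zero])
      (by simp only [Function.comp_apply, map_zero, expProd_zero]) hhead htail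
    simp only [funext (expProd_succ v)]
    refine hmul.congr_fderiv ?_
    ext1 a
    simp only [add_apply, ContinuousLinearMap.comp_apply, ContinuousLinearMap.proj_apply,
      ContinuousLinearMap.coe_pi', sum_apply, Fin.sum_univ_succ, head, tail]
    rfl

theorem map_expProd_mul_nhds {n₁ n₂ : ℕ} {v : Fin n₁ → GroupLieAlgebra (𝓡 d) G}
    {w : Fin n₂ → GroupLieAlgebra (𝓡 d) G}
    (h : Submodule.span ℝ (range v) ⊔ Submodule.span ℝ (range w) = ⊤) :
    map (fun p : (Fin n₁ → ℝ) × (Fin n₂ → ℝ) => (expProd v p.1 * expProd w p.2 : G)) (𝓝 0) =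
      𝓝 1 := by
  have hv := (continuous_expProd v).comp (continuous_fst (Y := Fin n₂ → ℝ))
  have hw := (continuous_expProd w).comp (continuous_snd (X := Fin n₁ → ℝ))
  have hv' := HasStrictFDerivAt.comp (f := Prod.fst) (0 : (Fin n₁ → ℝ) × (Fin n₂ → ℝ))
    (hasStrictFDerivAt_expProd v) hasStrictFDerivAt_fst
  have hw' := HasStrictFDerivAt.comp (f := Prod.snd) (0 : (Fin n₁ → ℝ) × (Fin n₂ → ℝ))
    (hasStrictFDerivAt_expProd w) hasStrictFDerivAt_snd
  refine map_nhds_eq_nhds_one_of_range_eq_top (hv.mul hw).continuousAt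
    (by simp [expProd_zero]) (hasStrictFDerivAt_extChartAt_mul hv.continuousAt hw.continuousAt
      (expProd_zero v) (expProd_zero w) hv' hw') (eq_top_iff.2 fun z _ => ?_)
  obtain ⟨x, hx, y, hy, rfl⟩ := Submodule.mem_sup.1 (h.ge (Submodule.mem_top (x := z)))
  obtain ⟨a, rfl⟩ := (Submodule.mem_span_range_iff_exists_fun ℝ).1 hx
  obtain ⟨b, rfl⟩ := (Submodule.mem_span_range_iff_exists_fun ℝ).1 hy
  refine ⟨(a, b), ?_⟩
  simp only [ContinuousLinearMap.toLinearMap_add, ContinuousLinearMap.toLinearMap_comp,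
    ContinuousLinearMap.toLinearMap_sum, ContinuousLinearMap.coe_fst,
    ContinuousLinearMap.coe_snd, LinearMap.add_apply, LinearMap.coe_comp, LinearMap.coe_sum,
    ContinuousLinearMap.coe_coe, LinearMap.coe_fst, Function.comp_apply, Finset.sum_apply,
    LinearMap.coe_snd]
  rfl

end SecondKind

/-! ### Haar measure in orbit coordinates -/

theorem IsDiffeoOn.injOn {n : ℕ} {f : (Fin n → ℝ) → (Fin n → ℝ)} {U : Set (Fin n → ℝ)}
    (hf : IsDiffeoOn f U) : InjOn f U := by
  obtain ⟨-, -, -, g, -, hg⟩ := hf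
  exact hg.injOn

theorem IsDiffeoOn.isOpen_image {n : ℕ} {f : (Fin n → ℝ) → (Fin n → ℝ)} {U S : Set (Fin n → ℝ)}
    (hf : IsDiffeoOn f U) (hS : IsOpen S) (hSU : S ⊆ U) : IsOpen (f '' S) := by
  obtain ⟨-, hV, -, g, hg, hgf⟩ := hf
  have himage : f '' S = f '' U ∩ g ⁻¹' S := by
    ext ξ
    constructor
    · rintro ⟨a, ha, rfl⟩
      exact ⟨mem_image_of_mem f (hSU ha), by rwa [mem_preimage, hgf (hSU ha)]⟩
    · rintro ⟨⟨a, ha, rfl⟩, hga⟩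
      rw [mem_preimage, hgf ha] at hga
      exact mem_image_of_mem f hga
  rw [himage]
  exact hg.continuousOn.isOpen_inter_preimage hV hS

theorem IsDiffeoOn.det_ne_zero {n : ℕ} {f : (Fin n → ℝ) → (Fin n → ℝ)} {U : Set (Fin n → ℝ)}
    (hf : IsDiffeoOn f U) {a : Fin n → ℝ} (ha : a ∈ U) {f' : (Fin n → ℝ) →L[ℝ] (Fin n → ℝ)}
    (hf' : HasFDerivAt f f' a) : f'.det ≠ 0 := by
  obtain ⟨hU, hfU, -, g, hg, hgf⟩ := hf
  have hg' : HasFDerivAt g (fderiv ℝ g (f a)) (f a) :=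
    ((hg.contDiffAt (hfU.mem_nhds (mem_image_of_mem f ha))).differentiableAt (by simp)).hasFDerivAt
  have hid : (fderiv ℝ g (f a)).comp f' = .id ℝ _ :=
    (hg'.comp a hf').unique ((hasFDerivAt_id a).congr_of_eventuallyEq
      (eventually_of_mem (hU.mem_nhds ha) fun b hb => hgf hb))
  have hdet : LinearMap.det (fderiv ℝ g (f a) : (Fin n → ℝ) →ₗ[ℝ] (Fin n → ℝ)) * f'.det = 1 := by
    rw [ContinuousLinearMap.det, ← LinearMap.det_comp, ← ContinuousLinearMap.toLinearMap_comp, hid,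
      ContinuousLinearMap.coe_id, LinearMap.det_id]
  exact right_ne_zero_of_mul_eq_one hdet

/-- Local coordinates `e` of a group `M` near `1`, adapted to a linear action `ρ` of `M`: the orbit
map `θ a = ρ (e a) (θ 0)`, followed by a linear projection `p`, is a diffeomorphism on `O`. -/
structure OrbitCoords {M : Type*} [Group M] [TopologicalSpace M] {n : ℕ} {V : Type*}
    [NormedAddCommGroup V] [NormedSpace ℝ V] (ρ : M →* (V →L[ℝ] V)) (p : V →L[ℝ] (Fin n → ℝ))
    (e : (Fin n → ℝ) → M) (θ : (Fin n → ℝ) → V) (O : Set (Fin n → ℝ)) : Prop where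
  continuous_coord : Continuous e
  coord_zero : e 0 = 1
  nhds_le : 𝓝 1 ≤ map e (𝓝 0)
  contDiff_orbit : ContDiff ℝ ∞ θ
  orbit_eq : ∀ a, θ a = ρ (e a) (θ 0)
  continuous_action : Continuous fun a => ρ (e a)
  zero_mem : 0 ∈ O
  diffeo : IsDiffeoOn (fun a => p (θ a)) O

namespace OrbitCoords

variable {M : Type*} [Group M] {n : ℕ} {V : Type*} [NormedAddCommGroup V] [NormedSpace ℝ V]

/-- The derivative at `a` of `a ↦ p (ρ g (θ a))`. -/
def orbitDeriv (ρ : M →* (V →L[ℝ] V)) (p : V →L[ℝ] (Fin n → ℝ)) (θ : (Fin n → ℝ) → V) (g : M)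
    (a : Fin n → ℝ) : (Fin n → ℝ) →L[ℝ] (Fin n → ℝ) :=
  (p.comp (ρ g)).comp (fderiv ℝ θ a)

/-- The density of Haar measure in the coordinates `e`, up to a constant: the Jacobian at `a`
of left translation by `(e a)⁻¹`, which sends `e a` to `1`. -/
def haarWeight (ρ : M →* (V →L[ℝ] V)) (p : V →L[ℝ] (Fin n → ℝ)) (e : (Fin n → ℝ) → M)
    (θ : (Fin n → ℝ) → V) (a : Fin n → ℝ) : ℝ :=
  |(orbitDeriv ρ p θ 1 a).det| / |(orbitDeriv ρ p θ (e a) 0).det|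

/-- The density of Haar measure in the coordinates `p ∘ θ`, up to a constant. -/
def orbitDensity (ρ : M →* (V →L[ℝ] V)) (p : V →L[ℝ] (Fin n → ℝ)) (e : (Fin n → ℝ) → M)
    (θ : (Fin n → ℝ) → V) (O : Set (Fin n → ℝ)) (ξ : Fin n → ℝ) : ℝ :=
  |(orbitDeriv ρ p θ (e (Function.invFunOn (fun a => p (θ a)) O ξ)) 0).det|⁻¹

variable [TopologicalSpace M] {ρ : M →* (V →L[ℝ] V)} {p : V →L[ℝ] (Fin n → ℝ)}
  {e : (Fin n → ℝ) → M} {θ : (Fin n → ℝ) → V} {O : Set (Fin n → ℝ)} (h : OrbitCoords ρ p e θ O)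
include h

theorem hasFDerivAt_orbit (g : M) (a : Fin n → ℝ) :
    HasFDerivAt (fun a => p (ρ g (θ a))) (orbitDeriv ρ p θ g a) a :=
  (p.comp (ρ g)).hasFDerivAt.comp a (h.contDiff_orbit.contDiffAt.differentiableAt
    (by simp)).hasFDerivAt

theorem action_orbit_of_mul_eq {g : M} {a b : Fin n → ℝ} (hab : g * e a = e b) :
    ρ g (θ a) = θ b := by
  rw [h.orbit_eq a, h.orbit_eq b, ← hab, map_mul]
  rfl

theorem injOn_coord : InjOn e O := fun a ha b hb hab => by
  refine h.diffeo.injOn ha hb ?_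
  rw [h.orbit_eq a, h.orbit_eq b, hab]

theorem det_orbitDeriv_one_ne_zero {a : Fin n → ℝ} (ha : a ∈ O) :
    (orbitDeriv ρ p θ 1 a).det ≠ 0 :=
  h.diffeo.det_ne_zero ha (by simpa using h.hasFDerivAt_orbit 1 a)

theorem continuous_det_orbitDeriv_coord_zero :
    Continuous fun a => (orbitDeriv ρ p θ (e a) 0).det :=
  ContinuousLinearMap.continuous_det.comp
    ((continuous_const.clm_comp h.continuous_action).clm_comp continuous_const)

theorem continuous_det_orbitDeriv_one : Continuous fun a => (orbitDeriv ρ p θ 1 a).det :=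
  ContinuousLinearMap.continuous_det.comp
    (continuous_const.clm_comp (h.contDiff_orbit.continuous_fderiv (by simp)))

theorem orbitDensity_apply {a : Fin n → ℝ} (ha : a ∈ O) :
    orbitDensity ρ p e θ O (p (θ a)) = |(orbitDeriv ρ p θ (e a) 0).det|⁻¹ := by
  have hinv := h.diffeo.injOn.leftInvOn_invFunOn ha
  rw [orbitDensity, hinv]

theorem continuousOn_invFunOn :
    ContinuousOn (Function.invFunOn (fun a => p (θ a)) O) ((fun a => p (θ a)) '' O) := by
  obtain ⟨-, -, -, g, hg, hgl⟩ := h.diffeo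
  refine hg.continuousOn.congr ?_
  rintro _ ⟨a, ha, rfl⟩
  rw [hgl ha]
  exact h.diffeo.injOn.leftInvOn_invFunOn ha

theorem orbitDeriv_eq_comp_fderiv {a : Fin n → ℝ} {c : (Fin n → ℝ) → (Fin n → ℝ)} (hca : c a = 0)
    (hc : DifferentiableAt ℝ c a) (hce : ∀ᶠ b in 𝓝 a, e b = e a * e (c b)) (g : M) :
    orbitDeriv ρ p θ g a = (orbitDeriv ρ p θ (g * e a) 0).comp (fderiv ℝ c a) := by
  have hcomp : HasFDerivAt (fun b => p (ρ (g * e a) (θ (c b))))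
      ((orbitDeriv ρ p θ (g * e a) 0).comp (fderiv ℝ c a)) a := by
    have horbit := h.hasFDerivAt_orbit (g * e a) (c a)
    rw [hca] at horbit
    exact HasFDerivAt.comp (g := fun b => p (ρ (g * e a) (θ b))) a (hca ▸ horbit) hc.hasFDerivAt
  refine (h.hasFDerivAt_orbit g a).unique (hcomp.congr_of_eventuallyEq ?_)
  filter_upwards [hce] with b hb
  rw [map_mul, ContinuousLinearMap.mul_def, ContinuousLinearMap.comp_apply,
    h.action_orbit_of_mul_eq hb.symm]

variable [IsTopologicalGroup M]

-- Near `a`, the map `c` is left translation by `(e a)⁻¹` read in the coordinates `e`. It is smooth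
-- because in the coordinates `p ∘ θ` it becomes the linear action of `(e a)⁻¹`.
theorem exists_transition (a : Fin n → ℝ) : ∃ c : (Fin n → ℝ) → (Fin n → ℝ), c a = 0 ∧
    ContDiffAt ℝ ∞ c a ∧ ∀ᶠ b in 𝓝 a, e b = e a * e (c b) := by
  obtain ⟨hO, hO', -, q, hq, hqp⟩ := h.diffeo
  have hbase : ρ (e a)⁻¹ (θ a) = θ 0 :=
    h.action_orbit_of_mul_eq (by rw [h.coord_zero, inv_mul_cancel])
  refine ⟨fun b => q (p (ρ (e a)⁻¹ (θ b))), by simpa only [hbase] using hqp h.zero_mem, ?_, ?_⟩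
  · refine ContDiffAt.comp a ?_ ((p.comp (ρ (e a)⁻¹)).contDiff.comp h.contDiff_orbit).contDiffAt
    rw [hbase]
    exact hq.contDiffAt (hO'.mem_nhds (mem_image_of_mem _ h.zero_mem))
  · have himage : e '' O ∈ 𝓝 ((e a)⁻¹ * e a) := by
      rw [inv_mul_cancel]
      exact h.nhds_le (image_mem_map (hO.mem_nhds h.zero_mem))
    have hcont : Continuous fun b => (e a)⁻¹ * e b := continuous_const.mul h.continuous_coord
    filter_upwards [hcont.continuousAt.eventually_mem himage] with b ⟨x, hx, hxb⟩
    rw [h.action_orbit_of_mul_eq hxb.symm, hqp hx, hxb, mul_inv_cancel_left]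

theorem exists_det_orbitDeriv_eq_mul (a : Fin n → ℝ) :
    ∃ δ : ℝ, ∀ g, (orbitDeriv ρ p θ g a).det = (orbitDeriv ρ p θ (g * e a) 0).det * δ := by
  obtain ⟨c, hca, hc, hce⟩ := h.exists_transition a
  refine ⟨(fderiv ℝ c a).det, fun g => ?_⟩
  rw [h.orbitDeriv_eq_comp_fderiv hca (hc.differentiableAt (by simp)) hce]
  exact LinearMap.det_comp _ _

theorem det_orbitDeriv_coord_zero_ne_zero {a : Fin n → ℝ} (ha : a ∈ O) :
    (orbitDeriv ρ p θ (e a) 0).det ≠ 0 := by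
  obtain ⟨δ, hδ⟩ := h.exists_det_orbitDeriv_eq_mul a
  have hdet := h.det_orbitDeriv_one_ne_zero ha
  rw [hδ, one_mul] at hdet
  exact left_ne_zero_of_mul hdet

theorem map_coord_nhds {a : Fin n → ℝ} (ha : a ∈ O) : map e (𝓝 a) = 𝓝 (e a) := by
  refine le_antisymm h.continuous_coord.continuousAt ?_
  obtain ⟨c, hca, hc, hce⟩ := h.exists_transition a
  have hcomp := h.orbitDeriv_eq_comp_fderiv hca (hc.differentiableAt (by simp)) hce 1
  have hdet : LinearMap.det (fderiv ℝ c a : (Fin n → ℝ) →ₗ[ℝ] (Fin n → ℝ)) ≠ 0 := by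
    refine right_ne_zero_of_mul (a := LinearMap.det (orbitDeriv ρ p θ (1 * e a) 0).toLinearMap) ?_
    rw [← LinearMap.det_comp, ← ContinuousLinearMap.toLinearMap_comp, ← hcomp]
    exact h.det_orbitDeriv_one_ne_zero ha
  have hc_map : map c (𝓝 a) = 𝓝 0 := by
    rw [← hca]
    exact (hc.hasStrictFDerivAt (by simp)).map_nhds_eq_of_surj
      ((LinearMap.isUnit_iff_range_eq_top _).1
        ((LinearMap.isUnit_iff_isUnit_det _).2 hdet.isUnit))
  have he_map : map e (𝓝 a) = map (fun x => e a * x) (map e (map c (𝓝 a))) := by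
    rw [map_map, map_map]
    exact map_congr hce
  rw [he_map, hc_map, ← map_mul_left_nhds_one]
  exact map_mono h.nhds_le

theorem isOpen_image_coord {S : Set (Fin n → ℝ)} (hS : IsOpen S) (hSO : S ⊆ O) :
    IsOpen (e '' S) := by
  rw [isOpen_iff_mem_nhds]
  rintro _ ⟨a, ha, rfl⟩
  rw [← h.map_coord_nhds (hSO ha)]
  exact image_mem_map (hS.mem_nhds ha)

theorem abs_det_orbitDeriv_mul_inv {a b : Fin n → ℝ} (ha : a ∈ O) (hb : b ∈ O) {g : M}
    (hab : g * e a = e b) :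
    |(orbitDeriv ρ p θ g a).det| * |(orbitDeriv ρ p θ (e b) 0).det|⁻¹ = haarWeight ρ p e θ a := by
  obtain ⟨δ, hδ⟩ := h.exists_det_orbitDeriv_eq_mul a
  have hdet_a := abs_ne_zero.2 (h.det_orbitDeriv_coord_zero_ne_zero ha)
  have hdet_b := abs_ne_zero.2 (h.det_orbitDeriv_coord_zero_ne_zero hb)
  rw [haarWeight, hδ g, hδ 1, hab, one_mul, abs_mul, abs_mul, mul_div_cancel_left₀ _ hdet_a,
    mul_right_comm, mul_inv_cancel₀ hdet_b, one_mul]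

theorem haarWeight_pos {a : Fin n → ℝ} (ha : a ∈ O) : 0 < haarWeight ρ p e θ a :=
  div_pos (abs_pos.2 (h.det_orbitDeriv_one_ne_zero ha))
    (abs_pos.2 (h.det_orbitDeriv_coord_zero_ne_zero ha))

theorem continuousOn_haarWeight : ContinuousOn (haarWeight ρ p e θ) O :=
  h.continuous_det_orbitDeriv_one.abs.continuousOn.div
    h.continuous_det_orbitDeriv_coord_zero.abs.continuousOn
    fun _ ha => abs_ne_zero.2 (h.det_orbitDeriv_coord_zero_ne_zero ha)

theorem orbitDensity_pos {a : Fin n → ℝ} (ha : a ∈ O) : 0 < orbitDensity ρ p e θ O (p (θ a)) := by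
  rw [h.orbitDensity_apply ha]
  exact inv_pos.2 (abs_pos.2 (h.det_orbitDeriv_coord_zero_ne_zero ha))

theorem continuousOn_orbitDensity :
    ContinuousOn (orbitDensity ρ p e θ O) ((fun a => p (θ a)) '' O) := by
  refine ContinuousOn.inv₀
    (h.continuous_det_orbitDeriv_coord_zero.abs.comp_continuousOn h.continuousOn_invFunOn) ?_
  rintro _ ⟨a, ha, rfl⟩
  have hinv := h.diffeo.injOn.leftInvOn_invFunOn ha
  rw [hinv]
  exact abs_ne_zero.2 (h.det_orbitDeriv_coord_zero_ne_zero ha)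

-- Change of variables `ξ = p (ρ g (θ a))`.
theorem lintegral_haarWeight_eq_lintegral_orbitDensity {g : M} {E F : Set (Fin n → ℝ)}
    (hE : MeasurableSet E) (hEO : E ⊆ O) (hFO : F ⊆ O)
    (hEF : (fun a => g * e a) '' E = e '' F) :
    ∫⁻ a in E, ENNReal.ofReal (haarWeight ρ p e θ a) =
      ∫⁻ ξ in (fun a => p (θ a)) '' F, ENNReal.ofReal (orbitDensity ρ p e θ O ξ) := by
  have htranslate : ∀ a ∈ E, ∃ b ∈ F, g * e a = e b := fun a ha => by
    obtain ⟨b, hb, hab⟩ := hEF.subset (mem_image_of_mem _ ha)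
    exact ⟨b, hb, hab.symm⟩
  have himage : (fun a => p (θ a)) '' F = (fun a => p (ρ g (θ a))) '' E := by
    refine Subset.antisymm ?_ ?_
    · rintro _ ⟨b, hb, rfl⟩
      obtain ⟨a, ha, hab⟩ := hEF.superset (mem_image_of_mem _ hb)
      exact ⟨a, ha, by simp only [h.action_orbit_of_mul_eq hab]⟩
    · rintro _ ⟨a, ha, rfl⟩
      obtain ⟨b, hb, hab⟩ := htranslate a ha
      exact ⟨b, hb, by simp only [h.action_orbit_of_mul_eq hab]⟩
  have hinj : InjOn (fun a => p (ρ g (θ a))) E := by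
    intro a ha a' ha' haa
    obtain ⟨b, hb, hab⟩ := htranslate a ha
    obtain ⟨b', hb', hab'⟩ := htranslate a' ha'
    simp only [h.action_orbit_of_mul_eq hab, h.action_orbit_of_mul_eq hab'] at haa
    have hbb := h.diffeo.injOn (hFO hb) (hFO hb') haa
    rw [← hbb, ← hab] at hab'
    exact (h.injOn_coord (hEO ha') (hEO ha) (mul_left_cancel hab')).symm
  rw [himage, lintegral_image_eq_lintegral_abs_det_fderiv_mul volume hE
    (fun a _ => (h.hasFDerivAt_orbit g a).hasFDerivWithinAt) hinj]
  refine setLIntegral_congr_fun hE fun a ha => ?_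
  obtain ⟨b, hb, hab⟩ := htranslate a ha
  simp only [h.action_orbit_of_mul_eq hab]
  rw [h.orbitDensity_apply (hFO hb), ← ENNReal.ofReal_mul (abs_nonneg _),
    h.abs_det_orbitDeriv_mul_inv (hEO ha) (hFO hb) hab]

end OrbitCoords

section Glue

variable {M : Type*} [Group M] [TopologicalSpace M] [IsTopologicalGroup M]
  [SecondCountableTopology M] [MeasurableSpace M] [BorelSpace M]

theorem exists_disjoint_cover_inv_mul_mem {U : Set M} (hU : MeasurableSet U) (hU1 : U ∈ 𝓝 1) :
    ∃ (k : ℕ → M) (D : ℕ → Set M), (∀ i, MeasurableSet (D i)) ∧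
      Pairwise (Function.onFun Disjoint D) ∧ ⋃ i, D i = univ ∧ ∀ i, ∀ x ∈ D i, (k i)⁻¹ * x ∈ U := by
  have hnhds : ∀ g : M, (fun x => g⁻¹ * x) ⁻¹' U ∈ 𝓝 g := fun g =>
    (continuous_const_mul g⁻¹).continuousAt.preimage_mem_nhds (by rwa [inv_mul_cancel])
  obtain ⟨t, ht_countable, ht⟩ := TopologicalSpace.countable_cover_nhds hnhds
  have ht_nonempty : t.Nonempty := by
    rw [nonempty_iff_ne_empty]
    rintro rfl
    exact empty_ne_univ (biUnion_empty _ ▸ ht)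
  obtain ⟨k, rfl⟩ := ht_countable.exists_eq_range ht_nonempty
  refine ⟨k, disjointed fun i => (fun x => (k i)⁻¹ * x) ⁻¹' U,
    MeasurableSet.disjointed fun i => (continuous_const_mul _).measurable hU,
    disjoint_disjointed _, ?_, fun i x hx => disjointed_subset _ i hx⟩
  rw [iUnion_disjointed, ← ht, biUnion_range]

theorem exists_isMulLeftInvariant_of_locally_invariant {U : Set M} (hU : MeasurableSet U)
    (hU1 : U ∈ 𝓝 1) {ν₀ : Measure M}
    (hinv : ∀ (g : M) (E : Set M), MeasurableSet E → E ⊆ U → (∀ x ∈ E, g * x ∈ U) →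
      ν₀ ((fun x => g⁻¹ * x) ⁻¹' E) = ν₀ E) :
    ∃ ν : Measure M, ν.IsMulLeftInvariant ∧ ∀ (g : M) (E : Set M), MeasurableSet E →
      (∀ x ∈ E, g⁻¹ * x ∈ U) → ν E = ν₀ ((fun x => g * x) ⁻¹' E) := by
  have hmul (g : M) : Measurable fun x : M => g * x := (continuous_const_mul g).measurable
  obtain ⟨k, D, hD, hD_disj, hD_univ, hDU⟩ := exists_disjoint_cover_inv_mul_mem hU hU1
  let ν : Measure M := Measure.sum fun i => (ν₀.map fun x => k i * x).restrict (D i)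
  have hν_apply : ∀ E, MeasurableSet E → ν E = ∑' i, ν₀ ((fun x => k i * x) ⁻¹' (E ∩ D i)) := by
    intro E hE
    rw [Measure.sum_apply _ hE]
    refine tsum_congr fun i => ?_
    rw [Measure.restrict_apply hE, Measure.map_apply (hmul _) (hE.inter (hD i))]
  have hsplit : ∀ (τ : Measure M) (E : Set M), MeasurableSet E → ∀ g : M,
      τ ((fun x => g * x) ⁻¹' E) = ∑' i, τ ((fun x => g * x) ⁻¹' (E ∩ D i)) := by
    intro τ E hE g
    rw [← measure_iUnion
      (fun i j hij => ((hD_disj hij).mono inter_subset_right inter_subset_right).preimage _)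
      fun i => hmul _ (hE.inter (hD i)), ← preimage_iUnion, ← inter_iUnion, hD_univ, inter_univ]
  have hpreimage (g g' : M) (E : Set M) :
      (fun x => (g⁻¹ * g')⁻¹ * x) ⁻¹' ((fun x => g' * x) ⁻¹' E) = (fun x => g * x) ⁻¹' E := by
    ext x
    simp [mul_assoc]
  have hlocal : ∀ (g : M) (E : Set M), MeasurableSet E → (∀ x ∈ E, g⁻¹ * x ∈ U) →
      ν E = ν₀ ((fun x => g * x) ⁻¹' E) := by
    intro g E hE hEU
    rw [hν_apply E hE, hsplit ν₀ E hE g]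
    refine tsum_congr fun i => ?_
    rw [← hpreimage (k i) g]
    exact hinv _ _ (hmul _ (hE.inter (hD i))) (fun x hx => by simpa using hEU _ hx.1)
      fun x hx => by simpa [mul_assoc] using hDU i _ hx.2
  refine ⟨ν, ⟨fun g => Measure.ext fun E hE => ?_⟩, hlocal⟩
  rw [Measure.map_apply (hmul g) hE, hsplit ν E hE g, hν_apply E hE]
  refine tsum_congr fun i => ?_
  rw [hlocal (g⁻¹ * k i) _ (hmul g (hE.inter (hD i)))
    fun x hx => by simpa [mul_assoc] using hDU i _ hx.2, ← preimage_comp]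
  congr 1
  ext x
  simp [mul_assoc]

theorem exists_measure_eq_mul_of_locally_invariant [LocallyCompactSpace M] {U : Set M}
    (hU : MeasurableSet U) (hU1 : U ∈ 𝓝 1) {ν₀ : Measure M} [IsFiniteMeasure ν₀]
    (hν₀ : ν₀ U ≠ 0)
    (hinv : ∀ (g : M) (E : Set M), MeasurableSet E → E ⊆ U → (∀ x ∈ E, g * x ∈ U) →
      ν₀ ((fun x => g⁻¹ * x) ⁻¹' E) = ν₀ E)
    (μ : Measure M) [μ.IsHaarMeasure] :
    ∃ c : ℝ, 0 < c ∧ ∀ E ⊆ U, MeasurableSet E → μ E = ENNReal.ofReal c * ν₀ E := by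
  obtain ⟨ν, hν_inv, hν⟩ := exists_isMulLeftInvariant_of_locally_invariant hU hU1 hinv
  have hν_U : ∀ E ⊆ U, MeasurableSet E → ν E = ν₀ E := fun E hEU hE => by
    simpa using hν 1 E hE fun x hx => by simpa using hEU hx
  have hν_finite : IsLocallyFiniteMeasure ν := by
    refine ⟨fun g => ⟨(fun x => g⁻¹ * x) ⁻¹' U, (continuous_const_mul g⁻¹).continuousAt
      |>.preimage_mem_nhds (by rwa [inv_mul_cancel]), ?_⟩⟩
    rw [hν g _ ((continuous_const_mul g⁻¹).measurable hU) fun x hx => hx]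
    exact measure_lt_top _ _
  have hν_haar := Measure.isMulLeftInvariant_eq_smul ν μ
  set c := Measure.haarScalarFactor ν μ
  have hc : c ≠ 0 := fun hc => by
    rw [hc, zero_smul] at hν_haar
    exact hν₀ (by rw [← hν_U U subset_rfl hU, hν_haar, Measure.coe_zero, Pi.zero_apply])
  refine ⟨(c : ℝ)⁻¹, by positivity, fun E hEU hE => ?_⟩
  rw [← hν_U E hEU hE, hν_haar, Measure.smul_apply, ENNReal.ofReal_inv_of_pos (by positivity),
    ENNReal.ofReal_coe_nnreal, ENNReal.smul_def, smul_eq_mul, ← mul_assoc,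
    ENNReal.inv_mul_cancel (by exact_mod_cast hc) ENNReal.coe_ne_top, one_mul]

end Glue

namespace OrbitCoords

variable {M : Type*} [Group M] [MeasurableSpace M] {n : ℕ} {V : Type*} [NormedAddCommGroup V]
  [NormedSpace ℝ V]

/-- The measure with density `haarWeight` in the coordinates `e` on `e '' S`. It is a multiple of
Haar measure there. -/
def localHaar (ρ : M →* (V →L[ℝ] V)) (p : V →L[ℝ] (Fin n → ℝ)) (e : (Fin n → ℝ) → M)
    (θ : (Fin n → ℝ) → V) (S : Set (Fin n → ℝ)) : Measure M :=
  ((volume.restrict S).withDensity fun a => ENNReal.ofReal (haarWeight ρ p e θ a)).map e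

variable [TopologicalSpace M] [BorelSpace M] {ρ : M →* (V →L[ℝ] V)} {p : V →L[ℝ] (Fin n → ℝ)}
  {e : (Fin n → ℝ) → M} {θ : (Fin n → ℝ) → V} {O S : Set (Fin n → ℝ)}
  (h : OrbitCoords ρ p e θ O)
include h

theorem localHaar_apply {E : Set M} (hE : MeasurableSet E) :
    localHaar ρ p e θ S E = ∫⁻ a in S ∩ e ⁻¹' E, ENNReal.ofReal (haarWeight ρ p e θ a) := by
  have hmeas : Measurable e := h.continuous_coord.measurable
  rw [localHaar, Measure.map_apply hmeas hE, withDensity_apply _ (hmeas hE),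
    Measure.restrict_restrict (hmeas hE), inter_comm]

variable [IsTopologicalGroup M]

theorem localHaar_preimage_inv_mul (hS : MeasurableSet S) (hSO : S ⊆ O) {g : M} {E : Set M}
    (hE : MeasurableSet E) (hES : E ⊆ e '' S) (hgE : ∀ x ∈ E, g * x ∈ e '' S) :
    localHaar ρ p e θ S ((fun x => g⁻¹ * x) ⁻¹' E) = localHaar ρ p e θ S E := by
  have hmeas : Measurable e := h.continuous_coord.measurable
  have hgE_meas : MeasurableSet ((fun x => g⁻¹ * x) ⁻¹' E) :=
    (continuous_const_mul g⁻¹).measurable hE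
  have himage : e '' (S ∩ e ⁻¹' E) = E := by rw [image_inter_preimage, inter_eq_right.2 hES]
  have himage' : (fun a => g * e a) '' (S ∩ e ⁻¹' E) =
      e '' (S ∩ e ⁻¹' ((fun x => g⁻¹ * x) ⁻¹' E)) := by
    rw [image_inter_preimage, ← image_image (fun x => g * x) e, himage, ← image_mul_left',
      inv_inv, eq_comm, inter_eq_right]
    exact image_subset_iff.2 hgE
  rw [h.localHaar_apply hE, h.localHaar_apply hgE_meas,
    h.lintegral_haarWeight_eq_lintegral_orbitDensity (hS.inter (hmeas hE))
      (inter_subset_left.trans hSO) (inter_subset_left.trans hSO) himage',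
    h.lintegral_haarWeight_eq_lintegral_orbitDensity (g := 1) (hS.inter (hmeas hgE_meas))
      (inter_subset_left.trans hSO) (inter_subset_left.trans hSO)
      (image_congr fun a _ => one_mul (e a))]

theorem isFiniteMeasure_localHaar {K : Set (Fin n → ℝ)} (hK : IsCompact K) (hSK : S ⊆ K)
    (hKO : K ⊆ O) : IsFiniteMeasure (localHaar ρ p e θ S) := by
  refine ⟨?_⟩
  rw [h.localHaar_apply .univ, preimage_univ, inter_univ]
  exact (lintegral_mono_set hSK).trans_lt
    ((h.continuousOn_haarWeight.mono hKO).integrableOn_compact hK).lintegral_lt_top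

theorem localHaar_image_coord_ne_zero (hS : IsOpen S) (hS0 : S.Nonempty) (hSO : S ⊆ O) :
    localHaar ρ p e θ S (e '' S) ≠ 0 := by
  rw [h.localHaar_apply (h.isOpen_image_coord hS hSO).measurableSet,
    inter_eq_left.2 (subset_preimage_image e S)]
  intro hzero
  rw [lintegral_eq_zero_iff' ((h.continuousOn_haarWeight.mono hSO).aemeasurable
    hS.measurableSet).ennreal_ofReal] at hzero
  refine hS.measure_ne_zero volume hS0
    (measure_mono_null (fun a ha => ?_) ((ae_restrict_iff' hS.measurableSet).1 hzero))
  simpa using ⟨ha, h.haarWeight_pos (hSO ha)⟩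

theorem exists_haar_eq_lintegral_orbitDensity [SecondCountableTopology M] [LocallyCompactSpace M]
    (hS : IsOpen S) (hS0 : 0 ∈ S) {K : Set (Fin n → ℝ)} (hK : IsCompact K) (hSK : S ⊆ K)
    (hKO : K ⊆ O) (μ : Measure M) [μ.IsHaarMeasure] :
    ∃ c : ℝ, 0 < c ∧ ∀ E : Set M, MeasurableSet E → E ⊆ e '' S →
      μ E = ∫⁻ ξ in (fun a => p (θ a)) '' (S ∩ e ⁻¹' E),
        ENNReal.ofReal (c * orbitDensity ρ p e θ O ξ) := by
  have hSO : S ⊆ O := hSK.trans hKO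
  have hU : IsOpen (e '' S) := h.isOpen_image_coord hS hSO
  have hfinite := h.isFiniteMeasure_localHaar hK hSK hKO
  obtain ⟨c, hc, hμ⟩ := exists_measure_eq_mul_of_locally_invariant hU.measurableSet
    (hU.mem_nhds ⟨0, hS0, h.coord_zero⟩) (h.localHaar_image_coord_ne_zero hS ⟨0, hS0⟩ hSO)
    (fun g E => h.localHaar_preimage_inv_mul hS.measurableSet hSO) μ
  refine ⟨c, hc, fun E hE hEU => ?_⟩
  rw [hμ E hEU hE, h.localHaar_apply hE, h.lintegral_haarWeight_eq_lintegral_orbitDensity (g := 1)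
    (hS.measurableSet.inter (h.continuous_coord.measurable hE)) (inter_subset_left.trans hSO)
    (inter_subset_left.trans hSO) (image_congr fun a _ => one_mul (e a))]
  simp_rw [ENNReal.ofReal_mul hc.le]
  rw [lintegral_const_mul' _ _ ENNReal.ofReal_ne_top]

end OrbitCoords

/-! ### The coadjoint orbit of `λ` -/

section Coadjoint

theorem contDiff_list_prod {E 𝔸 : Type*} [NormedAddCommGroup E] [NormedSpace ℝ E] [NormedRing 𝔸]
    [NormedAlgebra ℝ 𝔸] {n : WithTop ℕ∞} {l : List (E → 𝔸)} (h : ∀ f ∈ l, ContDiff ℝ n f) :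
    ContDiff ℝ n fun x => (l.map fun f => f x).prod := by
  induction l with
  | nil => simpa using contDiff_const
  | cons f l ih =>
    simp only [List.map_cons, List.prod_cons]
    exact (h f (by simp)).mul (ih fun g hg => h g (by simp [hg]))

theorem contDiff_list_prod_exp_smul {𝔸 : Type*} [NormedRing 𝔸] [NormedAlgebra ℝ 𝔸]
    [CompleteSpace 𝔸] {m : ℕ} (N : Fin m → 𝔸) :
    ContDiff ℝ ∞ fun a : Fin m → ℝ =>
      (List.ofFn fun k => NormedSpace.exp (a k • N k)).reverse.prod := by
  have hexp : ContDiff ℝ ∞ (NormedSpace.exp : 𝔸 → 𝔸) :=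
    contDiff_iff_contDiffAt.2 fun x => (NormedSpace.exp_analytic (𝕂 := ℝ) x).contDiffAt
  have hprod := contDiff_list_prod (E := Fin m → ℝ) (n := ∞)
    (l := (List.ofFn fun k a => NormedSpace.exp (a k • N k)).reverse) fun f hf => by
      obtain ⟨k, rfl⟩ := (List.mem_ofFn' _ _).1 (List.mem_reverse.1 hf)
      exact hexp.comp ((contDiff_apply ℝ ℝ k).smul contDiff_const)
  simpa only [List.map_reverse, List.map_ofFn, Function.comp_def] using hprod

theorem contDiff_list_prod_exp_smul_apply {n m : ℕ} (N : Fin m → Matrix (Fin n) (Fin n) ℝ)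
    (i j : Fin n) :
    ContDiff ℝ ∞ fun a : Fin m → ℝ =>
      (List.ofFn fun k => NormedSpace.exp (a k • N k)).reverse.prod i j := by
  let _ : NormedRing (Matrix (Fin n) (Fin n) ℝ) := Matrix.linftyOpNormedRing
  let _ : NormedAlgebra ℝ (Matrix (Fin n) (Fin n) ℝ) := Matrix.linftyOpNormedAlgebra
  exact (LinearMap.toContinuousLinearMap (Matrix.entryLinearMap ℝ ℝ i j)).contDiff.comp
    (contDiff_list_prod_exp_smul N)

variable {d : ℕ} {G : Type*} [TopologicalSpace G] [ChartedSpace (EuclideanSpace ℝ (Fin d)) G]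
  [Group G] [LieGroup (𝓡 d) ∞ G] {M : Subgroup G}
  {𝔪 : LieSubalgebra ℝ (GroupLieAlgebra (𝓡 d) G)} {𝔭 : LieIdeal ℝ (GroupLieAlgebra (𝓡 d) G)}
  {n₁ n₂ : ℕ}

/-- The restriction of `Ad m⁻¹` to the ideal `𝔭`, for `m` in a subgroup `M` whose adjoint action
preserves `𝔭`. -/
def adInvIdeal
    (h𝔭 : ∀ (m : M) (Y : 𝔭), lieAd (m : G)⁻¹ (Y : GroupLieAlgebra (𝓡 d) G) ∈ 𝔭) (m : M) :
    𝔭 →ₗ[ℝ] 𝔭 where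
  toFun Y := ⟨lieAd (m : G)⁻¹ (Y : GroupLieAlgebra (𝓡 d) G), h𝔭 m Y⟩
  map_add' Y Z := Subtype.ext (map_add (lieAd (m : G)⁻¹) (Y : GroupLieAlgebra (𝓡 d) G) Z)
  map_smul' c Y := Subtype.ext (map_smul (lieAd (m : G)⁻¹) c (Y : GroupLieAlgebra (𝓡 d) G))

section

variable {h𝔭 : ∀ (m : M) (Y : 𝔭), lieAd (m : G)⁻¹ (Y : GroupLieAlgebra (𝓡 d) G) ∈ 𝔭}

theorem adInvIdeal_mul (m m' : M) :
    adInvIdeal h𝔭 (m * m') = adInvIdeal h𝔭 m' ∘ₗ adInvIdeal h𝔭 m := by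
  ext Y
  have h := lieAd_mul (m' : G)⁻¹ (m : G)⁻¹ (Y : GroupLieAlgebra (𝓡 d) G)
  rwa [← mul_inv_rev] at h

theorem adInvIdeal_one : adInvIdeal h𝔭 1 = LinearMap.id := by
  ext Y
  have h := lieAd_one (G := G) (Y : GroupLieAlgebra (𝓡 d) G)
  rwa [← inv_one] at h

end

/-- The operator `ℓ ↦ ℓ ᵥ* N` of row vectors, as a linear function of the matrix `N`. -/
def vecMulCLM (n : ℕ) : Matrix (Fin n) (Fin n) ℝ →ₗ[ℝ] (Fin n → ℝ) →L[ℝ] (Fin n → ℝ) where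
  toFun N := LinearMap.toContinuousLinearMap N.vecMulLinear
  map_add' N N' := by
    ext
    simp
  map_smul' c N := by
    ext
    simp

/-- The coadjoint action of `M` on `𝔭^*`. Functionals are given by their coordinates in `X^*`,
that is, by row vectors, on which the matrix of `Ad m⁻¹` acts from the right. -/
def coadjoint (X : Module.Basis (Fin n₁) ℝ 𝔭)
    (h𝔭 : ∀ (m : M) (Y : 𝔭), lieAd (m : G)⁻¹ (Y : GroupLieAlgebra (𝓡 d) G) ∈ 𝔭) :
    M →* ((Fin n₁ → ℝ) →L[ℝ] (Fin n₁ → ℝ)) where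
  toFun m := vecMulCLM n₁ (LinearMap.toMatrix X X (adInvIdeal h𝔭 m))
  map_one' := by
    rw [adInvIdeal_one, LinearMap.toMatrix_id]
    ext
    simp [vecMulCLM]
  map_mul' m m' := by
    rw [adInvIdeal_mul, LinearMap.toMatrix_comp X X X]
    ext ℓ : 1
    simp [vecMulCLM, Matrix.vecMul_vecMul]

/-- The coordinates of `θ_λ(a)` in the basis `X^*`. -/
def thetaVec (A : Module.Basis (Fin n₂) ℝ 𝔪) (X : Module.Basis (Fin n₁) ℝ 𝔭)
    (lam : Module.Dual ℝ 𝔭) (a : Fin n₂ → ℝ) (i : Fin n₁) : ℝ :=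
  theta A X lam a (X i)

/-- The projection `P_J^*` of `𝔭^*` onto the coordinates in `J`. -/
def projCoords (J : Fin n₂ ↪o Fin n₁) : (Fin n₁ → ℝ) →L[ℝ] (Fin n₂ → ℝ) :=
  ContinuousLinearMap.pi fun i => ContinuousLinearMap.proj (J i)

/-- The matrix of `C(a)` in the basis `X`. -/
def matC (A : Module.Basis (Fin n₂) ℝ 𝔪) (X : Module.Basis (Fin n₁) ℝ 𝔭) (a : Fin n₂ → ℝ) :
    Matrix (Fin n₁) (Fin n₁) ℝ :=
  LinearMap.toMatrix X X (opC A X a)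

theorem contDiff_matC_apply (A : Module.Basis (Fin n₂) ℝ 𝔪) (X : Module.Basis (Fin n₁) ℝ 𝔭)
    (i j : Fin n₁) : ContDiff ℝ ∞ fun a => matC A X a i j := by
  have h := contDiff_list_prod_exp_smul_apply (fun k => -(LinearMap.toMatrix X X
    (LieModule.toEnd ℝ (GroupLieAlgebra (𝓡 d) G) 𝔭 (A k : GroupLieAlgebra (𝓡 d) G)))) i j
  convert! h using 2 with a
  rw [matC, opC, LinearMap.toMatrix_toLin]
  simp only [map_smul, smul_neg]

theorem thetaVec_eq_vecMul (A : Module.Basis (Fin n₂) ℝ 𝔪) (X : Module.Basis (Fin n₁) ℝ 𝔭)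
    (lam : Module.Dual ℝ 𝔭) (a : Fin n₂ → ℝ) :
    thetaVec A X lam a = (fun j => lam (X j)) ᵥ* matC A X a := by
  ext i
  rw [thetaVec, theta, LinearMap.comp_apply, ← X.sum_repr (opC A X a (X i)), map_sum]
  simp only [map_smul, smul_eq_mul, Matrix.vecMul, dotProduct, matC, LinearMap.toMatrix_apply]
  exact Finset.sum_congr rfl fun j _ => mul_comm _ _

end Coadjoint

/-! ### Orbit coordinates of `M` -/

section Coords

theorem sigmaCompactSpace_of_preconnectedSpace (G : Type*) [TopologicalSpace G] [Group G]
    [IsTopologicalGroup G] [WeaklyLocallyCompactSpace G] [PreconnectedSpace G] :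
    SigmaCompactSpace G := by
  obtain ⟨K, hK, hK1⟩ := exists_compact_mem_nhds (1 : G)
  let S := K ∪ K⁻¹
  have hS_inv : S⁻¹ = S := by simp only [S, union_inv, inv_inv, union_comm]
  let H : Subgroup G :=
    { carrier := ⋃ n : ℕ, S ^ n
      one_mem' := mem_iUnion.2 ⟨0, by simp⟩
      mul_mem' := by
        simp only [mem_iUnion]
        rintro x y ⟨m, hx⟩ ⟨n, hy⟩
        exact ⟨m + n, pow_add S m n ▸ mul_mem_mul hx hy⟩
      inv_mem' := by
        simp only [mem_iUnion]
        rintro x ⟨n, hx⟩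
        exact ⟨n, by rwa [← hS_inv, inv_pow, Set.inv_mem_inv]⟩ }
  have hH : IsOpen (H : Set G) := H.isOpen_of_mem_nhds (g := 1)
    (mem_of_superset hK1 fun x hx => mem_iUnion.2 ⟨1, (pow_one S).ge (Or.inl hx)⟩)
  have hS_pow : ∀ n : ℕ, IsCompact (S ^ n) := fun n => by
    induction n with
    | zero => simp
    | succ n ih =>
      rw [pow_succ]
      exact ih.mul (hK.union hK.inv)
  exact ⟨⟨fun n => S ^ n, hS_pow,
    IsClopen.eq_univ ⟨H.isClosed_of_isOpen hH, hH⟩ ⟨1, H.one_mem⟩⟩⟩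

variable {d : ℕ} {G : Type*} [TopologicalSpace G] [ChartedSpace (EuclideanSpace ℝ (Fin d)) G]
  [Group G] [LieGroup (𝓡 d) ∞ G] {P M : Subgroup G}
  {𝔪 : LieSubalgebra ℝ (GroupLieAlgebra (𝓡 d) G)} {𝔭 : LieIdeal ℝ (GroupLieAlgebra (𝓡 d) G)}
  {n₁ n₂ : ℕ}

theorem secondKind_mem (hM : (M : Set G) = lieExp '' (𝔪 : Set (GroupLieAlgebra (𝓡 d) G)))
    (A : Module.Basis (Fin n₂) ℝ 𝔪) (a : Fin n₂ → ℝ) : (secondKind A a : G) ∈ M :=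
  expProd_mem (v := fun k => (A k : GroupLieAlgebra (𝓡 d) G))
    (fun k t => hM.ge ⟨_, (t • A k).2, rfl⟩) a

/-- Canonical coordinates of the second kind, as elements of `M`. -/
def coordM (hM : (M : Set G) = lieExp '' (𝔪 : Set (GroupLieAlgebra (𝓡 d) G)))
    (A : Module.Basis (Fin n₂) ℝ 𝔪) (a : Fin n₂ → ℝ) : M :=
  ⟨secondKind A a, secondKind_mem hM A a⟩

theorem span_range_coe_basis {V : Type*} [AddCommGroup V] [Module ℝ V] {W : Submodule ℝ V} {n : ℕ}
    (b : Module.Basis (Fin n) ℝ W) : Submodule.span ℝ (range fun k => (b k : V)) = W := by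
  have h := congrArg (Submodule.map W.subtype) b.span_eq
  rwa [Submodule.map_span, Submodule.map_top, Submodule.range_subtype, ← range_comp] at h

variable [T2Space G]

theorem pathConnectedSpace_of_lieExp_mul_lieExp [IsTopologicalGroup G]
    (h : ∀ g : G, ∃ v w : GroupLieAlgebra (𝓡 d) G, lieExp v * lieExp w = g) :
    PathConnectedSpace G := by
  have hjoined : ∀ g : G, Joined 1 g := fun g => by
    obtain ⟨v, w, rfl⟩ := h g
    exact ⟨⟨⟨fun t => lieExp ((t : ℝ) • v) * lieExp ((t : ℝ) • w),
      ((continuous_lieExp_smul v).comp continuous_subtype_val).mul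
        ((continuous_lieExp_smul w).comp continuous_subtype_val)⟩, by simp, by simp⟩⟩
  exact ⟨⟨1⟩, fun g g' => (hjoined g).symm.trans (hjoined g')⟩

theorem secondCountableTopology_of_isComplement' [IsTopologicalGroup G]
    (hPM : P.IsComplement' M)
    (hP : (P : Set G) = lieExp '' (𝔭 : Set (GroupLieAlgebra (𝓡 d) G)))
    (hM : (M : Set G) = lieExp '' (𝔪 : Set (GroupLieAlgebra (𝓡 d) G))) :
    SecondCountableTopology G := by
  have hpath : PathConnectedSpace G := pathConnectedSpace_of_lieExp_mul_lieExp fun g => by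
    obtain ⟨v, -, hv⟩ := hP.le (hPM.equiv g).1.2
    obtain ⟨w, -, hw⟩ := hM.le (hPM.equiv g).2.2
    exact ⟨v, w, by rw [hv, hw, hPM.equiv_fst_mul_equiv_snd]⟩
  have : LocallyCompactSpace G := ChartedSpace.locallyCompactSpace (EuclideanSpace ℝ (Fin d)) G
  have : SigmaCompactSpace G := sigmaCompactSpace_of_preconnectedSpace G
  exact ChartedSpace.secondCountable_of_sigmaCompact (EuclideanSpace ℝ (Fin d)) G

theorem lieAd_inv_mem (hM : (M : Set G) = lieExp '' (𝔪 : Set (GroupLieAlgebra (𝓡 d) G)))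
    (X : Module.Basis (Fin n₁) ℝ 𝔭) (m : M) (Y : 𝔭) :
    lieAd (m : G)⁻¹ (Y : GroupLieAlgebra (𝓡 d) G) ∈ 𝔭 := by
  obtain ⟨Z, -, hZ⟩ := hM.le m.2
  rw [← hZ, ← lieExp_neg, lieAd_lieExp_neg_coe X]
  exact Subtype.prop _

theorem coordM_zero (hM : (M : Set G) = lieExp '' (𝔪 : Set (GroupLieAlgebra (𝓡 d) G)))
    (A : Module.Basis (Fin n₂) ℝ 𝔪) : coordM hM A 0 = 1 :=
  Subtype.ext (expProd_zero _)

theorem adInvIdeal_coordM (hM : (M : Set G) = lieExp '' (𝔪 : Set (GroupLieAlgebra (𝓡 d) G)))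
    (X : Module.Basis (Fin n₁) ℝ 𝔭) (A : Module.Basis (Fin n₂) ℝ 𝔪) (a : Fin n₂ → ℝ) :
    adInvIdeal (lieAd_inv_mem hM X) (coordM hM A a) = opC A X a := by
  ext Y
  exact lieAd_secondKind_inv X A a Y

theorem coadjoint_coordM (hM : (M : Set G) = lieExp '' (𝔪 : Set (GroupLieAlgebra (𝓡 d) G)))
    (X : Module.Basis (Fin n₁) ℝ 𝔭) (A : Module.Basis (Fin n₂) ℝ 𝔪) (a : Fin n₂ → ℝ) :
    coadjoint X (lieAd_inv_mem hM X) (coordM hM A a) = vecMulCLM n₁ (matC A X a) := by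
  rw [matC, ← adInvIdeal_coordM hM]
  rfl

theorem matC_zero (hM : (M : Set G) = lieExp '' (𝔪 : Set (GroupLieAlgebra (𝓡 d) G)))
    (X : Module.Basis (Fin n₁) ℝ 𝔭) (A : Module.Basis (Fin n₂) ℝ 𝔪) : matC A X 0 = 1 := by
  rw [matC, ← adInvIdeal_coordM hM, coordM_zero, adInvIdeal_one, LinearMap.toMatrix_id]

variable [IsTopologicalGroup G]

-- The map `(x, a) ↦ ∏ exp (xᵢ Xᵢ) ∏ exp (aₖ Aₖ)` is open at `0`, and its values lie in `M` only if
-- the first factor, being in `P ∩ M`, is trivial.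
theorem nhds_one_le_map_coordM (hPM : P.IsComplement' M)
    (h𝔭𝔪 : IsCompl 𝔭.toSubmodule 𝔪.toSubmodule)
    (hP : (P : Set G) = lieExp '' (𝔭 : Set (GroupLieAlgebra (𝓡 d) G)))
    (hM : (M : Set G) = lieExp '' (𝔪 : Set (GroupLieAlgebra (𝓡 d) G)))
    (X : Module.Basis (Fin n₁) ℝ 𝔭) (A : Module.Basis (Fin n₂) ℝ 𝔪) :
    𝓝 1 ≤ map (coordM hM A) (𝓝 0) := by
  let expX : (Fin n₁ → ℝ) → G := expProd fun k => (X k : GroupLieAlgebra (𝓡 d) G)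
  have hopen : map (fun p : (Fin n₁ → ℝ) × (Fin n₂ → ℝ) => expX p.1 * coordM hM A p.2) (𝓝 0) =
      𝓝 1 := map_expProd_mul_nhds
    ((congrArg₂ (· ⊔ ·) (span_range_coe_basis (W := 𝔭.toSubmodule) X)
      (span_range_coe_basis (W := 𝔪.toSubmodule) A)).trans h𝔭𝔪.sup_eq_top)
  intro V hV
  have hV' : Prod.snd ⁻¹' (coordM hM A ⁻¹' V) ∈ 𝓝 (0 : (Fin n₁ → ℝ) × (Fin n₂ → ℝ)) :=
    continuous_snd.continuousAt.preimage_mem_nhds hV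
  have himage := hopen.ge (image_mem_map hV')
  refine mem_of_superset (continuous_subtype_val.continuousAt.preimage_mem_nhds himage) ?_
  rintro m ⟨⟨x, a⟩, ha, hm⟩
  have hxP : expX x ∈ P := expProd_mem (fun k t => hP.ge ⟨_, (t • X k).2, rfl⟩) x
  have hxM : expX x ∈ M :=
    (M.mul_mem_cancel_right (coordM hM A a).2).1 (Set.mem_of_eq_of_mem hm m.2)
  have hx : expX x = 1 := Subgroup.disjoint_def.1 hPM.disjoint hxP hxM
  have hma : coordM hM A a = m := Subtype.ext (by simpa only [hx, one_mul] using hm)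
  exact hma ▸ ha

/-- The restriction of `β_J` to `O` is a diffeomorphism, and the coordinates of the second kind of
`M` are adapted to the coadjoint orbit of `λ`. -/
abbrev CoadjointCoords (hM : (M : Set G) = lieExp '' (𝔪 : Set (GroupLieAlgebra (𝓡 d) G)))
    (lam : Module.Dual ℝ 𝔭) (X : Module.Basis (Fin n₁) ℝ 𝔭) (A : Module.Basis (Fin n₂) ℝ 𝔪)
    (J : Fin n₂ ↪o Fin n₁) (O : Set (Fin n₂ → ℝ)) : Prop :=
  OrbitCoords (coadjoint X (lieAd_inv_mem hM X)) (projCoords J) (coordM hM A) (thetaVec A X lam) O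

theorem coadjointCoords (hPM : P.IsComplement' M) (h𝔭𝔪 : IsCompl 𝔭.toSubmodule 𝔪.toSubmodule)
    (hP : (P : Set G) = lieExp '' (𝔭 : Set (GroupLieAlgebra (𝓡 d) G)))
    (hM : (M : Set G) = lieExp '' (𝔪 : Set (GroupLieAlgebra (𝓡 d) G))) (lam : Module.Dual ℝ 𝔭)
    (X : Module.Basis (Fin n₁) ℝ 𝔭) (A : Module.Basis (Fin n₂) ℝ 𝔪) (J : Fin n₂ ↪o Fin n₁)
    {O : Set (Fin n₂ → ℝ)} (hO0 : 0 ∈ O) (hO : IsDiffeoOn (beta A X lam J) O) :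
    CoadjointCoords hM lam X A J O where
  continuous_coord := Continuous.subtype_mk (continuous_expProd _) _
  coord_zero := coordM_zero hM A
  nhds_le := nhds_one_le_map_coordM hPM h𝔭𝔪 hP hM X A
  contDiff_orbit := by
    refine contDiff_pi.2 fun i => ?_
    simp only [thetaVec_eq_vecMul, Matrix.vecMul, dotProduct]
    exact ContDiff.sum fun j _ => contDiff_const.mul (contDiff_matC_apply A X j i)
  orbit_eq a := by
    rw [coadjoint_coordM, thetaVec_eq_vecMul, thetaVec_eq_vecMul, matC_zero hM, Matrix.vecMul_one]
    rfl
  continuous_action := by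
    simp only [coadjoint_coordM]
    exact (LinearMap.continuous_of_finiteDimensional (vecMulCLM n₁)).comp (continuous_pi fun i =>
      continuous_pi fun j => (contDiff_matC_apply A X i j).continuous)
  zero_mem := hO0
  diffeo := hO

end Coords

/-! ### The density of Haar measure -/

section Density

theorem isOpen_openCube (n : ℕ) (ε : ℝ) : IsOpen (openCube n ε) :=
  isOpen_set_pi finite_univ fun _ _ => isOpen_Ioo

theorem zero_mem_openCube (n : ℕ) {ε : ℝ} (hε : 0 < ε) : 0 ∈ openCube n ε :=
  fun _ _ => ⟨by simpa using hε, by simpa using hε⟩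

theorem openCube_subset_closedCube (n : ℕ) (ε : ℝ) : openCube n ε ⊆ closedCube n ε :=
  pi_mono fun _ _ => Ioo_subset_Icc_self

theorem isCompact_closedCube (n : ℕ) (ε : ℝ) : IsCompact (closedCube n ε) :=
  isCompact_univ_pi fun _ => isCompact_Icc

variable {d : ℕ} {G : Type*} [TopologicalSpace G] [ChartedSpace (EuclideanSpace ℝ (Fin d)) G]
  [Group G] [LieGroup (𝓡 d) ∞ G] {M : Subgroup G}
  {𝔪 : LieSubalgebra ℝ (GroupLieAlgebra (𝓡 d) G)} {𝔭 : LieIdeal ℝ (GroupLieAlgebra (𝓡 d) G)}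
  {n₁ n₂ : ℕ} {hM : (M : Set G) = lieExp '' (𝔪 : Set (GroupLieAlgebra (𝓡 d) G))}
  {lam : Module.Dual ℝ 𝔭} {X : Module.Basis (Fin n₁) ℝ 𝔭} {A : Module.Basis (Fin n₂) ℝ 𝔪}
  {J : Fin n₂ ↪o Fin n₁} {O : Set (Fin n₂ → ℝ)} {ε : ℝ}

theorem omegaOpen_eq_image (hM : (M : Set G) = lieExp '' (𝔪 : Set (GroupLieAlgebra (𝓡 d) G)))
    (A : Module.Basis (Fin n₂) ℝ 𝔪) (ε : ℝ) :
    omegaOpen M A ε = coordM hM A '' openCube n₂ ε := by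
  ext m
  constructor
  · rintro ⟨a, ha, hm⟩
    exact ⟨a, ha, Subtype.ext hm⟩
  · rintro ⟨a, ha, rfl⟩
    exact ⟨a, ha, rfl⟩

variable [T2Space G]

theorem phi_coordM (h : CoadjointCoords hM lam X A J O) (hεO : closedCube n₂ ε ⊆ O)
    {a : Fin n₂ → ℝ} (ha : a ∈ openCube n₂ ε) :
    phi A X lam J ε (coordM hM A a) = beta A X lam J a := by
  have hinj : InjOn (secondKind (G := G) A) (openCube n₂ ε) := fun x hx y hy hxy =>
    h.injOn_coord (hεO (openCube_subset_closedCube _ _ hx))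
      (hεO (openCube_subset_closedCube _ _ hy)) (Subtype.ext hxy)
  have hinv : Function.invFunOn (secondKind (G := G) A) (openCube n₂ ε) (secondKind A a) = a :=
    hinj.leftInvOn_invFunOn ha
  exact congrArg (beta A X lam J) hinv

theorem phi_image_omegaOpen (h : CoadjointCoords hM lam X A J O) (hεO : closedCube n₂ ε ⊆ O) :
    phi A X lam J ε '' omegaOpen M A ε = beta A X lam J '' openCube n₂ ε := by
  rw [omegaOpen_eq_image hM, image_image]
  exact image_congr fun a ha => phi_coordM h hεO ha

theorem beta_image_preimage_phi (h : CoadjointCoords hM lam X A J O) (hεO : closedCube n₂ ε ⊆ O)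
    (B : Set (Fin n₂ → ℝ)) :
    beta A X lam J '' (openCube n₂ ε ∩
      coordM hM A ⁻¹' (phi A X lam J ε ⁻¹' B ∩ omegaOpen M A ε)) =
      B ∩ beta A X lam J '' openCube n₂ ε := by
  ext ξ
  constructor
  · rintro ⟨a, ⟨ha, haB, -⟩, rfl⟩
    rw [mem_preimage, phi_coordM h hεO ha] at haB
    exact ⟨haB, a, ha, rfl⟩
  · rintro ⟨hξ, a, ha, rfl⟩
    refine ⟨a, ⟨ha, ?_, ?_⟩, rfl⟩
    · rwa [mem_preimage, phi_coordM h hεO ha]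
    · rw [omegaOpen_eq_image hM]
      exact mem_image_of_mem _ ha

variable [IsTopologicalGroup G]

theorem isOpen_omegaOpen (h : CoadjointCoords hM lam X A J O) (hεO : closedCube n₂ ε ⊆ O) :
    IsOpen (omegaOpen M A ε) := by
  rw [omegaOpen_eq_image hM]
  exact h.isOpen_image_coord (isOpen_openCube _ _) ((openCube_subset_closedCube _ _).trans hεO)

theorem continuousOn_phi (h : CoadjointCoords hM lam X A J O) (hεO : closedCube n₂ ε ⊆ O) :
    ContinuousOn (phi A X lam J ε) (omegaOpen M A ε) := by
  rw [omegaOpen_eq_image hM]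
  rintro _ ⟨a, ha, rfl⟩
  have haO := hεO (openCube_subset_closedCube _ _ ha)
  refine ContinuousAt.continuousWithinAt ?_
  rw [ContinuousAt, ← h.map_coord_nhds haO, tendsto_map'_iff, phi_coordM h hεO ha]
  have hbeta : ContinuousAt (beta A X lam J) a :=
    ((projCoords J).continuous.comp h.contDiff_orbit.continuous).continuousAt
  refine Tendsto.congr' ?_ hbeta
  filter_upwards [(isOpen_openCube n₂ ε).mem_nhds ha] with b hb using (phi_coordM h hεO hb).symm

variable [MeasurableSpace G] [BorelSpace G]

theorem measurableSet_preimage_phi_inter (h : CoadjointCoords hM lam X A J O)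
    (hεO : closedCube n₂ ε ⊆ O) {B : Set (Fin n₂ → ℝ)} (hB : MeasurableSet B) :
    MeasurableSet (phi A X lam J ε ⁻¹' B ∩ omegaOpen M A ε) := by
  rw [inter_comm, ← Subtype.image_preimage_coe]
  exact (isOpen_omegaOpen h hεO).measurableSet.subtype_image
    ((continuousOn_phi h hεO).domRestrict.measurable hB)

variable [SecondCountableTopology G] [LocallyCompactSpace M]

theorem exists_isHaarDensity (h : CoadjointCoords hM lam X A J O) (hε : 0 < ε)
    (hεO : closedCube n₂ ε ⊆ O) (μ : Measure M) [μ.IsHaarMeasure] :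
    ∃ Ψ, IsHaarDensity A X lam J ε μ Ψ := by
  have : SecondCountableTopology M := TopologicalSpace.Subtype.secondCountableTopology _
  have hSO : openCube n₂ ε ⊆ O := (openCube_subset_closedCube _ _).trans hεO
  obtain ⟨c, hc, hμ⟩ := h.exists_haar_eq_lintegral_orbitDensity (isOpen_openCube n₂ ε)
    (zero_mem_openCube n₂ hε) (isCompact_closedCube n₂ ε) (openCube_subset_closedCube _ _) hεO μ
  have hΩ : MeasurableSet (omegaOpen M A ε) := (isOpen_omegaOpen h hεO).measurableSet
  refine ⟨fun ξ => c * OrbitCoords.orbitDensity (coadjoint X (lieAd_inv_mem hM X)) (projCoords J)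
      (coordM hM A) (thetaVec A X lam) O ξ,
    (continuousOn_const.mul h.continuousOn_orbitDensity).mono (image_mono hSO), ?_, ?_⟩
  · rintro _ ⟨a, ha, rfl⟩
    exact mul_pos hc (h.orbitDensity_pos (hSO ha))
  · ext B hB
    rw [Measure.map_apply_of_aemeasurable ((continuousOn_phi h hεO).aemeasurable hΩ) hB,
      withDensity_apply _ hB, Measure.restrict_restrict hB, Measure.restrict_apply' hΩ,
      hμ _ (measurableSet_preimage_phi_inter h hεO hB)
        (inter_subset_right.trans (omegaOpen_eq_image hM A ε).le)]
    rw [← beta_image_preimage_phi h hεO B]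
    rfl

theorem isHaarDensity_psi (h : CoadjointCoords hM lam X A J O) (hε : 0 < ε)
    (hεO : closedCube n₂ ε ⊆ O) (μ : Measure M) [μ.IsHaarMeasure] :
    IsHaarDensity A X lam J ε μ (psi A X lam J ε μ) :=
  Classical.epsilon_spec (exists_isHaarDensity h hε hεO μ)

end Density

/-! ### Parseval's identity on a fundamental domain of a lattice -/

section Parseval

theorem enorm_sq_eq_ofReal (z : ℂ) : ‖z‖ₑ ^ 2 = ENNReal.ofReal (‖z‖ ^ 2) := by
  rw [ENNReal.ofReal_pow (norm_nonneg _), ofReal_norm]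

theorem exists_measurable_comp_eq {Z Y : Type*} [MeasurableSpace Z] [StandardBorelSpace Z]
    [MeasurableSpace Y] [MeasurableSpace.CountablySeparated Y] {S : Set Z} (hS : MeasurableSet S)
    {τ : Z → Y} (hτ : Measurable (S.domRestrict τ)) (hinj : InjOn τ S) {f : Z → ℂ}
    (hf : Measurable f) : ∃ u : Y → ℂ, Measurable u ∧ ∀ x ∈ S, u (τ x) = f x := by
  have : StandardBorelSpace S := hS.standardBorel
  have hembed : MeasurableEmbedding (S.domRestrict τ) :=
    hτ.measurableEmbedding (injOn_iff_injective.1 hinj)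
  obtain ⟨u, hu, huf⟩ :=
    hembed.exists_measurable_extend (hf.comp measurable_subtype_coe) fun _ => ⟨0⟩
  exact ⟨u, hu, fun x hx => congrFun huf ⟨x, hx⟩⟩

variable {ι : Type*} [Fintype ι]

/-- The Haar probability measure of the torus `(ℝ / ℤ)^ι`. -/
abbrev torusMeasure (ι : Type*) [Fintype ι] : Measure (UnitAddTorus ι) :=
  Measure.pi fun _ => AddCircle.haarAddCircle

theorem tsum_enorm_sq_mFourier {f : UnitAddTorus ι → ℂ} (hf : MemLp f 2 (torusMeasure ι)) :
    ∑' z : ι → ℤ, ‖∫ t, UnitAddTorus.mFourier z t * f t ∂torusMeasure ι‖ₑ ^ 2 =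
      ∫⁻ t, ‖f t‖ₑ ^ 2 ∂torusMeasure ι := by
  have hparseval : HasSum (fun z : ι → ℤ =>
      ‖∫ t, UnitAddTorus.mFourier (-z) t • hf.toLp f t ∂torusMeasure ι‖ ^ 2)
      (∫ t, ‖hf.toLp f t‖ ^ 2 ∂torusMeasure ι) := UnitAddTorus.hasSum_sq_mFourierCoeff (hf.toLp f)
  have hcoeff : ∀ z : ι → ℤ,
      ∫ t, UnitAddTorus.mFourier (-z) t • hf.toLp f t ∂torusMeasure ι =
        ∫ t, UnitAddTorus.mFourier (-z) t * f t ∂torusMeasure ι := fun z =>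
    integral_congr_ae (hf.coeFn_toLp.mono fun t ht => by simp only [ht, smul_eq_mul])
  have hnorm : ∫ t, ‖hf.toLp f t‖ ^ 2 ∂torusMeasure ι = ∫ t, ‖f t‖ ^ 2 ∂torusMeasure ι :=
    integral_congr_ae (hf.coeFn_toLp.mono fun t ht => by simp only [ht])
  simp only [hcoeff, hnorm] at hparseval
  rw [← (Equiv.neg (ι → ℤ)).tsum_eq]
  simp only [enorm_sq_eq_ofReal, Equiv.neg_apply]
  rw [← ENNReal.ofReal_tsum_of_nonneg (fun _ => by positivity) hparseval.summable,
    hparseval.tsum_eq, ofReal_integral_eq_lintegral_ofReal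
      ((memLp_two_iff_integrable_sq_norm hf.aestronglyMeasurable).1 hf)
      (Eventually.of_forall fun _ => by positivity)]

theorem map_restrict_unitCube (ι : Type*) [Fintype ι] :
    (volume.restrict (univ.pi fun _ : ι => Ico (0 : ℝ) 1)).map
      (fun x i => (x i : UnitAddCircle)) = torusMeasure ι := by
  have hmk : Measurable fun (x : ι → ℝ) i => (x i : UnitAddCircle) :=
    measurable_pi_lambda _ fun i => AddCircle.measurable_mk'.comp (measurable_pi_apply i)
  have hcube : (univ.pi fun _ : ι => Ico (0 : ℝ) 1) =ᵐ[volume]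
      {x : ι → ℝ | ∀ i, x i ∈ Ioc ((0 : ι → ℝ) i) ((0 : ι → ℝ) i + 1)} := by
    have hIoc : {x : ι → ℝ | ∀ i, x i ∈ Ioc ((0 : ι → ℝ) i) ((0 : ι → ℝ) i + 1)} =
        univ.pi fun i => Ioc ((0 : ι → ℝ) i) ((1 : ι → ℝ) i) := by
      ext x
      simp
    rw [hIoc]
    exact (Measure.univ_pi_Ico_ae_eq_Icc (f := 0) (g := 1)).trans
      Measure.univ_pi_Ioc_ae_eq_Icc.symm
  refine Measure.ext_of_lintegral _ fun g hg => ?_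
  rw [lintegral_map hg hmk, Measure.restrict_congr_set hcube]
  exact (UnitAddTorus.lintegral_preimage g 0).symm

/-- The projection `ℝ^ι → (ℝ / ℤ)^ι` given by the coordinates in the basis `b`; its fibres are the
cosets of the lattice spanned by `b`. -/
def toTorus (b : Module.Basis ι ℝ (ι → ℝ)) (x : ι → ℝ) : UnitAddTorus ι :=
  fun i => (b.equivFun x i : UnitAddCircle)

/-- The character `x ↦ exp (2πi ∑ zᵢ xᵢ)`, where the `xᵢ` are the coordinates of `x` in the
basis `b`. -/
def basisCharacter (b : Module.Basis ι ℝ (ι → ℝ)) (z : ι → ℤ) (x : ι → ℝ) : Circle :=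
  Circle.exp (2 * Real.pi * ∑ i, z i * b.equivFun x i)

/-- The covolume of the lattice spanned by `b`. -/
def covol (b : Module.Basis ι ℝ (ι → ℝ)) : ℝ :=
  |(LinearMap.det (b.equivFun : (ι → ℝ) →ₗ[ℝ] (ι → ℝ)))⁻¹|

theorem continuous_toTorus (b : Module.Basis ι ℝ (ι → ℝ)) : Continuous (toTorus b) :=
  continuous_pi fun i => (AddCircle.continuous_mk' 1).comp
    ((continuous_apply i).comp b.equivFun.toLinearMap.continuous_of_finiteDimensional)

theorem continuous_basisCharacter (b : Module.Basis ι ℝ (ι → ℝ)) (z : ι → ℤ) :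
    Continuous (basisCharacter b z) := by
  have hb : Continuous b.equivFun := b.equivFun.toLinearMap.continuous_of_finiteDimensional
  exact Circle.exp.continuous.comp (by fun_prop)

theorem covol_pos (b : Module.Basis ι ℝ (ι → ℝ)) : 0 < covol b :=
  abs_pos.2 (inv_ne_zero (LinearEquiv.isUnit_det' b.equivFun).ne_zero)

theorem toTorus_eq_iff (b : Module.Basis ι ℝ (ι → ℝ)) (x y : ι → ℝ) :
    toTorus b x = toTorus b y ↔ x - y ∈ Submodule.span ℤ (range b) := by
  rw [b.mem_span_iff_repr_mem ℤ, funext_iff]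
  refine forall_congr' fun i => ?_
  rw [toTorus, toTorus, QuotientAddGroup.eq_iff_sub_mem, AddSubgroup.mem_zmultiples_iff]
  simp

theorem mFourier_toTorus (b : Module.Basis ι ℝ (ι → ℝ)) (z : ι → ℤ) (x : ι → ℝ) :
    UnitAddTorus.mFourier z (toTorus b x) = Circle.coeHom (basisCharacter b z x) :=
  calc UnitAddTorus.mFourier z (toTorus b x)
      = ∏ i, fourier (z i) (b.equivFun x i : UnitAddCircle) := rfl
    _ = Complex.exp ((2 * Real.pi * ∑ i, z i * b.equivFun x i : ℝ) * Complex.I) := by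
        simp only [fourier_coe_apply]
        rw [← Complex.exp_sum]
        push_cast
        rw [Finset.mul_sum, Finset.sum_mul]
        exact congrArg Complex.exp (Finset.sum_congr rfl fun i _ => by ring)
    _ = Circle.coeHom (basisCharacter b z x) := (Circle.coe_exp _).symm

theorem map_toTorus_restrict_fundamentalDomain (b : Module.Basis ι ℝ (ι → ℝ)) :
    (volume.restrict (ZSpan.fundamentalDomain b)).map (toTorus b) =
      ENNReal.ofReal (covol b) • torusMeasure ι := by
  let E : (ι → ℝ) →ₗ[ℝ] (ι → ℝ) := b.equivFun
  have hE : Measurable E := E.continuous_of_finiteDimensional.measurable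
  have hdet : LinearMap.det E ≠ 0 := (LinearEquiv.isUnit_det' b.equivFun).ne_zero
  have hcube : MeasurableSet (univ.pi fun _ : ι => Ico (0 : ℝ) 1) :=
    MeasurableSet.univ_pi fun _ => measurableSet_Ico
  have hdomain : ZSpan.fundamentalDomain b = E ⁻¹' univ.pi fun _ => Ico 0 1 := by
    ext x
    simp [ZSpan.fundamentalDomain, E]
  have hmk : Measurable fun (x : ι → ℝ) i => (x i : UnitAddCircle) :=
    measurable_pi_lambda _ fun i => AddCircle.measurable_mk'.comp (measurable_pi_apply i)
  have hcomp : toTorus b = (fun x i => (x i : UnitAddCircle)) ∘ E := rfl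
  rw [hdomain, hcomp, ← Measure.map_map hmk hE, ← Measure.restrict_map hE hcube,
    Real.map_linearMap_volume_pi_eq_smul_volume_pi hdet, Measure.restrict_smul, Measure.map_smul,
    map_restrict_unitCube]
  rfl

theorem map_toTorus (b : Module.Basis ι ℝ (ι → ℝ)) {F : Set (ι → ℝ)}
    (hF : IsAddFundamentalDomain (Submodule.span ℤ (range b)) F volume) :
    (volume.restrict F).map (toTorus b) = ENNReal.ofReal (covol b) • torusMeasure ι := by
  have hm := (continuous_toTorus b).measurable
  have : VAddInvariantMeasure (Submodule.span ℤ (range b)) (ι → ℝ) volume :=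
    inferInstanceAs <|
      VAddInvariantMeasure (Submodule.span ℤ (range b)).toAddSubgroup (ι → ℝ) volume
  rw [← map_toTorus_restrict_fundamentalDomain]
  ext B hB
  rw [Measure.map_apply hm hB, Measure.map_apply hm hB, Measure.restrict_apply (hm hB),
    Measure.restrict_apply (hm hB)]
  refine hF.measure_set_eq (ZSpan.isAddFundamentalDomain b volume) (hm hB) fun g => ?_
  ext x
  have hg : toTorus b (g +ᵥ x) = toTorus b x := by
    rw [toTorus_eq_iff, Submodule.vadd_def, vadd_eq_add, add_sub_cancel_right]
    exact g.2
  rw [mem_preimage, mem_preimage, mem_preimage, hg]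

theorem lintegral_comp_toTorus (b : Module.Basis ι ℝ (ι → ℝ)) {F : Set (ι → ℝ)}
    (hF : IsAddFundamentalDomain (Submodule.span ℤ (range b)) F volume)
    {g : UnitAddTorus ι → ℝ≥0∞} (hg : Measurable g) :
    ∫⁻ x in F, g (toTorus b x) = ENNReal.ofReal (covol b) * ∫⁻ t, g t ∂torusMeasure ι := by
  rw [← lintegral_map hg (continuous_toTorus b).measurable, map_toTorus b hF,
    lintegral_smul_measure, smul_eq_mul]

theorem integral_comp_toTorus (b : Module.Basis ι ℝ (ι → ℝ)) {F : Set (ι → ℝ)}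
    (hF : IsAddFundamentalDomain (Submodule.span ℤ (range b)) F volume)
    {g : UnitAddTorus ι → ℂ} (hg : Measurable g) :
    ∫ x in F, g (toTorus b x) = covol b * ∫ t, g t ∂torusMeasure ι := by
  rw [← integral_map (continuous_toTorus b).aemeasurable hg.aestronglyMeasurable,
    map_toTorus b hF, integral_smul_measure, ENNReal.toReal_ofReal (covol_pos b).le,
    Complex.real_smul]

theorem memLp_of_memLp_comp_toTorus (b : Module.Basis ι ℝ (ι → ℝ)) {F : Set (ι → ℝ)}
    (hF : IsAddFundamentalDomain (Submodule.span ℤ (range b)) F volume)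
    {g : UnitAddTorus ι → ℂ} (hg : Measurable g) {p : ℝ≥0∞}
    (hgp : MemLp (g ∘ toTorus b) p (volume.restrict F)) : MemLp g p (torusMeasure ι) := by
  have hc : ENNReal.ofReal (covol b) ≠ 0 := (ENNReal.ofReal_pos.2 (covol_pos b)).ne'
  have hmap : MemLp g p (ENNReal.ofReal (covol b) • torusMeasure ι) := by
    rw [← map_toTorus b hF]
    exact (memLp_map_measure_iff hg.aestronglyMeasurable (continuous_toTorus b).aemeasurable).2 hgp
  refine hmap.of_measure_le_smul (ENNReal.inv_ne_top.2 hc) (le_of_eq ?_)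
  rw [smul_smul, ENNReal.inv_mul_cancel hc ENNReal.ofReal_ne_top, one_smul]

theorem exists_measurable_subset_injOn_toTorus (b : Module.Basis ι ℝ (ι → ℝ))
    {F : Set (ι → ℝ)} (hF : IsAddFundamentalDomain (Submodule.span ℤ (range b)) F volume) :
    ∃ S ⊆ F, MeasurableSet S ∧ S =ᵐ[volume] F ∧ InjOn (toTorus b) S := by
  obtain ⟨F₀, hF₀, hF₀m, hF₀e⟩ := hF.nullMeasurableSet.exists_measurable_subset_ae_eq
  let N := ⋃ g : {g : Submodule.span ℤ (range b) // g ≠ 0}, F₀ ∩ (fun x => -g.1.1 + x) ⁻¹' F₀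
  have hNm : MeasurableSet N := MeasurableSet.iUnion fun g =>
    hF₀m.inter ((measurable_const_add _) hF₀m)
  have hN : volume N = 0 := by
    refine measure_iUnion_null fun g => measure_mono_null ?_ (hF.aedisjoint (Ne.symm g.2))
    rintro x ⟨hx, hgx⟩
    exact ⟨by simpa using hF₀ hx, _, hF₀ hgx, by simp [Submodule.vadd_def]⟩
  refine ⟨F₀ \ N, sdiff_subset.trans hF₀, hF₀m.diff hNm, (sdiff_null_ae_eq_self hN).trans hF₀e, ?_⟩
  rintro x ⟨hx, hxN⟩ y ⟨hy, -⟩ hxy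
  by_contra hne
  rw [toTorus_eq_iff] at hxy
  refine hxN (mem_iUnion.2 ⟨⟨⟨x - y, hxy⟩, fun h => hne (sub_eq_zero.1 (congrArg Subtype.val h))⟩,
    hx, ?_⟩)
  simpa using hy

theorem exists_measurable_comp_toTorus_ae_eq (b : Module.Basis ι ℝ (ι → ℝ)) {F : Set (ι → ℝ)}
    (hF : IsAddFundamentalDomain (Submodule.span ℤ (range b)) F volume) {u : (ι → ℝ) → ℂ}
    (hu : Measurable u) :
    ∃ v : UnitAddTorus ι → ℂ, Measurable v ∧ v ∘ toTorus b =ᵐ[volume.restrict F] u := by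
  obtain ⟨S, -, hS, hSF, hinj⟩ := exists_measurable_subset_injOn_toTorus b hF
  obtain ⟨v, hv, hvu⟩ := exists_measurable_comp_eq (τ := toTorus b) hS
    ((continuous_toTorus b).measurable.comp measurable_subtype_coe) hinj hu
  refine ⟨v, hv, ?_⟩
  rw [← Measure.restrict_congr_set hSF]
  exact ae_restrict_of_forall_mem hS hvu

theorem tsum_enorm_sq_integral_basisCharacter (b : Module.Basis ι ℝ (ι → ℝ)) {F : Set (ι → ℝ)}
    (hF : IsAddFundamentalDomain (Submodule.span ℤ (range b)) F volume) {u : (ι → ℝ) → ℂ}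
    (hu : Measurable u) (hu2 : MemLp u 2 volume) (hu0 : ∀ x ∉ F, u x = 0) :
    ∑' z : ι → ℤ, ‖∫ x, Circle.coeHom (basisCharacter b z x) * u x‖ₑ ^ 2 =
      ENNReal.ofReal (covol b) * ∫⁻ x, ‖u x‖ₑ ^ 2 := by
  obtain ⟨v, hv, hvu⟩ := exists_measurable_comp_toTorus_ae_eq b hF hu
  have hv2 : MemLp v 2 (torusMeasure ι) :=
    memLp_of_memLp_comp_toTorus b hF hv ((hu2.restrict F).ae_eq hvu.symm)
  have hnorm : ∫⁻ x, ‖u x‖ₑ ^ 2 =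
      ENNReal.ofReal (covol b) * ∫⁻ t, ‖v t‖ₑ ^ 2 ∂torusMeasure ι := by
    rw [← lintegral_comp_toTorus b hF (g := fun t => ‖v t‖ₑ ^ 2) (by fun_prop),
      ← setLIntegral_eq_of_support_subset (s := F) fun x hx => by
        by_contra hxF
        exact hx (by simp [hu0 x hxF])]
    exact lintegral_congr_ae (hvu.mono fun x hx => congrArg (fun w : ℂ => ‖w‖ₑ ^ 2) hx.symm)
  have hcoeff : ∀ z : ι → ℤ, ∫ x, Circle.coeHom (basisCharacter b z x) * u x =
      covol b * ∫ t, UnitAddTorus.mFourier z t * v t ∂torusMeasure ι := fun z => by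
    rw [← integral_comp_toTorus b hF (g := fun t => UnitAddTorus.mFourier z t * v t) (by fun_prop),
      ← setIntegral_eq_integral_of_forall_compl_eq_zero (s := F)
        fun x hx => by rw [hu0 x hx, mul_zero]]
    exact integral_congr_ae (hvu.mono fun x hx => by
      simp only [← hx, mFourier_toTorus, Function.comp_apply])
  have hcovol : ‖(covol b : ℂ)‖ₑ = ENNReal.ofReal (covol b) := by
    rw [← ofReal_norm, Complex.norm_real, Real.norm_of_nonneg (covol_pos b).le]
  simp only [hcoeff, enorm_mul, mul_pow]
  rw [ENNReal.tsum_mul_left, tsum_enorm_sq_mFourier hv2, hnorm, hcovol, sq, mul_assoc]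

end Parseval

section Transfer

theorem memLp_two_iff_lintegral {Z : Type*} [MeasurableSpace Z] {μ : Measure Z} {f : Z → ℂ}
    (hf : AEStronglyMeasurable f μ) : MemLp f 2 μ ↔ ∫⁻ x, ‖f x‖ₑ ^ 2 ∂μ < ⊤ := by
  have hnorm := eLpNorm_lt_top_iff_lintegral_rpow_enorm_lt_top (μ := μ) (f := f) two_ne_zero
    ENNReal.ofNat_ne_top
  simp only [ENNReal.toReal_ofNat, ENNReal.rpow_ofNat] at hnorm
  rw [← hnorm]
  exact ⟨fun h => h.2, fun h => ⟨hf, h⟩⟩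

variable {Z Y : Type*} [MeasurableSpace Z] [MeasurableSpace Y] {ν : Measure Z} {κ : Measure Y}
  {Φ : Z → Y} {ρ : Y → ℝ}

theorem lintegral_comp_of_map_eq_withDensity (hΦ : AEMeasurable Φ ν) (hρ : Measurable ρ)
    (hmap : ν.map Φ = κ.withDensity fun y => ENNReal.ofReal (ρ y)) {g : Y → ℝ≥0∞}
    (hg : Measurable g) : ∫⁻ x, g (Φ x) ∂ν = ∫⁻ y, ENNReal.ofReal (ρ y) * g y ∂κ := by
  rw [← lintegral_map' hg.aemeasurable hΦ, hmap,
    lintegral_withDensity_eq_lintegral_mul _ (by fun_prop) hg]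
  rfl

theorem integral_comp_of_map_eq_withDensity (hΦ : AEMeasurable Φ ν) (hρ : Measurable ρ)
    (hρ0 : ∀ y, 0 ≤ ρ y) (hmap : ν.map Φ = κ.withDensity fun y => ENNReal.ofReal (ρ y))
    {g : Y → ℂ} (hg : Measurable g) : ∫ x, g (Φ x) ∂ν = ∫ y, (ρ y : ℂ) * g y ∂κ := by
  rw [← integral_map hΦ hg.aestronglyMeasurable, hmap,
    integral_withDensity_eq_integral_toReal_smul (by fun_prop)
      (Eventually.of_forall fun _ => ENNReal.ofReal_lt_top)]
  simp only [ENNReal.toReal_ofReal (hρ0 _), Complex.real_smul]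

variable {ι : Type*} [Fintype ι] {F : Set (ι → ℝ)}

/- Parseval is applied to `ρ u`; of the two factors `ρ` in `‖ρ u‖²`, one is absorbed by the
change of variables `Φ`. -/
theorem tsum_enorm_sq_integral_basisCharacter_comp {Φ : Z → ι → ℝ} {ρ : (ι → ℝ) → ℝ}
    (hΦ : AEMeasurable Φ ν) (hρ : Measurable ρ) (hρ0 : ∀ y, 0 ≤ ρ y)
    (hmap : ν.map Φ = volume.withDensity fun y => ENNReal.ofReal (ρ y))
    (b : Module.Basis ι ℝ (ι → ℝ))
    (hF : IsAddFundamentalDomain (Submodule.span ℤ (range b)) F volume) {u : (ι → ℝ) → ℂ}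
    (hu : Measurable u) (hu0 : ∀ y ∉ F, u y = 0)
    (hfin : ∫⁻ x, ENNReal.ofReal (covol b * ρ (Φ x)) * ‖u (Φ x)‖ₑ ^ 2 ∂ν ≠ ⊤) :
    ∑' z : ι → ℤ, ‖∫ x, Circle.coeHom (basisCharacter b z (Φ x)) * u (Φ x) ∂ν‖ₑ ^ 2 =
      ∫⁻ x, ENNReal.ofReal (covol b * ρ (Φ x)) * ‖u (Φ x)‖ₑ ^ 2 ∂ν := by
  let v : (ι → ℝ) → ℂ := fun y => ρ y * u y
  have hv : Measurable v := by fun_prop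
  have hnorm : ∀ y, ‖v y‖ₑ ^ 2 = ENNReal.ofReal (ρ y) * (ENNReal.ofReal (ρ y) * ‖u y‖ₑ ^ 2) :=
    fun y => by
      have hρy : ‖(ρ y : ℂ)‖ₑ = ENNReal.ofReal (ρ y) := by
        rw [← ofReal_norm, Complex.norm_real, Real.norm_of_nonneg (hρ0 y)]
      rw [enorm_mul, mul_pow, hρy, sq, mul_assoc]
  have hlintegral : ∫⁻ x, ENNReal.ofReal (covol b * ρ (Φ x)) * ‖u (Φ x)‖ₑ ^ 2 ∂ν =
      ENNReal.ofReal (covol b) * ∫⁻ y, ‖v y‖ₑ ^ 2 := by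
    simp only [hnorm, ENNReal.ofReal_mul (covol_pos b).le, mul_assoc]
    rw [lintegral_const_mul' _ _ ENNReal.ofReal_ne_top, lintegral_comp_of_map_eq_withDensity hΦ hρ
      hmap (g := fun y => ENNReal.ofReal (ρ y) * ‖u y‖ₑ ^ 2) (by fun_prop)]
  have hv2 : MemLp v 2 volume := by
    rw [memLp_two_iff_lintegral hv.aestronglyMeasurable]
    rw [hlintegral] at hfin
    exact ENNReal.lt_top_of_mul_ne_top_right hfin (ENNReal.ofReal_pos.2 (covol_pos b)).ne'
  have hcoeff : ∀ z : ι → ℤ, ∫ x, Circle.coeHom (basisCharacter b z (Φ x)) * u (Φ x) ∂ν =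
      ∫ y, Circle.coeHom (basisCharacter b z y) * v y := fun z => by
    have hchar : Measurable fun y => Circle.coeHom (basisCharacter b z y) :=
      (continuous_coeHom.comp (continuous_basisCharacter b z)).measurable
    rw [integral_comp_of_map_eq_withDensity hΦ hρ hρ0 hmap
      (g := fun y => Circle.coeHom (basisCharacter b z y) * u y) (hchar.mul hu)]
    simp only [v, mul_left_comm]
  simp only [hcoeff]
  rw [tsum_enorm_sq_integral_basisCharacter b hF hv hv2 fun y hy => by simp [v, hu0 y hy],
    hlintegral]

theorem tsum_enorm_sq_setIntegral_basisCharacter {Ω : Set Z} (hΩ : MeasurableSet Ω)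
    {Φ : Z → ι → ℝ} (hΦ : Measurable (Ω.domRestrict Φ)) {r : (ι → ℝ) → Z} (hr : Measurable r)
    (hrΦ : LeftInvOn r Φ Ω) (hV : MeasurableSet (Φ '' Ω)) {Ψ : (ι → ℝ) → ℝ}
    (hΨ : Measurable ((Φ '' Ω).indicator Ψ)) (hΨ0 : ∀ y ∈ Φ '' Ω, 0 ≤ Ψ y)
    (hmap : (ν.restrict Ω).map Φ =
      (volume.restrict (Φ '' Ω)).withDensity fun y => ENNReal.ofReal (Ψ y))
    (b : Module.Basis ι ℝ (ι → ℝ))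
    (hF : IsAddFundamentalDomain (Submodule.span ℤ (range b)) F volume) {f : Z → ℂ}
    (hf : Measurable f) (hfΩ : ∀ x ∉ Ω, f x = 0) (hfF : ∀ x, Φ x ∉ F → f x = 0)
    (hfin : ∫⁻ x, ENNReal.ofReal (covol b * Ψ (Φ x)) * ‖f x‖ₑ ^ 2 ∂ν ≠ ⊤) :
    ∑' z : ι → ℤ, ‖∫ x, Circle.coeHom (basisCharacter b z (Φ x)) * f x ∂ν‖ₑ ^ 2 =
      ∫⁻ x, ENNReal.ofReal (covol b * Ψ (Φ x)) * ‖f x‖ₑ ^ 2 ∂ν := by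
  set V := Φ '' Ω
  let u : (ι → ℝ) → ℂ := V.indicator (f ∘ r)
  have huf : ∀ x ∈ Ω, u (Φ x) = f x := fun x hx =>
    (indicator_of_mem (mem_image_of_mem Φ hx) _).trans (congrArg f (hrΦ hx))
  have hu0 : ∀ y ∉ F, u y = 0 := fun y hy => by
    by_cases hyV : y ∈ V
    · obtain ⟨x, hx, rfl⟩ := hyV
      rw [huf x hx, hfF x hy]
    · exact indicator_of_notMem hyV _
  have hmapV : (ν.restrict Ω).map Φ =
      volume.withDensity fun y => ENNReal.ofReal (V.indicator Ψ y) := by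
    rw [hmap, ← withDensity_indicator hV]
    exact congrArg _ (indicator_comp_of_zero ENNReal.ofReal_zero)
  have hlintegral : ∫⁻ x, ENNReal.ofReal (covol b * Ψ (Φ x)) * ‖f x‖ₑ ^ 2 ∂ν =
      ∫⁻ x in Ω, ENNReal.ofReal (covol b * V.indicator Ψ (Φ x)) * ‖u (Φ x)‖ₑ ^ 2 ∂ν := by
    rw [← setLIntegral_eq_of_support_subset (s := Ω) fun x hx => by
      by_contra hxΩ
      exact hx (by simp [hfΩ x hxΩ])]
    exact setLIntegral_congr_fun hΩ fun x hx => by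
      rw [huf x hx, indicator_of_mem (mem_image_of_mem Φ hx)]
  have hcoeff : ∀ z : ι → ℤ, ∫ x, Circle.coeHom (basisCharacter b z (Φ x)) * f x ∂ν =
      ∫ x in Ω, Circle.coeHom (basisCharacter b z (Φ x)) * u (Φ x) ∂ν := fun z => by
    rw [← setIntegral_eq_integral_of_forall_compl_eq_zero (s := Ω) fun x hx => by
      rw [hfΩ x hx, mul_zero]]
    exact setIntegral_congr_fun hΩ fun x hx => by rw [huf x hx]
  simp only [hcoeff, hlintegral] at hfin ⊢
  exact tsum_enorm_sq_integral_basisCharacter_comp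
    (aemeasurable_restrict_of_measurable_subtype hΩ hΦ) hΨ (indicator_nonneg hΨ0) hmapV b hF
    ((hf.comp hr).indicator hV) hu0 hfin

end Transfer

/-! ### Frames whose frame operator is a multiplication operator -/

section Multiplier

theorem lintegral_enorm_sq_Lp {Z : Type*} [MeasurableSpace Z] {μ : Measure Z} (h : Lp ℂ 2 μ) :
    ∫⁻ x, ‖h x‖ₑ ^ 2 ∂μ = ENNReal.ofReal (‖h‖ ^ 2) := by
  have hnorm := eLpNorm_eq_lintegral_rpow_enorm_toReal (μ := μ) (f := h) two_ne_zero
    ENNReal.ofNat_ne_top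
  simp only [ENNReal.toReal_ofNat, ENNReal.rpow_ofNat] at hnorm
  rw [ENNReal.ofReal_pow (norm_nonneg _), ofReal_norm, Lp.enorm_def, hnorm,
    ← ENNReal.rpow_natCast, ← ENNReal.rpow_mul]
  simp

theorem ofReal_mul_norm_sq_Lp {Z : Type*} [MeasurableSpace Z] {μ : Measure Z} {c : ℝ}
    (hc : 0 ≤ c) (h : Lp ℂ 2 μ) :
    ENNReal.ofReal (c * ‖h‖ ^ 2) = ∫⁻ x, ENNReal.ofReal c * ‖h x‖ₑ ^ 2 ∂μ := by
  rw [ENNReal.ofReal_mul hc, ← lintegral_enorm_sq_Lp,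
    lintegral_const_mul' _ _ ENNReal.ofReal_ne_top]

theorem exists_lintegral_mul_enorm_sq_eq_setLIntegral {Z : Type*} [MeasurableSpace Z]
    {μ : Measure Z} {U : Set Z} (hU : MeasurableSet U) (hμU : μ U ≠ ⊤) :
    ∃ h : Lp ℂ 2 μ, ∀ W : Z → ℝ≥0∞, ∫⁻ x, W x * ‖h x‖ₑ ^ 2 ∂μ = ∫⁻ x in U, W x ∂μ := by
  refine ⟨indicatorConstLp 2 hU hμU 1, fun W => ?_⟩
  rw [← lintegral_indicator hU]
  refine lintegral_congr_ae ?_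
  filter_upwards [indicatorConstLp_coeFn (p := 2) (hs := hU) (hμs := hμU) (c := (1 : ℂ))] with x hx
  rw [hx]
  by_cases hxU : x ∈ U <;> simp [hxU]

variable {Z : Type*} [TopologicalSpace Z] [MeasurableSpace Z] {μ : Measure Z}
  [IsLocallyFiniteMeasure μ] [μ.IsOpenPosMeasure]

theorem exists_isOpen_subset_measure_ne {V : Set Z} (hV : IsOpen V) (hne : V.Nonempty) :
    ∃ U ⊆ V, IsOpen U ∧ μ U ≠ 0 ∧ μ U ≠ ⊤ := by
  obtain ⟨x, hx⟩ := hne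
  obtain ⟨N, hxN, hN, hμN⟩ := μ.exists_isOpen_measure_lt_top x
  exact ⟨V ∩ N, inter_subset_left, hV.inter hN, (hV.inter hN).measure_ne_zero μ ⟨x, hx, hxN⟩,
    measure_ne_top_of_subset inter_subset_right hμN.ne⟩

variable [BorelSpace Z] {W : Z → ℝ≥0∞}

theorem le_of_forall_lintegral_const_mul_le (hW : Continuous W) {c : ℝ≥0∞}
    (hc : ∀ h : Lp ℂ 2 μ, ∫⁻ x, c * ‖h x‖ₑ ^ 2 ∂μ ≤ ∫⁻ x, W x * ‖h x‖ₑ ^ 2 ∂μ) (x : Z) :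
    c ≤ W x := by
  by_contra! hlt
  obtain ⟨r, hxr, hrc⟩ := exists_between hlt
  obtain ⟨U, hUr, hU, hU0, hUtop⟩ :=
    exists_isOpen_subset_measure_ne (μ := μ) (isOpen_Iio.preimage hW) ⟨x, hxr⟩
  obtain ⟨h, hh⟩ := exists_lintegral_mul_enorm_sq_eq_setLIntegral hU.measurableSet hUtop
  have hle : c * μ U ≤ r * μ U :=
    calc c * μ U = ∫⁻ x, c * ‖h x‖ₑ ^ 2 ∂μ := by rw [hh, setLIntegral_const]
      _ ≤ ∫⁻ x in U, W x ∂μ := (hc h).trans_eq (hh W)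
      _ ≤ r * μ U := by
        rw [← setLIntegral_const]
        exact setLIntegral_mono measurable_const fun y hy => (hUr hy).le
  exact hle.not_gt (ENNReal.mul_lt_mul_left hU0 hUtop hrc)

theorem le_of_forall_lintegral_le_const_mul (hW : Continuous W) {c : ℝ≥0∞}
    (hc : ∀ h : Lp ℂ 2 μ, ∫⁻ x, W x * ‖h x‖ₑ ^ 2 ∂μ ≤ ∫⁻ x, c * ‖h x‖ₑ ^ 2 ∂μ) (x : Z) :
    W x ≤ c := by
  by_contra! hlt
  obtain ⟨r, hcr, hrx⟩ := exists_between hlt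
  obtain ⟨U, hUr, hU, hU0, hUtop⟩ :=
    exists_isOpen_subset_measure_ne (μ := μ) (isOpen_Ioi.preimage hW) ⟨x, hrx⟩
  obtain ⟨h, hh⟩ := exists_lintegral_mul_enorm_sq_eq_setLIntegral hU.measurableSet hUtop
  have hle : r * μ U ≤ c * μ U :=
    calc r * μ U ≤ ∫⁻ x in U, W x ∂μ := by
          rw [← setLIntegral_const]
          exact setLIntegral_mono hW.measurable fun y hy => (hUr hy).le
      _ ≤ ∫⁻ x, c * ‖h x‖ₑ ^ 2 ∂μ := (hh W).symm.trans_le (hc h)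
      _ = c * μ U := by rw [hh, setLIntegral_const]
  exact hle.not_gt (ENNReal.mul_lt_mul_left hU0 hUtop hcr)

theorem frame_of_multiplier [Nonempty Z] {ι : Type*} {v : ι → Lp ℂ 2 μ} (hW : Continuous W)
    (hv : ∀ h : Lp ℂ 2 μ, ∑' i, ‖⟪h, v i⟫_ℂ‖ₑ ^ 2 = ∫⁻ x, W x * ‖h x‖ₑ ^ 2 ∂μ)
    (hinf : 0 < ⨅ x, W x) (hsup : ⨆ x, W x < ⊤) :
    IsFrame v ∧ IsGreatest {a | IsLowerFrameBound v a} (⨅ x, W x).toReal ∧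
      IsLeast {b | IsUpperFrameBound v b} (⨆ x, W x).toReal := by
  have hle : ⨅ x, W x ≤ ⨆ x, W x := iInf_le_iSup
  have hinf_top : ⨅ x, W x ≠ ⊤ := (hle.trans_lt hsup).ne
  have hlower : IsLowerFrameBound v (⨅ x, W x).toReal := by
    refine ⟨ENNReal.toReal_pos hinf.ne' hinf_top, fun h => ?_⟩
    rw [hv, ofReal_mul_norm_sq_Lp ENNReal.toReal_nonneg, ENNReal.ofReal_toReal hinf_top]
    exact lintegral_mono fun x => mul_le_mul_left (iInf_le W x) _
  have hupper : IsUpperFrameBound v (⨆ x, W x).toReal := by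
    refine ⟨ENNReal.toReal_pos (hinf.trans_le hle).ne' hsup.ne, fun h => ?_⟩
    rw [hv, ofReal_mul_norm_sq_Lp ENNReal.toReal_nonneg, ENNReal.ofReal_toReal hsup.ne]
    exact lintegral_mono fun x => mul_le_mul_left (le_iSup W x) _
  refine ⟨⟨_, _, ENNReal.toReal_mono hsup.ne hle, hlower, hupper⟩, ⟨hlower, ?_⟩, ⟨hupper, ?_⟩⟩
  · rintro a ⟨ha, hbound⟩
    rw [← ENNReal.ofReal_le_iff_le_toReal hinf_top]
    refine le_iInf (le_of_forall_lintegral_const_mul_le (μ := μ) hW fun h => ?_)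
    rw [← ofReal_mul_norm_sq_Lp ha.le, ← hv]
    exact hbound h
  · rintro b ⟨hb, hbound⟩
    refine ENNReal.toReal_le_of_le_ofReal hb.le (iSup_le ?_)
    refine le_of_forall_lintegral_le_const_mul (μ := μ) hW fun h => ?_
    rw [← ofReal_mul_norm_sq_Lp hb.le, ← hv]
    exact hbound h

end Multiplier

/-! ### Periodization over a subset of a group -/

section LocallyFinite

variable {M : Type*} [Group M] [TopologicalSpace M] [IsTopologicalGroup M] {g : M → ℝ≥0∞}
  {Γ : Set M}

theorem finite_inter_of_tsum_ne_top (hg : Continuous g) {m₀ : M} (hm₀ : g m₀ ≠ 0)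
    (hsum : ∀ m, ∑' γ : Γ, g (γ * m) ≠ ⊤) {C : Set M} (hC : IsCompact C) : (Γ ∩ C).Finite := by
  refine hC.induction_on (p := fun S => (Γ ∩ S).Finite) (by simp)
    (fun S T hST hT => hT.subset (inter_subset_inter_right _ hST))
    (fun S T hS hT => by rw [inter_union_distrib_left]; exact hS.union hT) fun γ₀ _ => ?_
  obtain ⟨r, hr0, hr⟩ := exists_between (pos_iff_ne_zero.2 hm₀)
  have htendsto : Tendsto (fun γ : M => g (γ * (γ₀⁻¹ * m₀))) (𝓝 γ₀) (𝓝 (g m₀)) := by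
    have hcont : Continuous fun γ : M => g (γ * (γ₀⁻¹ * m₀)) := by fun_prop
    simpa using hcont.tendsto γ₀
  refine ⟨_, mem_nhdsWithin_of_mem_nhds (htendsto.eventually (lt_mem_nhds hr)), ?_⟩
  have hfinite := ENNReal.finite_const_le_of_tsum_ne_top (hsum (γ₀⁻¹ * m₀)) hr0.ne'
  refine (hfinite.image Subtype.val).subset ?_
  rintro γ ⟨hγ, hrγ⟩
  exact ⟨⟨γ, hγ⟩, (le_of_lt hrγ : r ≤ g (γ * (γ₀⁻¹ * m₀))), rfl⟩

theorem continuous_tsum_mul_left [LocallyCompactSpace M] (hg : Continuous g)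
    (hgc : HasCompactSupport g) {m₀ : M} (hm₀ : g m₀ ≠ 0)
    (hsum : ∀ m, ∑' γ : Γ, g (γ * m) ≠ ⊤) : Continuous fun m => ∑' γ : Γ, g (γ * m) := by
  have hlf : LocallyFinite fun γ : Γ => Function.support fun m => g (γ * m) := by
    intro m
    obtain ⟨U, hU, hUm⟩ := exists_compact_mem_nhds m
    refine ⟨U, hUm, ?_⟩
    have hfinite := finite_inter_of_tsum_ne_top hg hm₀ hsum (hgc.isCompact.mul hU.inv)
    refine Finite.of_finite_image (f := Subtype.val) (hfinite.subset ?_)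
      Subtype.val_injective.injOn
    rintro _ ⟨γ, ⟨x, hx, hxU⟩, rfl⟩
    exact ⟨γ.2, _, subset_tsupport g hx, x⁻¹, inv_mem_inv.2 hxU, by simp⟩
  have hfinsum : (fun m => ∑' γ : Γ, g (γ * m)) = fun m => ∑ᶠ γ : Γ, g (γ * m) :=
    funext fun m => tsum_eq_finsum (hlf.point_finite m)
  rw [hfinsum]
  exact continuous_finsum (fun γ => by fun_prop) hlf

theorem countable_of_tsum_ne_top [SigmaCompactSpace M] (hg : Continuous g) {m₀ : M}
    (hm₀ : g m₀ ≠ 0) (hsum : ∀ m, ∑' γ : Γ, g (γ * m) ≠ ⊤) : Γ.Countable := by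
  have hcover : Γ = ⋃ n, Γ ∩ compactCovering M n := by
    rw [← inter_iUnion, iUnion_compactCovering, inter_univ]
  rw [hcover]
  exact countable_iUnion fun n =>
    (finite_inter_of_tsum_ne_top hg hm₀ hsum (isCompact_compactCovering M n)).countable

end LocallyFinite

/-! ### Coefficients of the induced representation -/

section Coefficients

theorem conjP_conjP {G : Type*} [Group G] {P M : Subgroup G} [P.Normal] (p : P) (γ m : M) :
    conjP (conjP p γ) m = conjP p (γ * m) := by
  apply Subtype.ext
  simp only [conjP, Subgroup.coe_mul]
  group

theorem inner_indRep {G : Type*} [TopologicalSpace G] [Group G] [IsTopologicalGroup G]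
    [MeasurableSpace G] [BorelSpace G] {P M : Subgroup G} [P.Normal] (hPM : P.IsComplement' M)
    (χ : P →ₜ* Circle) (μ : Measure M) [μ.IsMulLeftInvariant] {s : M → ℂ} (hs : MemLp s 2 μ)
    (p : P) (γ : M) (h : Lp ℂ 2 μ) :
    ⟪h, indRep hPM χ μ ((γ : G)⁻¹ * p) (hs.toLp s)⟫_ℂ =
      ∫ m, Circle.coeHom (χ (conjP p m)) * (s m * (starRingEnd ℂ) (h (γ⁻¹ * m))) ∂μ := by
  have hfactor : (γ : G)⁻¹ * p = (conjP p γ : P) * ((γ⁻¹ : M) : G) := by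
    simp only [conjP, Subgroup.coe_inv]
    group
  have htranslate : (fun m => hs.toLp s (γ * m)) =ᵐ[μ] fun m => s (γ * m) :=
    (measurePreserving_mul_left μ γ).quasiMeasurePreserving.ae_eq_comp hs.coeFn_toLp
  rw [hfactor, L2.inner_def, ← integral_mul_left_eq_self (fun m =>
    Circle.coeHom (χ (conjP p m)) * (s m * (starRingEnd ℂ) (h (γ⁻¹ * m)))) γ]
  refine integral_congr_ae ?_
  filter_upwards [indRep_ae hPM χ μ (conjP p γ) γ⁻¹ (hs.toLp s), htranslate] with m hrep hm
  rw [RCLike.inner_apply, hrep, inv_inv, hm, conjP_conjP, inv_mul_cancel_left, mul_assoc]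

end Coefficients

/-! ### The dual lattice -/

section Lattice

variable {n : ℕ}

/-- The basis `(L^{-T} X_k^*)` of the dual lattice, in the coordinates given by `(X_j^*)`. -/
def dualBasis (L : GL (Fin n) ℝ) : Module.Basis (Fin n) ℝ (Fin n → ℝ) :=
  Module.Basis.ofEquivFun (Matrix.toLin'OfInv
    (M := ((↑L⁻¹ : Matrix (Fin n) (Fin n) ℝ)ᵀ)) (M' := (L : Matrix (Fin n) (Fin n) ℝ)ᵀ)
    (by rw [← Matrix.transpose_mul, ← Units.val_mul, mul_inv_cancel]; simp)
    (by rw [← Matrix.transpose_mul, ← Units.val_mul, inv_mul_cancel]; simp))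

theorem dualBasis_equivFun (L : GL (Fin n) ℝ) (ξ : Fin n → ℝ) :
    (dualBasis L).equivFun ξ = (L : Matrix (Fin n) (Fin n) ℝ)ᵀ *ᵥ ξ := by
  rw [dualBasis, Module.Basis.equivFun_ofEquivFun]
  exact Matrix.toLin'_apply (L : Matrix (Fin n) (Fin n) ℝ)ᵀ ξ

theorem dualLattice_eq_span_dualBasis (L : GL (Fin n) ℝ) :
    dualLattice L = Submodule.span ℤ (range (dualBasis L)) := by
  rw [dualLattice]
  congr 2
  ext k : 1
  rw [dualBasis, Module.Basis.coe_ofEquivFun]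
  exact ((Matrix.toLin'_apply _ _).trans
    (Matrix.mulVec_single_one ((↑L⁻¹ : Matrix (Fin n) (Fin n) ℝ)ᵀ) k)).symm

theorem covol_dualBasis (L : GL (Fin n) ℝ) :
    covol (dualBasis L) = |((↑L⁻¹ : Matrix (Fin n) (Fin n) ℝ)ᵀ).det| := by
  have hlin : ((dualBasis L).equivFun : (Fin n → ℝ) →ₗ[ℝ] (Fin n → ℝ)) =
      Matrix.toLin' (L : Matrix (Fin n) (Fin n) ℝ)ᵀ := by
    refine LinearMap.ext fun ξ => ?_
    rw [Matrix.toLin'_apply]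
    exact dualBasis_equivFun L ξ
  rw [covol, hlin, LinearMap.det_toLin', Matrix.det_transpose, Matrix.det_transpose,
    Matrix.coe_units_inv, Matrix.det_nonsing_inv, Ring.inverse_eq_inv']

/- A nonzero linear functional is an open map, so it cannot take only integer values on a nonempty
open set. -/
theorem eq_of_eqOn_basisCharacter {ι : Type*} [Fintype ι] (b : Module.Basis ι ℝ (ι → ℝ))
    {V : Set (ι → ℝ)} (hV : IsOpen V) (hne : V.Nonempty) {z z' : ι → ℤ}
    (h : EqOn (basisCharacter b z) (basisCharacter b z') V) : z = z' := by
  let ℓ : (ι → ℝ) →ₗ[ℝ] ℝ := b.constr ℝ fun i => (z i : ℝ) - z' i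
  have hℓ : ∀ ξ, ℓ ξ = ∑ i, z i * b.equivFun ξ i - ∑ i, z' i * b.equivFun ξ i := fun ξ => by
    rw [b.constr_apply_fintype ℝ, ← Finset.sum_sub_distrib]
    exact Finset.sum_congr rfl fun i _ => by rw [smul_eq_mul]; ring
  have hinteger : ℓ '' V ⊆ range ((↑) : ℤ → ℝ) := by
    rintro _ ⟨ξ, hξ, rfl⟩
    obtain ⟨k, hk⟩ := Circle.exp_eq_exp.1 (h hξ)
    refine ⟨k, mul_left_cancel₀ Real.two_pi_pos.ne' ?_⟩
    rw [hℓ]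
    linarith
  have hℓ0 : ℓ = 0 := by
    by_contra hℓ0
    have hopen : IsOpen (ℓ '' V) :=
      ℓ.isOpenMap_of_finiteDimensional (LinearMap.surjective hℓ0) V hV
    have hcountable : (ℓ '' V).Countable := (countable_range _).mono hinteger
    exact hopen.measure_ne_zero volume (hne.image ℓ) (hcountable.measure_zero volume)
  ext i
  have hi : (z i : ℝ) - z' i = 0 :=
    (b.constr_basis ℝ (fun i => (z i : ℝ) - z' i) i).symm.trans (DFunLike.congr_fun hℓ0 (b i))
  exact_mod_cast sub_eq_zero.1 hi

end Lattice

/-! ### The frame operator -/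

section FrameOperator

variable {d : ℕ} {G : Type*} [TopologicalSpace G] [ChartedSpace (EuclideanSpace ℝ (Fin d)) G]
  [Group G] [LieGroup (𝓡 d) ∞ G] {P M : Subgroup G}
  {𝔪 : LieSubalgebra ℝ (GroupLieAlgebra (𝓡 d) G)} {𝔭 : LieIdeal ℝ (GroupLieAlgebra (𝓡 d) G)}
  {n₁ n₂ : ℕ}

/-- The element of the lattice `Λ ⊆ 𝔭` with coordinates `z` in the basis `(L X_j)_{j ∈ J}`. -/
def latticeVec (X : Module.Basis (Fin n₁) ℝ 𝔭) (J : Fin n₂ ↪o Fin n₁) (L : GL (Fin n₂) ℝ)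
    (z : Fin n₂ → ℤ) : 𝔭 :=
  ∑ k, z k • ∑ i, (L : Matrix (Fin n₂) (Fin n₂) ℝ) i k • X (J i)

/-- The element `exp Y` of `Γ_P ⊆ P`, where `Y` is the element of `Λ` with coordinates `z`. -/
def latticePoint (hP : (P : Set G) = lieExp '' (𝔭 : Set (GroupLieAlgebra (𝓡 d) G)))
    (X : Module.Basis (Fin n₁) ℝ 𝔭) (J : Fin n₂ ↪o Fin n₁) (L : GL (Fin n₂) ℝ)
    (z : Fin n₂ → ℤ) : P :=
  ⟨lieExp (latticeVec X J L z : GroupLieAlgebra (𝓡 d) G),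
    hP.symm.subset (mem_image_of_mem _ (latticeVec X J L z).2)⟩

/-- `χ` is the character `χ_λ` of `P = exp 𝔭`, given by `χ_λ (exp Y) = e^{2πi λ(Y)}`. -/
def IsExpCharacter (lam : Module.Dual ℝ 𝔭) (χ : P →ₜ* Circle) : Prop :=
  ∀ (Y : 𝔭) (hY : lieExp (Y : GroupLieAlgebra (𝓡 d) G) ∈ P),
    χ ⟨lieExp (Y : GroupLieAlgebra (𝓡 d) G), hY⟩ = Circle.exp (2 * Real.pi * lam Y)

theorem theta_latticeVec (A : Module.Basis (Fin n₂) ℝ 𝔪) (X : Module.Basis (Fin n₁) ℝ 𝔭)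
    (lam : Module.Dual ℝ 𝔭) (J : Fin n₂ ↪o Fin n₁) (L : GL (Fin n₂) ℝ) (z : Fin n₂ → ℤ)
    (a : Fin n₂ → ℝ) : theta A X lam a (latticeVec X J L z) =
      ∑ k, z k * (dualBasis L).equivFun (beta A X lam J a) k := by
  rw [latticeVec, map_sum]
  refine Finset.sum_congr rfl fun k _ => ?_
  rw [map_zsmul, map_sum, dualBasis_equivFun, zsmul_eq_mul]
  congr 1
  exact Finset.sum_congr rfl fun i _ => map_smul (theta A X lam a) _ _

theorem gammaSet_eq_range (hP : (P : Set G) = lieExp '' (𝔭 : Set (GroupLieAlgebra (𝓡 d) G)))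
    (X : Module.Basis (Fin n₁) ℝ 𝔭) (J : Fin n₂ ↪o Fin n₁) (L : GL (Fin n₂) ℝ) (ΓM : Set M) :
    gammaSet X J L ΓM =
      range fun q : ΓM × (Fin n₂ → ℤ) => ((q.1 : M) : G)⁻¹ * latticePoint hP X J L q.2 := by
  ext κ
  constructor
  · rintro ⟨g, ⟨γ, hγ, hγg⟩, _, ⟨Y, hY, rfl⟩, rfl⟩
    obtain ⟨z, rfl⟩ := (Submodule.mem_span_range_iff_exists_fun ℤ).1 hY
    exact ⟨(⟨γ, hγ⟩, z), congrArg (· * _) (inv_eq_iff_eq_inv.2 hγg)⟩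
  · rintro ⟨⟨γ, z⟩, rfl⟩
    have hγ : ((γ : M) : G)⁻¹ ∈ ((fun γ : M => (γ : G)) '' ΓM)⁻¹ :=
      inv_mem_inv.2 (mem_image_of_mem _ γ.2)
    exact mul_mem_mul hγ
      (mem_image_of_mem _ ((Submodule.mem_span_range_iff_exists_fun ℤ).2 ⟨z, rfl⟩))

variable {hM : (M : Set G) = lieExp '' (𝔪 : Set (GroupLieAlgebra (𝓡 d) G))}
  {lam : Module.Dual ℝ 𝔭} {X : Module.Basis (Fin n₁) ℝ 𝔭} {A : Module.Basis (Fin n₂) ℝ 𝔪}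
  {J : Fin n₂ ↪o Fin n₁} {O : Set (Fin n₂ → ℝ)} {ε : ℝ}

variable [T2Space G]

theorem isOpen_beta_image_openCube (h : CoadjointCoords hM lam X A J O)
    (hεO : closedCube n₂ ε ⊆ O) : IsOpen (beta A X lam J '' openCube n₂ ε) :=
  h.diffeo.isOpen_image (isOpen_openCube _ _) ((openCube_subset_closedCube _ _).trans hεO)

variable [P.Normal] {χ : P →ₜ* Circle}

/- Since `m⁻¹ (exp Y) m = exp (C(a) Y)` for `m = e(a)`, the character takes the value
`e^{2πi θ(a)(Y)}`, and `θ(a)(Y)` only involves `β_J(a)` when `Y ∈ Λ`. -/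
theorem character_conjP_latticePoint (h : CoadjointCoords hM lam X A J O)
    (hεO : closedCube n₂ ε ⊆ O)
    (hP : (P : Set G) = lieExp '' (𝔭 : Set (GroupLieAlgebra (𝓡 d) G)))
    (hχ : IsExpCharacter lam χ) (L : GL (Fin n₂) ℝ) (z : Fin n₂ → ℤ) {m : M}
    (hm : m ∈ omegaOpen M A ε) :
    χ (conjP (latticePoint hP X J L z) m) =
      basisCharacter (dualBasis L) z (phi A X lam J ε m) := by
  rw [omegaOpen_eq_image hM] at hm
  obtain ⟨a, ha, rfl⟩ := hm
  have hconj : (conjP (latticePoint hP X J L z) (coordM hM A a) : G) =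
      lieExp (opC A X a (latticeVec X J L z) : GroupLieAlgebra (𝓡 d) G) := by
    have hAd := conj_lieExp (secondKind A a : G)⁻¹
      (latticeVec X J L z : GroupLieAlgebra (𝓡 d) G)
    rwa [inv_inv, lieAd_secondKind_inv X A a] at hAd
  calc χ (conjP (latticePoint hP X J L z) (coordM hM A a))
      = χ ⟨lieExp (opC A X a (latticeVec X J L z) : GroupLieAlgebra (𝓡 d) G),
          hconj ▸ SetLike.coe_mem _⟩ := congrArg χ (Subtype.ext hconj)
    _ = Circle.exp (2 * Real.pi * theta A X lam a (latticeVec X J L z)) := hχ _ _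
    _ = basisCharacter (dualBasis L) z (phi A X lam J ε (coordM hM A a)) := by
      rw [phi_coordM h hεO ha, theta_latticeVec, basisCharacter]

theorem injective_latticePoint (h : CoadjointCoords hM lam X A J O) (hε : 0 < ε)
    (hεO : closedCube n₂ ε ⊆ O)
    (hP : (P : Set G) = lieExp '' (𝔭 : Set (GroupLieAlgebra (𝓡 d) G)))
    (hχ : IsExpCharacter lam χ) (L : GL (Fin n₂) ℝ) :
    Function.Injective (latticePoint hP X J L) := by
  intro z z' hzz'
  refine eq_of_eqOn_basisCharacter (dualBasis L) (isOpen_beta_image_openCube h hεO)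
    ⟨_, mem_image_of_mem _ (zero_mem_openCube n₂ hε)⟩ ?_
  rw [← phi_image_omegaOpen h hεO]
  rintro _ ⟨m, hm, rfl⟩
  rw [← character_conjP_latticePoint h hεO hP hχ L z hm, hzz',
    character_conjP_latticePoint h hεO hP hχ L z' hm]

theorem tsum_gammaSet (h : CoadjointCoords hM lam X A J O) (hε : 0 < ε)
    (hεO : closedCube n₂ ε ⊆ O) (hPM : P.IsComplement' M)
    (hP : (P : Set G) = lieExp '' (𝔭 : Set (GroupLieAlgebra (𝓡 d) G)))
    (hχ : IsExpCharacter lam χ) (L : GL (Fin n₂) ℝ) (ΓM : Set M) (w : G → ℝ≥0∞) :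
    ∑' κ : gammaSet X J L ΓM, w κ =
      ∑' (γ : ΓM) (z : Fin n₂ → ℤ), w (((γ : M) : G)⁻¹ * latticePoint hP X J L z) := by
  have hinj : Function.Injective fun q : ΓM × (Fin n₂ → ℤ) =>
      ((q.1 : M) : G)⁻¹ * latticePoint hP X J L q.2 :=
    (Subgroup.mul_injective_of_disjoint hPM.disjoint.symm).comp
      ((inv_injective.comp Subtype.val_injective).prodMap
        (injective_latticePoint h hε hεO hP hχ L))
  rw [gammaSet_eq_range hP, tsum_range w hinj, ENNReal.tsum_prod']

end FrameOperator

section FrameIdentity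

theorem lintegral_enorm_sq_mul_ne_top {Z : Type*} [MeasurableSpace Z] {μ : Measure Z} {g : Z → ℂ}
    {C : ℝ} (hg : ∀ x, ‖g x‖ ≤ C) (f : Lp ℂ 2 μ) : ∫⁻ x, ‖g x‖ₑ ^ 2 * ‖f x‖ₑ ^ 2 ∂μ ≠ ⊤ := by
  refine ne_top_of_le_ne_top (b := ENNReal.ofReal C ^ 2 * ENNReal.ofReal (‖f‖ ^ 2))
    (ENNReal.mul_ne_top (by finiteness) ENNReal.ofReal_ne_top) ?_
  rw [← lintegral_enorm_sq_Lp, ← lintegral_const_mul' _ _ (by finiteness)]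
  refine lintegral_mono fun x => ?_
  gcongr
  rw [← ofReal_norm]
  exact ENNReal.ofReal_le_ofReal (hg x)

variable {d : ℕ} {G : Type*} [TopologicalSpace G] [ChartedSpace (EuclideanSpace ℝ (Fin d)) G]
  [Group G] [LieGroup (𝓡 d) ∞ G] [MeasurableSpace G] {P M : Subgroup G}
  {𝔪 : LieSubalgebra ℝ (GroupLieAlgebra (𝓡 d) G)} {𝔭 : LieIdeal ℝ (GroupLieAlgebra (𝓡 d) G)}
  {n₁ n₂ : ℕ} {hM : (M : Set G) = lieExp '' (𝔪 : Set (GroupLieAlgebra (𝓡 d) G))}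
  {lam : Module.Dual ℝ 𝔭} {X : Module.Basis (Fin n₁) ℝ 𝔭} {A : Module.Basis (Fin n₂) ℝ 𝔪}
  {J : Fin n₂ ↪o Fin n₁} {O : Set (Fin n₂ → ℝ)} {ε : ℝ} {μ : Measure M} {s : M → ℂ}

theorem hasCompactSupport_upsilon (hsc : HasCompactSupport s) (L : GL (Fin n₂) ℝ) :
    HasCompactSupport (upsilon A X lam J ε μ L s) :=
  hsc.mul_left

theorem exists_enorm_upsilon_sq_ne_zero {L : GL (Fin n₂) ℝ} {ΓM : Set M}
    (hinf : 0 < ⨅ m, upsilonSum A X lam J ε μ L s ΓM m) :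
    ∃ m, ‖upsilon A X lam J ε μ L s m‖ₑ ^ 2 ≠ 0 := by
  by_contra! hzero
  refine (hinf.trans_le (iInf_le _ 1)).ne' ?_
  simp only [upsilonSum, hzero, tsum_zero]

variable [T2Space G]

theorem enorm_upsilon_sq (h : CoadjointCoords hM lam X A J O) (hεO : closedCube n₂ ε ⊆ O)
    (hψ : IsHaarDensity A X lam J ε μ (psi A X lam J ε μ)) (hsΩ : tsupport s ⊆ omegaOpen M A ε)
    (L : GL (Fin n₂) ℝ) (m : M) :
    ‖upsilon A X lam J ε μ L s m‖ₑ ^ 2 =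
      ENNReal.ofReal (covol (dualBasis L) * psi A X lam J ε μ (phi A X lam J ε m)) *
        ‖s m‖ₑ ^ 2 := by
  by_cases hm : m ∈ omegaOpen M A ε
  · have hpos : 0 < psi A X lam J ε μ (phi A X lam J ε m) :=
      hψ.2.1 _ (phi_image_omegaOpen h hεO ▸ mem_image_of_mem _ hm)
    rw [upsilon, enorm_mul, mul_pow, covol_dualBasis, ← ofReal_norm, Complex.norm_real,
      Real.norm_of_nonneg (Real.sqrt_nonneg _), ← ENNReal.ofReal_pow (Real.sqrt_nonneg _),
      Real.sq_sqrt (mul_nonneg hpos.le (abs_nonneg _)), mul_comm (psi A X lam J ε μ _)]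
  · have hsm : s m = 0 := image_eq_zero_of_notMem_tsupport fun hmem => hm (hsΩ hmem)
    simp [upsilon, hsm]

theorem exists_measurable_leftInvOn_phi [BorelSpace G]
    (h : CoadjointCoords hM lam X A J O) (hεO : closedCube n₂ ε ⊆ O) :
    ∃ r, Measurable r ∧ LeftInvOn r (phi A X lam J ε) (omegaOpen M A ε) := by
  classical
  have hSO : openCube n₂ ε ⊆ O := (openCube_subset_closedCube _ _).trans hεO
  let V := beta A X lam J '' openCube n₂ ε
  let r : (Fin n₂ → ℝ) → M :=
    V.piecewise (coordM hM A ∘ Function.invFunOn (beta A X lam J) O) fun _ => 1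
  refine ⟨r, ContinuousOn.measurable_piecewise ?_ continuousOn_const
    (isOpen_beta_image_openCube h hεO).measurableSet, ?_⟩
  · exact h.continuous_coord.comp_continuousOn (h.continuousOn_invFunOn.mono (image_mono hSO))
  · rw [omegaOpen_eq_image hM]
    rintro _ ⟨a, ha, rfl⟩
    have hinv : Function.invFunOn (beta A X lam J) O (beta A X lam J a) = a :=
      h.diffeo.injOn.leftInvOn_invFunOn (hSO ha)
    rw [phi_coordM h hεO ha]
    exact (piecewise_eq_of_mem _ _ _ (mem_image_of_mem _ ha)).trans (congrArg (coordM hM A) hinv)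

variable [IsTopologicalGroup G]

theorem continuous_upsilon (h : CoadjointCoords hM lam X A J O) (hεO : closedCube n₂ ε ⊆ O)
    (hψ : IsHaarDensity A X lam J ε μ (psi A X lam J ε μ)) (hs : Continuous s)
    (hsΩ : tsupport s ⊆ omegaOpen M A ε) (L : GL (Fin n₂) ℝ) :
    Continuous (upsilon A X lam J ε μ L s) := by
  refine continuous_iff_continuousAt.2 fun m => ?_
  by_cases hm : m ∈ omegaOpen M A ε
  · have hmaps : MapsTo (phi A X lam J ε) (omegaOpen M A ε) (beta A X lam J '' openCube n₂ ε) :=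
      mapsTo_iff_image_subset.2 (phi_image_omegaOpen h hεO).subset
    have hψΦ : ContinuousAt (fun m => psi A X lam J ε μ (phi A X lam J ε m)) m :=
      (hψ.1.comp (continuousOn_phi h hεO) hmaps).continuousAt
        ((isOpen_omegaOpen h hεO).mem_nhds hm)
    exact (Complex.continuous_ofReal.continuousAt.comp
      (Real.continuous_sqrt.continuousAt.comp (hψΦ.mul continuousAt_const))).mul hs.continuousAt
  · have hmem : (tsupport s)ᶜ ∈ 𝓝 m :=
      (isClosed_tsupport s).isOpen_compl.mem_nhds fun hms => hm (hsΩ hms)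
    refine (continuousAt_const (y := (0 : ℂ))).congr ?_
    filter_upwards [hmem] with x hx
    simp [upsilon, image_eq_zero_of_notMem_tsupport hx]

theorem continuous_enorm_upsilon_sq (h : CoadjointCoords hM lam X A J O)
    (hεO : closedCube n₂ ε ⊆ O) (hψ : IsHaarDensity A X lam J ε μ (psi A X lam J ε μ))
    (hs : Continuous s) (hsΩ : tsupport s ⊆ omegaOpen M A ε) (L : GL (Fin n₂) ℝ) :
    Continuous fun m => ‖upsilon A X lam J ε μ L s m‖ₑ ^ 2 :=
  (ENNReal.continuous_pow 2).comp (continuous_upsilon h hεO hψ hs hsΩ L).enorm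

theorem continuous_upsilonSum [LocallyCompactSpace M] (h : CoadjointCoords hM lam X A J O)
    (hεO : closedCube n₂ ε ⊆ O) (hψ : IsHaarDensity A X lam J ε μ (psi A X lam J ε μ))
    (hs : Continuous s) (hsc : HasCompactSupport s) (hsΩ : tsupport s ⊆ omegaOpen M A ε)
    {L : GL (Fin n₂) ℝ} {ΓM : Set M} (hinf : 0 < ⨅ m, upsilonSum A X lam J ε μ L s ΓM m)
    (hsup : ⨆ m, upsilonSum A X lam J ε μ L s ΓM m < ⊤) :
    Continuous (upsilonSum A X lam J ε μ L s ΓM) := by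
  obtain ⟨m₀, hm₀⟩ := exists_enorm_upsilon_sq_ne_zero hinf
  have hcompact := (hasCompactSupport_upsilon (μ := μ) (A := A) (X := X) (lam := lam) (J := J)
    (ε := ε) hsc L).comp_left (g := fun w => ‖w‖ₑ ^ 2) (by simp)
  exact continuous_tsum_mul_left (continuous_enorm_upsilon_sq h hεO hψ hs hsΩ L) hcompact hm₀
    fun m => ((le_iSup (upsilonSum A X lam J ε μ L s ΓM) m).trans_lt hsup).ne

theorem countable_of_iSup_upsilonSum_lt_top [SigmaCompactSpace M]
    (h : CoadjointCoords hM lam X A J O) (hεO : closedCube n₂ ε ⊆ O)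
    (hψ : IsHaarDensity A X lam J ε μ (psi A X lam J ε μ)) (hs : Continuous s)
    (hsΩ : tsupport s ⊆ omegaOpen M A ε) {L : GL (Fin n₂) ℝ} {ΓM : Set M}
    (hinf : 0 < ⨅ m, upsilonSum A X lam J ε μ L s ΓM m)
    (hsup : ⨆ m, upsilonSum A X lam J ε μ L s ΓM m < ⊤) : ΓM.Countable := by
  obtain ⟨m₀, hm₀⟩ := exists_enorm_upsilon_sq_ne_zero hinf
  exact countable_of_tsum_ne_top (continuous_enorm_upsilon_sq h hεO hψ hs hsΩ L) hm₀
    fun m => ((le_iSup (upsilonSum A X lam J ε μ L s ΓM) m).trans_lt hsup).ne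

variable [BorelSpace G]

section Coefficient

variable [P.Normal] [μ.IsMulLeftInvariant] {χ : P →ₜ* Circle}

theorem inner_indRep_latticePoint (h : CoadjointCoords hM lam X A J O) (hεO : closedCube n₂ ε ⊆ O)
    (hPM : P.IsComplement' M)
    (hP : (P : Set G) = lieExp '' (𝔭 : Set (GroupLieAlgebra (𝓡 d) G)))
    (hχ : IsExpCharacter lam χ) (hs : MemLp s 2 μ) (hsΩ : tsupport s ⊆ omegaOpen M A ε)
    (L : GL (Fin n₂) ℝ) (z : Fin n₂ → ℤ) (γ : M) (f : Lp ℂ 2 μ) :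
    ⟪f, indRep hPM χ μ ((γ : G)⁻¹ * latticePoint hP X J L z) (hs.toLp s)⟫_ℂ =
      ∫ m, Circle.coeHom (basisCharacter (dualBasis L) z (phi A X lam J ε m)) *
        (s m * (starRingEnd ℂ) (f (γ⁻¹ * m))) ∂μ := by
  rw [inner_indRep]
  congr 1 with m
  by_cases hm : m ∈ tsupport s
  · rw [character_conjP_latticePoint h hεO hP hχ L z (hsΩ hm)]
  · simp only [image_eq_zero_of_notMem_tsupport hm, zero_mul, mul_zero]

end Coefficient

theorem lintegral_covol_mul_psi_mul_enorm_sq [μ.IsMulLeftInvariant]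
    (h : CoadjointCoords hM lam X A J O) (hεO : closedCube n₂ ε ⊆ O)
    (hψ : IsHaarDensity A X lam J ε μ (psi A X lam J ε μ)) (hsΩ : tsupport s ⊆ omegaOpen M A ε)
    (L : GL (Fin n₂) ℝ) (γ : M) (f : M → ℂ) :
    ∫⁻ m, ENNReal.ofReal (covol (dualBasis L) * psi A X lam J ε μ (phi A X lam J ε m)) *
        ‖s m * (starRingEnd ℂ) (f (γ⁻¹ * m))‖ₑ ^ 2 ∂μ =
      ∫⁻ m, ‖upsilon A X lam J ε μ L s (γ * m)‖ₑ ^ 2 * ‖f m‖ₑ ^ 2 ∂μ := by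
  rw [← lintegral_mul_left_eq_self _ γ]
  refine lintegral_congr fun m => ?_
  rw [enorm_upsilon_sq h hεO hψ hsΩ, inv_mul_cancel_left, enorm_mul, mul_pow, mul_assoc,
    RCLike.enorm_conj]

variable [SecondCountableTopology G] [P.Normal] [LocallyCompactSpace M] [μ.IsHaarMeasure]
  {χ : P →ₜ* Circle}

theorem tsum_enorm_sq_inner_indRep_latticePoint (h : CoadjointCoords hM lam X A J O) (hε : 0 < ε)
    (hεO : closedCube n₂ ε ⊆ O) (hPM : P.IsComplement' M)
    (hP : (P : Set G) = lieExp '' (𝔭 : Set (GroupLieAlgebra (𝓡 d) G)))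
    (hχ : IsExpCharacter lam χ) (hs : Continuous s) (hsc : HasCompactSupport s)
    (hs2 : MemLp s 2 μ) (hsΩ : tsupport s ⊆ omegaOpen M A ε) {L : GL (Fin n₂) ℝ}
    {F : Set (Fin n₂ → ℝ)} (hF : IsAddFundamentalDomain (dualLattice L) F volume)
    (hsF : phi A X lam J ε '' tsupport s ⊆ F) (γ : M) (f : Lp ℂ 2 μ) :
    ∑' z, ‖⟪f, indRep hPM χ μ ((γ : G)⁻¹ * latticePoint hP X J L z) (hs2.toLp s)⟫_ℂ‖ₑ ^ 2 =
      ∫⁻ m, ‖upsilon A X lam J ε μ L s (γ * m)‖ₑ ^ 2 * ‖f m‖ₑ ^ 2 ∂μ := by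
  have hψ := isHaarDensity_psi h hε hεO μ
  have himage := phi_image_omegaOpen h hεO
  have hV : MeasurableSet (phi A X lam J ε '' omegaOpen M A ε) :=
    himage ▸ (isOpen_beta_image_openCube h hεO).measurableSet
  have hΨ : Measurable ((phi A X lam J ε '' omegaOpen M A ε).indicator (psi A X lam J ε μ)) := by
    classical
    rw [← piecewise_eq_indicator]
    exact (himage ▸ hψ.1).measurable_piecewise continuousOn_const hV
  obtain ⟨r, hr, hrΦ⟩ := exists_measurable_leftInvOn_phi h hεO
  obtain ⟨C, hC⟩ := (continuous_upsilon h hεO hψ hs hsΩ L).bounded_above_of_compact_support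
    (hasCompactSupport_upsilon hsc L)
  have hmeas : Measurable fun m => s m * (starRingEnd ℂ) (f (γ⁻¹ * m)) :=
    hs.measurable.mul (Complex.continuous_conj.measurable.comp
      ((Lp.stronglyMeasurable f).measurable.comp (measurable_const_mul _)))
  have hzero : ∀ m ∉ tsupport s, s m * (starRingEnd ℂ) (f (γ⁻¹ * m)) = 0 := fun m hm => by
    rw [image_eq_zero_of_notMem_tsupport hm, zero_mul]
  rw [dualLattice_eq_span_dualBasis] at hF
  simp only [inner_indRep_latticePoint h hεO hPM hP hχ hs2 hsΩ]
  rw [← lintegral_covol_mul_psi_mul_enorm_sq h hεO hψ hsΩ]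
  refine tsum_enorm_sq_setIntegral_basisCharacter (isOpen_omegaOpen h hεO).measurableSet
    (continuousOn_phi h hεO).domRestrict.measurable hr hrΦ hV hΨ
    (fun ξ hξ => (hψ.2.1 ξ (himage ▸ hξ)).le) (himage.symm ▸ hψ.2.2) (dualBasis L) hF hmeas
    (fun m hm => hzero m fun hms => hm (hsΩ hms))
    (fun m hm => hzero m fun hms => hm (hsF (mem_image_of_mem _ hms))) ?_
  rw [lintegral_covol_mul_psi_mul_enorm_sq h hεO hψ hsΩ]
  exact lintegral_enorm_sq_mul_ne_top (fun m => hC (γ * m)) f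

theorem tsum_enorm_sq_inner_indRep_gammaSet (h : CoadjointCoords hM lam X A J O) (hε : 0 < ε)
    (hεO : closedCube n₂ ε ⊆ O) (hPM : P.IsComplement' M)
    (hP : (P : Set G) = lieExp '' (𝔭 : Set (GroupLieAlgebra (𝓡 d) G)))
    (hχ : IsExpCharacter lam χ) (hs : Continuous s) (hsc : HasCompactSupport s)
    (hs2 : MemLp s 2 μ) (hsΩ : tsupport s ⊆ omegaOpen M A ε) {L : GL (Fin n₂) ℝ}
    {F : Set (Fin n₂ → ℝ)} (hF : IsAddFundamentalDomain (dualLattice L) F volume)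
    (hsF : phi A X lam J ε '' tsupport s ⊆ F) {ΓM : Set M} (hΓM : ΓM.Countable) (f : Lp ℂ 2 μ) :
    ∑' κ : gammaSet X J L ΓM, ‖⟪f, indRep hPM χ μ (κ : G) (hs2.toLp s)⟫_ℂ‖ₑ ^ 2 =
      ∫⁻ m, upsilonSum A X lam J ε μ L s ΓM m * ‖f m‖ₑ ^ 2 ∂μ := by
  have : Countable ΓM := hΓM.to_subtype
  have hmeas := (continuous_enorm_upsilon_sq h hεO (isHaarDensity_psi h hε hεO μ) hs hsΩ
    L).measurable
  rw [tsum_gammaSet h hε hεO hPM hP hχ L ΓM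
    fun κ => ‖⟪f, indRep hPM χ μ κ (hs2.toLp s)⟫_ℂ‖ₑ ^ 2]
  simp only [tsum_enorm_sq_inner_indRep_latticePoint h hε hεO hPM hP hχ hs hsc hs2 hsΩ hF hsF]
  simp only [upsilonSum, ← ENNReal.tsum_mul_right]
  exact (lintegral_tsum fun γ : ΓM => ((hmeas.comp (measurable_const_mul (γ : M))).mul
    ((Lp.stronglyMeasurable f).measurable.enorm.pow_const 2)).aemeasurable).symm

end FrameIdentity

end

end SolvFrame

open SolvFrame in
theorem theorem2_general
    {d : ℕ} {G : Type*} [TopologicalSpace G] [ChartedSpace (EuclideanSpace ℝ (Fin d)) G]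
    [Group G] [LieGroup (𝓡 d) ∞ G] [IsTopologicalGroup G] [T2Space G]
    [MeasurableSpace G] [BorelSpace G] (P M : Subgroup G) [P.Normal]
    (hMc : IsClosed (M : Set G)) (hPM : P.IsComplement' M)
    (𝔭 : LieIdeal ℝ (GroupLieAlgebra (𝓡 d) G)) (𝔪 : LieSubalgebra ℝ (GroupLieAlgebra (𝓡 d) G))
    (h𝔭𝔪 : IsCompl 𝔭.toSubmodule 𝔪.toSubmodule)
    (hP : (P : Set G) = lieExp '' (𝔭 : Set (GroupLieAlgebra (𝓡 d) G)))
    (hM : (M : Set G) = lieExp '' (𝔪 : Set (GroupLieAlgebra (𝓡 d) G)))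
    (μ : Measure M) [μ.IsHaarMeasure] (lam : Module.Dual ℝ 𝔭) (χ : P →ₜ* Circle)
    (hχ : ∀ (Y : 𝔭) (hY : lieExp (Y : GroupLieAlgebra (𝓡 d) G) ∈ P),
      χ ⟨lieExp (Y : GroupLieAlgebra (𝓡 d) G), hY⟩ = Circle.exp (2 * Real.pi * lam Y))
    {n₁ n₂ : ℕ} (X : Module.Basis (Fin n₁) ℝ 𝔭)
    (A : Module.Basis (Fin n₂) ℝ 𝔪) (J : Fin n₂ ↪o Fin n₁) (O : Set (Fin n₂ → ℝ))
    (hO : IsDiffeoOn (beta A X lam J) O) (ε : ℝ) (hε : 0 < ε) (hεO : closedCube n₂ ε ⊆ O)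
    (s : M → ℂ) (hs : Continuous s) (hsc : HasCompactSupport s)
    (hsΩ : tsupport s ⊆ omegaOpen M A ε) (L : GL (Fin n₂) ℝ)
    (hL : ∃ F : Set (Fin n₂ → ℝ), IsAddFundamentalDomain (dualLattice L) F volume ∧
      phi A X lam J ε '' tsupport s ⊆ F)
    (ΓM : Set M) (hinf : 0 < ⨅ m, upsilonSum A X lam J ε μ L s ΓM m)
    (hsup : ⨆ m, upsilonSum A X lam J ε μ L s ΓM m < ⊤) :
    let sL2 : Lp ℂ 2 μ := (hs.memLp_of_hasCompactSupport hsc).toLp s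
    let system : gammaSet X J L ΓM → Lp ℂ 2 μ := fun κ => indRep hPM χ μ (κ : G) sL2
    IsFrame system ∧
    IsGreatest {a | IsLowerFrameBound system a}
      (⨅ m, upsilonSum A X lam J ε μ L s ΓM m).toReal ∧
    IsLeast {b | IsUpperFrameBound system b}
      (⨆ m, upsilonSum A X lam J ε μ L s ΓM m).toReal := by
  intro sL2 system
  have h : CoadjointCoords hM lam X A J O := coadjointCoords hPM h𝔭𝔪 hP hM lam X A J
    (hεO (openCube_subset_closedCube n₂ ε (zero_mem_openCube n₂ hε))) hO
  have : LocallyCompactSpace G := ChartedSpace.locallyCompactSpace (EuclideanSpace ℝ (Fin d)) G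
  have : SecondCountableTopology G := secondCountableTopology_of_isComplement' hPM hP hM
  have : LocallyCompactSpace M := hMc.isClosedEmbedding_subtypeVal.locallyCompactSpace
  have : SigmaCompactSpace M := hMc.isClosedEmbedding_subtypeVal.sigmaCompactSpace
  have hψ : IsHaarDensity A X lam J ε μ (psi A X lam J ε μ) := isHaarDensity_psi h hε hεO μ
  obtain ⟨F, hF, hsF⟩ := hL
  have hcont : Continuous (upsilonSum A X lam J ε μ L s ΓM) :=
    continuous_upsilonSum h hεO hψ hs hsc hsΩ hinf hsup
  have hcountable : ΓM.Countable :=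
    countable_of_iSup_upsilonSum_lt_top h hεO hψ hs hsΩ hinf hsup
  exact frame_of_multiplier hcont (fun f => tsum_enorm_sq_inner_indRep_gammaSet h hε hεO hPM hP
    hχ hs hsc (hs.memLp_of_hasCompactSupport hsc) hsΩ hF hsF hcountable f) hinf hsup

open SolvFrame in
theorem theorem2
    -- a connected, simply connected, completely solvable Lie group
    {d : ℕ} {G : Type*} [TopologicalSpace G] [ChartedSpace (EuclideanSpace ℝ (Fin d)) G]
    [Group G] [LieGroup (𝓡 d) ∞ G] [IsTopologicalGroup G] [T2Space G] [SimplyConnectedSpace G]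
    [MeasurableSpace G] [BorelSpace G]
    (hG : IsCompletelySolvable (GroupLieAlgebra (𝓡 d) G))
    -- `G = P ⋊ M` with `P = exp 𝔭`, `M = exp 𝔪` closed
    (P M : Subgroup G) [P.Normal] (hPc : IsClosed (P : Set G)) (hMc : IsClosed (M : Set G))
    (hPM : P.IsComplement' M)
    (𝔭 : LieIdeal ℝ (GroupLieAlgebra (𝓡 d) G)) (𝔪 : LieSubalgebra ℝ (GroupLieAlgebra (𝓡 d) G))
    (h𝔭𝔪 : IsCompl 𝔭.toSubmodule 𝔪.toSubmodule)
    (hP : (P : Set G) = lieExp '' (𝔭 : Set (GroupLieAlgebra (𝓡 d) G)))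
    (hM : (M : Set G) = lieExp '' (𝔪 : Set (GroupLieAlgebra (𝓡 d) G)))
    (μ : Measure M) [μ.IsHaarMeasure]
    -- the unitary character `χ_λ (exp Y) = e^{2πi λ(Y)}` of `P`, and `π_λ` irreducible
    (lam : Module.Dual ℝ 𝔭) (χ : P →ₜ* Circle)
    (hχ : ∀ (Y : 𝔭) (hY : lieExp (Y : GroupLieAlgebra (𝓡 d) G) ∈ P),
      χ ⟨lieExp (Y : GroupLieAlgebra (𝓡 d) G), hY⟩ = Circle.exp (2 * Real.pi * lam Y))
    (hirr : IsIrreducibleRep (indRep hPM χ μ))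
    -- strong Malcev bases, the index set `J(λ)`, the neighbourhood `O` and `ε`
    {n₁ n₂ : ℕ} (X : Module.Basis (Fin n₁) ℝ 𝔭) (hX : IsStrongMalcev X)
    (A : Module.Basis (Fin n₂) ℝ 𝔪) (hA : IsStrongMalcev A)
    (J : Fin n₂ ↪o Fin n₁) (hJ : ((jacZero A X lam).submatrix J id).det ≠ 0)
    (O : Set (Fin n₂ → ℝ)) (hO0 : 0 ∈ O) (hO : IsDiffeoOn (beta A X lam J) O)
    (ε : ℝ) (hε : 0 < ε) (hεO : closedCube n₂ ε ⊆ O)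
    -- the smooth function `s`, the operator `L` and the set `Γ_M`
    (s : M → ℂ) (hs : IsSmoothFun d s) (hsc : HasCompactSupport s)
    (hsΩ : tsupport s ⊆ omegaOpen M A ε)
    (L : GL (Fin n₂) ℝ)
    (hL : ∃ F : Set (Fin n₂ → ℝ), IsAddFundamentalDomain (dualLattice L) F volume ∧
      phi A X lam J ε '' tsupport s ⊆ F)
    (ΓM : Set M) (hΓM : IsDiscrete ΓM)
    (hinf : 0 < ⨅ m, upsilonSum A X lam J ε μ L s ΓM m)
    (hsup : ⨆ m, upsilonSum A X lam J ε μ L s ΓM m < ⊤) :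
    let sL2 : Lp ℂ 2 μ := (hs.continuous.memLp_of_hasCompactSupport hsc).toLp s
    let system : gammaSet X J L ΓM → Lp ℂ 2 μ := fun κ => indRep hPM χ μ (κ : G) sL2
    IsFrame system ∧
    IsGreatest {a | IsLowerFrameBound system a}
      (⨅ m, upsilonSum A X lam J ε μ L s ΓM m).toReal ∧
    IsLeast {b | IsUpperFrameBound system b}
      (⨆ m, upsilonSum A X lam J ε μ L s ΓM m).toReal := by
  exact theorem2_general P M hMc hPM 𝔭 𝔪 h𝔭𝔪 hP hM μ lam χ hχ X A J O hO ε hε hεO s hs.continuous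
    hsc hsΩ L hL ΓM hinf hsup
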